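/- **Definitions.** Let $T[1,n]$ be a text over an ordered alphabet $\Sigma$ of constant size $\sigma$ whose last character $T[n]$ is smaller than all its other characters (and hence occurs only once). The suffix array $\mathsf{sa}[1,n]$ is the permutation of $[1,n]$ that lists the suffixes $T[i,n]$ in increasing lexicographic order, $\mathsf{pos}=\mathsf{sa}^{-1}$ is its inverse, and for a sampling step $d$ with $1\le d\le n$, $\mathsf{pos}_d$ is the array of the $\lfloor n/d\rfloor$ values $\mathsf{pos}[d],\mathsf{pos}[2d],\dots,\mathsf{pos}[\lfloor n/d\rfloor d]$, one word per value. *Machine.* A word RAM with words of $w=\Theta(\log n)$ bits (precisely, $n<2^w$ and $w=O(\log n)$), a constant number of registers, and an internal memory of $M\le n$ words; arithmetic, bitwise and comparison operations on words, memory accesses, and reading, writing, or moving by one bit on a disk take one unit of CPU time each. There are three disks, which are bit strings with one sequentially moving head each: a read-only input disk holding $T$ with $\lceil\log_2\sigma\rceil$ bits per character, an output disk with exactly the space for $\mathsf{pos}_d$ (that is, $\lfloor n/d\rfloor\, w$ bits), and a work disk. The disk working space is the capacity of the work disk. A pass is a maximal scan of one disk in one direction; the number of passes is summed over the disks. Disks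 are divided into pages of $B$ consecutive words, $1\le B\le M$ and $B\log n=O(n)$; there is one page buffer per disk, and an I/O is the fetching or writing back of the page under a head. **Theorem.** For every constant $\sigma$ there is a program that, for all $n\ge 2$, all texts $T[1,n]$ as above, all $w$, $M$, $B$ as above, and all sampling steps $d=\Omega(\log n)$ with $d\le n$, given $T$ on the input disk and $n,M,d,w$ in its registers, halts with $\mathsf{pos}_d$ on the output disk, and does so in $O(n/M)$ passes over disks holding $\Theta(n)$ bits in total, with exactly $n$ bits of disk working space, with $O\bigl(n^2/(MB\log n)\bigr)$ I/Os, and in $O(n^2/M)$ CPU time. The constants hidden in these bounds depend only on $\sigma$ and on the constants in the assumptions $d=\Omega(\log n)$, $w=O(\log n)$ and $B\log n=O(n)$. -/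

import Mathlib

/-! ## Texts, suffix arrays, and the sampled inverse suffix array -/

namespace SuffixIndex

/-- `T` is a text: its last character is smaller than, hence different from, all the others. -/
def IsText {σ n : ℕ} (T : Fin n → Fin σ) : Prop :=
  ∀ i j : Fin n, (j : ℕ) + 1 = n → i ≠ j → T j < T i

/-- The suffix of `T` that starts at the (0-based) position `i`. -/
def suffix {σ n : ℕ} (T : Fin n → Fin σ) (i : Fin n) : List (Fin σ) :=
  (List.ofFn T).drop i

/-- The suffix array: the permutation that sorts the suffixes of `T` lexicographically. -/
def sa {σ n : ℕ} (T : Fin n → Fin σ) : Equiv.Perm (Fin n) :=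
  Tuple.sort (suffix T)

/-- The suffix array lists the suffixes in strictly increasing lexicographic order. -/
theorem sa_strictMono {σ n : ℕ} (T : Fin n → Fin σ) :
    StrictMono (fun i => suffix T (sa T i)) := by
  have hinj : Function.Injective (suffix T) := by
    intro i j h
    have h' := congrArg List.length h
    simp only [suffix, List.length_drop, List.length_ofFn] at h'
    have hi := i.isLt
    have hj := j.isLt
    exact Fin.ext (by omega)
  exact (Tuple.monotone_sort (suffix T)).strictMono_of_injective
    (hinj.comp (sa T).injective)

/-- The inverse suffix array: the rank, counted from 1, of the suffix starting at the (0-based)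
position `i` among all suffixes. -/
def pos {σ n : ℕ} (T : Fin n → Fin σ) (i : Fin n) : ℕ :=
  ((sa T).symm i : ℕ) + 1

/-- The word in slot `k` of a bit string cut into slots of `w` bits, most significant bit first,
is the number `v`. -/
def HoldsWord (w : ℕ) (tape : ℕ → Bool) (k v : ℕ) : Prop :=
  ∀ b < w, tape (k * w + (w - 1 - b)) = v.testBit b

/-- The bit string `tape` holds the `⌊n / d⌋` words `pos[d], pos[2d], pos[3d], …` in this order
(1-based positions). -/
def HoldsPosD {σ n : ℕ} (T : Fin n → Fin σ) (d w : ℕ) (tape : ℕ → Bool) : Prop :=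
  ∀ (k : ℕ) (i : Fin n), (i : ℕ) + 1 = (k + 1) * d → HoldsWord w tape k (pos T i)

/-- The bit string that encodes `T`, every character with `⌈log₂ σ⌉` bits, most significant bit
first. -/
def encodeText {σ n : ℕ} (T : Fin n → Fin σ) (p : ℕ) : Bool :=
  if h : p / Nat.clog 2 σ < n then
    (T ⟨p / Nat.clog 2 σ, h⟩ : ℕ).testBit (Nat.clog 2 σ - 1 - p % Nat.clog 2 σ)
  else false

end SuffixIndex

/-! ## A word RAM with sequentially accessed disks

The CPU has a fixed finite set of registers (those occurring in the program) and an internal memory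
of `M` words. A word has `w` bits. There are three disks: a read-only one for the input, one for the
output and one for the working space. Each disk is a string of bits of bounded length with a single
head, which moves to an adjacent bit in one step. Consecutive groups of `B` words form a page, and
each disk has a buffer for the page under its head. -/

namespace ExtMem

inductive Disk
  | input
  | output
  | work
  deriving DecidableEq

inductive Dir
  | toLeft
  | toRight
  deriving DecidableEq

/-- The operations of the CPU on words. -/
inductive BinOp
  | add | sub | mul | div | mod | land | lor | xor | shl | shr | lt | eq

/-- Arithmetic is modulo `2 ^ w`; comparisons return `1` or `0`. -/
def BinOp.eval (w : ℕ) : BinOp → ℕ → ℕ → ℕ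
  | .add, a, b => (a + b) % 2 ^ w
  | .sub, a, b => (a + (2 ^ w - b)) % 2 ^ w
  | .mul, a, b => (a * b) % 2 ^ w
  | .div, a, b => (a / b) % 2 ^ w
  | .mod, a, b => (a % b) % 2 ^ w
  | .land, a, b => (a &&& b) % 2 ^ w
  | .lor, a, b => (a ||| b) % 2 ^ w
  | .xor, a, b => (a ^^^ b) % 2 ^ w
  | .shl, a, b => (a <<< b) % 2 ^ w
  | .shr, a, b => (a >>> b) % 2 ^ w
  | .lt, a, b => if a < b then 1 else 0
  | .eq, a, b => if a = b then 1 else 0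

/-- Expressions over constants and registers. -/
inductive Expr
  | lit (v : ℕ)
  | reg (r : ℕ)
  | bin (o : BinOp) (e₁ e₂ : Expr)

def Expr.eval (w : ℕ) (ρ : ℕ → ℕ) : Expr → ℕ
  | .lit v => v % 2 ^ w
  | .reg r => ρ r
  | .bin o e₁ e₂ => o.eval w (e₁.eval w ρ) (e₂.eval w ρ)

/-- The number of steps that the evaluation of an expression takes. -/
def Expr.cost : Expr → ℕ
  | .lit _ => 1
  | .reg _ => 1
  | .bin _ e₁ e₂ => e₁.cost + e₂.cost + 1

/-- Programs. -/
inductive Cmd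
  | nop
  /-- `r := e` -/
  | assign (r : ℕ) (e : Expr)
  /-- `r := memory[a]` -/
  | load (r : ℕ) (a : Expr)
  /-- `memory[a] := e` -/
  | store (a e : Expr)
  /-- `r :=` the bit under the head of disk `k` -/
  | read (r : ℕ) (k : Disk)
  /-- the bit under the head of disk `k` becomes the lowest bit of `e` -/
  | write (k : Disk) (e : Expr)
  /-- move the head of disk `k` by one bit -/
  | move (k : Disk) (δ : Dir)
  | seq (p q : Cmd)
  /-- run `p` if `e ≠ 0`, and `q` otherwise -/
  | cond (e : Expr) (p q : Cmd)
  /-- run `p` as long as `e ≠ 0` -/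
  | loop (e : Expr) (p : Cmd)

/-- A machine: word length in bits, internal memory in words, page size in words, and the capacity
of each disk in bits. -/
structure Machine where
  w : ℕ
  M : ℕ
  B : ℕ
  size : Disk → ℕ

/-- A configuration of the machine together with the resources used so far. -/
structure State where
  reg : ℕ → ℕ
  mem : ℕ → ℕ
  tape : Disk → ℕ → Bool
  head : Disk → ℕ
  /-- the direction of the scan under way on each disk -/
  dir : Disk → Option Dir
  /-- CPU steps -/
  time : ℕ
  /-- maximal monotone scans by a head, summed over all disks -/
  passes : ℕ
  /-- pages fetched or written back, summed over all disks -/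
  pageAccesses : ℕ

namespace State

def tick (s : State) (t : ℕ) : State := { s with time := s.time + t }

def setReg (s : State) (r v : ℕ) : State := { s with reg := Function.update s.reg r v }

def setMem (s : State) (a v : ℕ) : State := { s with mem := Function.update s.mem a v }

/-- Write `b` under the head of disk `k`. -/
def setBit (s : State) (k : Disk) (b : Bool) : State :=
  { s with tape := Function.update s.tape k (Function.update (s.tape k) (s.head k) b) }

/-- Move the head of disk `k` in direction `δ` to the bit `p`. If this is not the direction of the
scan under way on `k`, a new pass begins. If `p` is on another page, the old page is written back
and the new one is fetched. -/
def moveTo (m : Machine) (s : State) (k : Disk) (δ : Dir) (p : ℕ) : State :=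
  { s with
    head := Function.update s.head k p
    dir := Function.update s.dir k (some δ)
    passes := s.passes + if s.dir k = some δ then 0 else 1
    pageAccesses := s.pageAccesses +
      if s.head k / (m.B * m.w) = p / (m.B * m.w) then 0 else 2 }

end State

/-- `Exec m P s t`: program `P`, started in `s` on the machine `m`, halts in `t`. A program that
addresses a word outside the internal memory, reads or writes outside a disk, moves a head further
than just behind the end of a disk, or writes on the input disk gets stuck and does not halt. -/
inductive Exec (m : Machine) : Cmd → State → State → Prop
  | nop (s : State) : Exec m .nop s (s.tick 1)
  | assign (s : State) (r : ℕ) (e : Expr) :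
      Exec m (.assign r e) s ((s.setReg r (e.eval m.w s.reg)).tick (1 + e.cost))
  | load (s : State) (r : ℕ) (a : Expr) (ha : a.eval m.w s.reg < m.M) :
      Exec m (.load r a) s ((s.setReg r (s.mem (a.eval m.w s.reg))).tick (1 + a.cost))
  | store (s : State) (a e : Expr) (ha : a.eval m.w s.reg < m.M) :
      Exec m (.store a e) s
        ((s.setMem (a.eval m.w s.reg) (e.eval m.w s.reg)).tick (1 + a.cost + e.cost))
  | read (s : State) (r : ℕ) (k : Disk) (hk : s.head k < m.size k) :
      Exec m (.read r k) s ((s.setReg r (s.tape k (s.head k)).toNat).tick 1)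
  | write (s : State) (k : Disk) (e : Expr) (hk : s.head k < m.size k) (hi : k ≠ .input) :
      Exec m (.write k e) s ((s.setBit k ((e.eval m.w s.reg).testBit 0)).tick (1 + e.cost))
  | moveLeft (s : State) (k : Disk) (hk : 0 < s.head k) :
      Exec m (.move k .toLeft) s ((s.moveTo m k .toLeft (s.head k - 1)).tick 1)
  | moveRight (s : State) (k : Disk) (hk : s.head k < m.size k) :
      Exec m (.move k .toRight) s ((s.moveTo m k .toRight (s.head k + 1)).tick 1)
  | seq {p q : Cmd} {s t u : State} (hp : Exec m p s t) (hq : Exec m q t u) :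
      Exec m (.seq p q) s u
  | condTrue {e : Expr} {p q : Cmd} {s t : State} (he : e.eval m.w s.reg ≠ 0)
      (hp : Exec m p (s.tick (1 + e.cost)) t) : Exec m (.cond e p q) s t
  | condFalse {e : Expr} {p q : Cmd} {s t : State} (he : e.eval m.w s.reg = 0)
      (hq : Exec m q (s.tick (1 + e.cost)) t) : Exec m (.cond e p q) s t
  | loopDone {e : Expr} {p : Cmd} {s : State} (he : e.eval m.w s.reg = 0) :
      Exec m (.loop e p) s (s.tick (1 + e.cost))
  | loopStep {e : Expr} {p : Cmd} {s t u : State} (he : e.eval m.w s.reg ≠ 0)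
      (hp : Exec m p (s.tick (1 + e.cost)) t) (hl : Exec m (.loop e p) t u) :
      Exec m (.loop e p) s u

/-- The machine for a text of length `n` over an alphabet of size `σ` and the sampling step `d`:
beside the disk space for the input (`n` characters) and for the output (`⌊n / d⌋` words) it has
exactly `n` bits of disk working space. -/
def posMachine (σ n d w M B : ℕ) : Machine where
  w := w
  M := M
  B := B
  size
    | .input => n * Nat.clog 2 σ
    | .output => n / d * w
    | .work => n

/-- The initial state: the text is on the input disk, the first four registers hold `n`, `M`, `d`
and `w`, everything else is zero, and the heads are at the beginning of the disks. The first fetch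
and the last write-back of each of the three disks are charged in advance. -/
def posInit {σ n : ℕ} (T : Fin n → Fin σ) (d w M : ℕ) : State where
  reg
    | 0 => n
    | 1 => M
    | 2 => d
    | 3 => w
    | _ => 0
  mem := fun _ => 0
  tape
    | .input => SuffixIndex.encodeText T
    | _ => fun _ => false
  head := fun _ => 0
  dir := fun _ => none
  time := 0
  passes := 0
  pageAccesses := 6

end ExtMem

/-! The text is cut into blocks of m = Θ(M) characters, processed from right to left. One block
costs two sweeps over the three disks, rightwards and back, and O(n) time, so there are O(n/M)
passes in all. When the text from b on has been processed, the slot of each sampled position j ≥ b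
holds 1 plus the number of p ≥ b whose suffix is smaller than that at j. A new block [a, b) must
raise these values by the number of its suffixes below suffix j, and must create the values of its
own sampled positions.

Sorting the block. Its suffixes, together with the one at b, are sorted in internal memory, although
they may agree far beyond the block. It is enough to compare each of them with the suffix at b: if
the outcomes are added to the characters in the right way, the block becomes a string with a unique
last character whose suffixes are ordered like those of the text (`block_string`). The outcomes are
read off the Z-function of the next block followed by the current one; a match running to the end of
the block leads to a comparison of b with b + k, k ≤ m, remembered in `G` from the previous round.
The block string is sorted in linear time by recursion on the positions not divisible by three
(`triples`, `dc3_wp`), with an explicit stack.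

Updating the rest. Let F(j) be the number of the sorted suffixes, those at a, …, b, that are smaller
than suffix j. Backward search (`cnt_step`) obtains F(j) from F(j + 1), the character at j, and one
bit: is suffix b smaller than suffix j? These bits are all that the work disk holds, hence n bits
suffice. Once F(j) is known, the bit is overwritten by the comparison with suffix a that the next
block needs. The same scan adds to the slot of j and tallies F(j) in `GAP`. Prefix sums of the tally
count the later suffixes below each block suffix (`cumGap_eq_cnt`), which completes the slots of the
block (`slotVal_block`).

Costs. There are n/d slots of w bits; as d = Ω(log n) and w = O(log n), they take O(n) bits, and a
scan handles them in O(n) time. Words are stored from the most significant bit, so a leftward scan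
meets the lowest bit first and can add in place. Passes are counted with the potential `St.phi`, and
page accesses follow from the passes, since one pass meets every page boundary of a disk at most
once (`Exec.pageAccesses_le`).

The machine. The algorithm is verified in a small structured language with arrays and exact
arithmetic, by weakest preconditions that carry a clock; `compile_sound` transfers the result. Two
boundary cases remain. The internal memory may be smaller than any constant, so the arrays extend
into a number of registers depending only on σ (`spare`). And n may be so small that the constants
of the program exceed a word; these finitely many texts are answered from tables built into the
program (`lookup`). -/

set_option linter.constructorNameAsVariable false

namespace ExtMem

/-! ## A structured language on top of the machine -/

/-- Program variables. -/
inductive Var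
  | n | M | d | w | m | b | a | el | N | np | n1 | len | K | off | lev
  | i | j | k | l | r | p | q | x | y | z | u | v | c | f | g | rk | h | u0 | v0 | y0
  deriving DecidableEq

/-- Arrays in the internal memory. -/
inductive Arr
  | U | Z | G | S | RK | RB | A | B | C | CNT | LN | OCC | GAP | PREV
  deriving DecidableEq

/-- Arithmetic expressions, evaluated over the natural numbers. -/
inductive Ex
  | lit (v : ℕ)
  | var (x : Var)
  | add (e f : Ex)
  | sub (e f : Ex)
  | mul (e f : Ex)
  | div (e f : Ex)
  | mod (e f : Ex)

namespace Ex

instance : Coe Var Ex := ⟨Ex.var⟩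
instance (k : ℕ) : OfNat Ex k := ⟨.lit k⟩
instance : Add Ex := ⟨.add⟩
instance : Sub Ex := ⟨.sub⟩
instance : Mul Ex := ⟨.mul⟩
instance : Div Ex := ⟨.div⟩
instance : Mod Ex := ⟨.mod⟩

def val (ρ : Var → ℕ) : Ex → ℕ
  | lit v => v
  | var x => ρ x
  | add e f => e.val ρ + f.val ρ
  | sub e f => e.val ρ - f.val ρ
  | mul e f => e.val ρ * f.val ρ
  | div e f => e.val ρ / f.val ρ
  | mod e f => e.val ρ % f.val ρ

/-- No operation overflows or gives a negative result on words with values below `W`. -/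
def ok (W : ℕ) (ρ : Var → ℕ) : Ex → Prop
  | lit v => v < W
  | var _ => True
  | add e f => e.ok W ρ ∧ f.ok W ρ ∧ e.val ρ + f.val ρ < W
  | sub e f => e.ok W ρ ∧ f.ok W ρ ∧ f.val ρ ≤ e.val ρ ∧ e.val ρ < W
  | mul e f => e.ok W ρ ∧ f.ok W ρ ∧ e.val ρ * f.val ρ < W
  | div e f => e.ok W ρ ∧ f.ok W ρ ∧ e.val ρ < W
  | mod e f => e.ok W ρ ∧ f.ok W ρ ∧ e.val ρ < W

variable (ρ : Var → ℕ) (W : ℕ) (e f : Ex)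

theorem val_var (x : Var) : (var x).val ρ = ρ x := rfl
theorem val_lit (v : ℕ) : (lit v).val ρ = v := rfl
theorem val_ofNat (k : ℕ) : (no_index (OfNat.ofNat k : Ex)).val ρ = k := rfl
theorem val_add : (e + f).val ρ = e.val ρ + f.val ρ := rfl
theorem val_sub : (e - f).val ρ = e.val ρ - f.val ρ := rfl
theorem val_mul : (e * f).val ρ = e.val ρ * f.val ρ := rfl
theorem val_div : (e / f).val ρ = e.val ρ / f.val ρ := rfl
theorem val_mod : (e % f).val ρ = e.val ρ % f.val ρ := rfl
theorem ok_var (x : Var) : (var x).ok W ρ ↔ True := Iff.rfl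
theorem ok_lit (v : ℕ) : (lit v).ok W ρ ↔ v < W := Iff.rfl
theorem ok_ofNat (k : ℕ) : (no_index (OfNat.ofNat k : Ex)).ok W ρ ↔ k < W := Iff.rfl
theorem ok_add : (e + f).ok W ρ ↔ e.ok W ρ ∧ f.ok W ρ ∧ e.val ρ + f.val ρ < W := Iff.rfl
theorem ok_sub : (e - f).ok W ρ ↔ e.ok W ρ ∧ f.ok W ρ ∧ f.val ρ ≤ e.val ρ ∧ e.val ρ < W :=
  Iff.rfl
theorem ok_mul : (e * f).ok W ρ ↔ e.ok W ρ ∧ f.ok W ρ ∧ e.val ρ * f.val ρ < W := Iff.rfl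
theorem ok_div : (e / f).ok W ρ ↔ e.ok W ρ ∧ f.ok W ρ ∧ e.val ρ < W := Iff.rfl
theorem ok_mod : (e % f).ok W ρ ↔ e.ok W ρ ∧ f.ok W ρ ∧ e.val ρ < W := Iff.rfl

end Ex

/-- Conditions. -/
inductive Cn
  | lt (e f : Ex)
  | le (e f : Ex)
  | eq (e f : Ex)
  | and (c d : Cn)

def Cn.holds (ρ : Var → ℕ) : Cn → Prop
  | lt e f => e.val ρ < f.val ρ
  | le e f => e.val ρ ≤ f.val ρ
  | eq e f => e.val ρ = f.val ρ
  | and c d => c.holds ρ ∧ d.holds ρ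

def Cn.ok (W : ℕ) (ρ : Var → ℕ) : Cn → Prop
  | lt e f => e.ok W ρ ∧ f.ok W ρ
  | le e f => e.ok W ρ ∧ f.ok W ρ
  | eq e f => e.ok W ρ ∧ f.ok W ρ
  | and c d => c.ok W ρ ∧ d.ok W ρ

/-- Structured programs. -/
inductive Prog
  | skip
  | assign (x : Var) (e : Ex)
  | load (x : Var) (a : Arr) (e : Ex)
  | store (a : Arr) (e f : Ex)
  | read (x : Var) (k : Disk)
  | write (k : Disk) (e : Ex)
  | move (k : Disk) (δ : Dir)
  | seq (p q : Prog)
  | ite (c : Cn) (p q : Prog)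
  | loop (c : Cn) (p : Prog)

infixr:60 " ;; " => Prog.seq
infix:62 " ::= " => Prog.assign

/-- The word bound, the length of every array, and the capacities of the disks. -/
structure Env where
  W : ℕ
  L : ℕ
  size : Disk → ℕ

/-- Program states. -/
structure St where
  reg : Var → ℕ
  arr : Arr → ℕ → ℕ
  tape : Disk → ℕ → Bool
  head : Disk → ℕ
  dir : Disk → Option Dir
  passes : ℕ

namespace St

def set (s : St) (x : Var) (v : ℕ) : St := { s with reg := Function.update s.reg x v }

def setArr (s : St) (a : Arr) (i v : ℕ) : St :=
  { s with arr := Function.update s.arr a (Function.update (s.arr a) i v) }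

def setBit (s : St) (k : Disk) (b : Bool) : St :=
  { s with tape := Function.update s.tape k (Function.update (s.tape k) (s.head k) b) }

def moveTo (s : St) (k : Disk) (δ : Dir) (p : ℕ) : St :=
  { s with
    head := Function.update s.head k p
    dir := Function.update s.dir k (some δ)
    passes := s.passes + if s.dir k = some δ then 0 else 1 }

/-- The number of passes, if on every disk without a scan in direction `δ` one is begun. -/
def phi (s : St) (δ : Dir) : ℕ :=
  s.passes + (if s.dir .input = some δ then 0 else 1) +
    (if s.dir .output = some δ then 0 else 1) + (if s.dir .work = some δ then 0 else 1)

theorem phi_le (s : St) (δ ε : Dir) : s.phi δ ≤ s.phi ε + 3 := by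
  unfold phi
  split_ifs <;> omega

end St

/-- The weakest precondition of a loop whose body has the weakest precondition `F`. -/
inductive LoopWp (W : ℕ) (c : Cn) (F : (St → ℕ → Prop) → St → ℕ → Prop) (Q : St → ℕ → Prop) :
    St → ℕ → Prop
  | done {s : St} {τ : ℕ} (hc : c.ok W s.reg) (hs : ¬ c.holds s.reg) (hQ : Q s (τ + 1)) :
      LoopWp W c F Q s τ
  | step {s : St} {τ : ℕ} (R : St → ℕ → Prop) (hc : c.ok W s.reg) (hs : c.holds s.reg)
      (hF : F R s (τ + 1)) (hR : ∀ t τ', R t τ' → LoopWp W c F Q t τ') : LoopWp W c F Q s τ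

/-- The weakest precondition for `p` to halt in a state and at a time satisfying `Q`. -/
def wp (Γ : Env) : Prog → (St → ℕ → Prop) → St → ℕ → Prop
  | .skip, Q, s, τ => Q s (τ + 1)
  | .assign x e, Q, s, τ => e.ok Γ.W s.reg ∧ Q (s.set x (e.val s.reg)) (τ + 1)
  | .load x a e, Q, s, τ =>
      e.ok Γ.W s.reg ∧ e.val s.reg < Γ.L ∧ Q (s.set x (s.arr a (e.val s.reg))) (τ + 1)
  | .store a e f, Q, s, τ =>
      e.ok Γ.W s.reg ∧ f.ok Γ.W s.reg ∧ e.val s.reg < Γ.L ∧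
        Q (s.setArr a (e.val s.reg) (f.val s.reg)) (τ + 1)
  | .read x k, Q, s, τ =>
      s.head k < Γ.size k ∧ Q (s.set x (s.tape k (s.head k)).toNat) (τ + 1)
  | .write k e, Q, s, τ =>
      e.ok Γ.W s.reg ∧ s.head k < Γ.size k ∧ k ≠ .input ∧
        Q (s.setBit k ((e.val s.reg).testBit 0)) (τ + 1)
  | .move k .toLeft, Q, s, τ => 0 < s.head k ∧ Q (s.moveTo k .toLeft (s.head k - 1)) (τ + 1)
  | .move k .toRight, Q, s, τ =>
      s.head k < Γ.size k ∧ Q (s.moveTo k .toRight (s.head k + 1)) (τ + 1)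
  | .seq p q, Q, s, τ => wp Γ p (wp Γ q Q) s τ
  | .ite c p q, Q, s, τ =>
      c.ok Γ.W s.reg ∧ (c.holds s.reg → wp Γ p Q s (τ + 1)) ∧
        (¬ c.holds s.reg → wp Γ q Q s (τ + 1))
  | .loop c p, Q, s, τ => LoopWp Γ.W c (wp Γ p) Q s τ

theorem wp_mono {Γ : Env} {p : Prog} {Q R : St → ℕ → Prop} {s : St} {τ : ℕ}
    (hp : wp Γ p Q s τ) (h : ∀ s τ, Q s τ → R s τ) : wp Γ p R s τ := by
  induction p generalizing Q R s τ with
  | skip => exact h _ _ hp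
  | assign | read => exact ⟨hp.1, h _ _ hp.2⟩
  | load => exact ⟨hp.1, hp.2.1, h _ _ hp.2.2⟩
  | store | write => exact ⟨hp.1, hp.2.1, hp.2.2.1, h _ _ hp.2.2.2⟩
  | move k δ => cases δ <;> exact ⟨hp.1, h _ _ hp.2⟩
  | seq p q ihp ihq => exact ihp hp fun s τ hq => ihq hq h
  | ite c p q ihp ihq => exact ⟨hp.1, fun hc => ihp (hp.2.1 hc) h, fun hc => ihq (hp.2.2 hc) h⟩
  | loop c p ih =>
    change LoopWp _ _ _ _ _ _ at hp
    induction hp with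
    | done hc hs hQ => exact .done hc hs (h _ _ hQ)
    | step R' hc hs hF _ ihR => exact .step R' hc hs hF ihR

namespace Prog

/-- `p` may change the variable `x`. -/
def modR (x : Var) : Prog → Bool
  | assign y _ | load y _ _ | read y _ => x = y
  | seq p q | ite _ p q => p.modR x || q.modR x
  | .loop _ p => p.modR x
  | _ => false

/-- `p` may change the array `a`. -/
def modA (a : Arr) : Prog → Bool
  | store b _ _ => a = b
  | seq p q | ite _ p q => p.modA a || q.modA a
  | .loop _ p => p.modA a
  | _ => false

/-- `p` may write on the disk `k`. -/
def modT (k : Disk) : Prog → Bool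
  | write l _ => k = l
  | seq p q | ite _ p q => p.modT k || q.modT k
  | .loop _ p => p.modT k
  | _ => false

/-- `p` may move the head of the disk `k`. -/
def modH (k : Disk) : Prog → Bool
  | move l _ => k = l
  | seq p q | ite _ p q => p.modH k || q.modH k
  | .loop _ p => p.modH k
  | _ => false

/-- `p` may move a head against the direction `δ`. -/
def against (δ : Dir) : Prog → Bool
  | move _ ε => ε ≠ δ
  | seq p q | ite _ p q => p.against δ || q.against δ
  | .loop _ p => p.against δ
  | _ => false

end Prog

/-- What a program that does not mention some component leaves unchanged. -/
structure Frame (p : Prog) (s t : St) : Prop where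
  reg : ∀ x, p.modR x = false → t.reg x = s.reg x
  arr : ∀ a, p.modA a = false → t.arr a = s.arr a
  tape : ∀ k, p.modT k = false → t.tape k = s.tape k
  head : ∀ k, p.modH k = false → t.head k = s.head k
  phi : ∀ δ, p.against δ = false → t.phi δ ≤ s.phi δ

theorem Frame.refl (p : Prog) (s : St) : Frame p s s :=
  ⟨fun _ _ => rfl, fun _ _ => rfl, fun _ _ => rfl, fun _ _ => rfl, fun _ _ => le_rfl⟩

theorem Frame.trans {p : Prog} {s t u : St} (h : Frame p s t) (h' : Frame p t u) :
    Frame p s u :=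
  ⟨fun x hx => (h'.reg x hx).trans (h.reg x hx), fun x hx => (h'.arr x hx).trans (h.arr x hx),
    fun x hx => (h'.tape x hx).trans (h.tape x hx),
    fun x hx => (h'.head x hx).trans (h.head x hx),
    fun x hx => (h'.phi x hx).trans (h.phi x hx)⟩

theorem Frame.seq {p q : Prog} {s t u : St} (h : Frame p s t) (h' : Frame q t u) :
    Frame (p ;; q) s u := by
  refine ⟨fun x hx => ?_, fun x hx => ?_, fun x hx => ?_, fun x hx => ?_, fun x hx => ?_⟩ <;>
    simp only [Prog.modR, Prog.modA, Prog.modT, Prog.modH, Prog.against,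
      Bool.or_eq_false_iff] at hx
  · exact (h'.reg x hx.2).trans (h.reg x hx.1)
  · exact (h'.arr x hx.2).trans (h.arr x hx.1)
  · exact (h'.tape x hx.2).trans (h.tape x hx.1)
  · exact (h'.head x hx.2).trans (h.head x hx.1)
  · exact (h'.phi x hx.2).trans (h.phi x hx.1)

/-- The pass that this move may open is already counted in `phi`, so scanning in the direction `δ`
is free. -/
theorem St.phi_moveTo (s : St) (k : Disk) (δ : Dir) (p : ℕ) :
    (s.moveTo k δ p).phi δ = s.phi δ := by
  cases k <;> simp only [St.phi, St.moveTo, Function.update_apply] <;> split_ifs <;>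
    simp_all

/-- What a program leaves alone is decided by its syntax. Specifications can thus confine themselves
to what is computed, and everything else is recovered afterwards by evaluating `modR`, `modA` and
the like. -/
theorem wp_frame {Γ : Env} {p : Prog} {Q : St → ℕ → Prop} {s : St} {τ : ℕ}
    (hp : wp Γ p Q s τ) : wp Γ p (fun t τ' => Q t τ' ∧ Frame p s t) s τ := by
  induction p generalizing Q s τ with
  | skip => exact ⟨hp, Frame.refl _ _⟩
  | assign x e =>
    refine ⟨hp.1, hp.2, fun y hy => ?_, fun _ _ => rfl, fun _ _ => rfl, fun _ _ => rfl,
      fun _ _ => le_rfl⟩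
    exact Function.update_of_ne (of_decide_eq_false hy) _ _
  | read x e =>
    refine ⟨hp.1, hp.2, fun y hy => ?_, fun _ _ => rfl, fun _ _ => rfl, fun _ _ => rfl,
      fun _ _ => le_rfl⟩
    exact Function.update_of_ne (of_decide_eq_false hy) _ _
  | load x a e =>
    refine ⟨hp.1, hp.2.1, hp.2.2, fun y hy => ?_, fun _ _ => rfl, fun _ _ => rfl, fun _ _ => rfl,
      fun _ _ => le_rfl⟩
    exact Function.update_of_ne (of_decide_eq_false hy) _ _
  | store a e f =>
    refine ⟨hp.1, hp.2.1, hp.2.2.1, hp.2.2.2, fun _ _ => rfl, fun y hy => ?_, fun _ _ => rfl,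
      fun _ _ => rfl, fun _ _ => le_rfl⟩
    exact Function.update_of_ne (of_decide_eq_false hy) _ _
  | write k e =>
    refine ⟨hp.1, hp.2.1, hp.2.2.1, hp.2.2.2, fun _ _ => rfl, fun _ _ => rfl, fun y hy => ?_,
      fun _ _ => rfl, fun _ _ => le_rfl⟩
    exact Function.update_of_ne (of_decide_eq_false hy) _ _
  | move k δ =>
    have key : ∀ q, Frame (.move k δ) s (s.moveTo k δ q) := fun q => by
      refine ⟨fun _ _ => rfl, fun _ _ => rfl, fun _ _ => rfl, fun y hy => ?_, fun ε hε => ?_⟩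
      · exact Function.update_of_ne (of_decide_eq_false hy) _ _
      · have : δ = ε := by simpa [Prog.against] using hε
        subst this
        exact (St.phi_moveTo _ _ _ _).le
    cases δ <;> exact ⟨hp.1, hp.2, key _⟩
  | seq p q ihp ihq =>
    refine wp_mono (p := p) (ihp hp) fun t τ' ht => ?_
    exact wp_mono (ihq ht.1) fun u τ'' hu => ⟨hu.1, ht.2.seq hu.2⟩
  | ite c p q ihp ihq =>
    refine ⟨hp.1, fun hc => wp_mono (ihp (hp.2.1 hc)) fun t τ' ht => ⟨ht.1, ?_⟩,
      fun hc => wp_mono (ihq (hp.2.2 hc)) fun t τ' ht => ⟨ht.1, ?_⟩⟩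
    · have h := ht.2.seq (Frame.refl q t)
      exact ⟨h.1, h.2, h.3, h.4, h.5⟩
    · have h := (Frame.refl p s).seq ht.2
      exact ⟨h.1, h.2, h.3, h.4, h.5⟩
  | loop c p ih =>
    change LoopWp _ _ _ _ _ _ at hp
    induction hp with
    | done hc hs hQ => exact .done hc hs ⟨hQ, Frame.refl _ _⟩
    | @step s τ R hc hs hF hR ihR =>
      refine .step (fun t τ' => R t τ' ∧ Frame p s t) hc hs (ih hF) fun t τ' ht => ?_
      have h1 := ihR t τ' ht.1
      have hf : Frame (.loop c p) s t := ⟨ht.2.1, ht.2.2, ht.2.3, ht.2.4, ht.2.5⟩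
      exact wp_mono (p := .loop c p) h1 fun u τ'' hu => ⟨hu.1, hf.trans hu.2⟩

/-- Sequential composition, with the frame of the first program. -/
theorem wp_seq {Γ : Env} {p q : Prog} {P Q : St → ℕ → Prop} {s : St} {τ : ℕ}
    (hp : wp Γ p P s τ) (hq : ∀ t τ', P t τ' → Frame p s t → wp Γ q Q t τ') :
    wp Γ (p ;; q) Q s τ :=
  wp_mono (p := p) (wp_frame hp) fun t τ' ht => hq t τ' ht.1 ht.2

/-- Loops: `I` is an invariant and `μ` a measure for termination. -/
theorem wp_while {Γ : Env} {c : Cn} {p : Prog} (I : St → ℕ → Prop) (μ : St → ℕ) {s : St} {τ : ℕ}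
    (hI : I s τ) (hok : ∀ t τ', Frame p s t → I t τ' → c.ok Γ.W t.reg)
    (hp : ∀ t τ', Frame p s t → I t τ' → c.holds t.reg →
      wp Γ p (fun u τ'' => I u τ'' ∧ μ u < μ t) t (τ' + 1)) :
    wp Γ (.loop c p) (fun t τ' => ∃ τ'', τ' = τ'' + 1 ∧ I t τ'' ∧ ¬ c.holds t.reg) s τ := by
  -- Induction on a bound `N` of the measure; the frame relative to the start of the loop is carried
  -- along, so that the hypotheses on the body may use it.
  have key : ∀ N t τ', μ t < N → Frame p s t → I t τ' → LoopWp Γ.W c (wp Γ p)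
      (fun t τ' => ∃ τ'', τ' = τ'' + 1 ∧ I t τ'' ∧ ¬ c.holds t.reg) t τ' := by
    intro N
    induction N with
    | zero => intro t τ' h; omega
    | succ N ih =>
      intro t τ' hμ hf hIt
      by_cases hc : c.holds t.reg
      · exact .step _ (hok t τ' hf hIt) hc (wp_frame (hp t τ' hf hIt hc)) fun u τ'' hu =>
          ih u τ'' (by omega) (hf.trans hu.2) hu.1.1
      · exact .done (hok t τ' hf hIt) hc ⟨τ', rfl, hIt, hc⟩
  exact key _ s τ (Nat.lt_succ_self _) (Frame.refl _ _) hI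

/-- `for x := lo to hi - 1 do p` (without the initialization of `x`). -/
def Prog.upTo (x : Var) (hi : Ex) (p : Prog) : Prog := .loop (.lt x hi) (p ;; x ::= (x : Ex) + 1)

/-- Counting loops: `I i` holds before the iteration `i`, and `T i` bounds the time until then. -/
theorem wp_upTo {Γ : Env} {x : Var} {hi : Ex} {p : Prog} (I : ℕ → St → Prop) (T : ℕ → ℕ)
    (lo H : ℕ) {s : St} {τ : ℕ} (hlo : s.reg x = lo) (hle : lo ≤ H) (hI : I lo s)
    (hhi : ∀ t, Frame (p ;; x ::= (x : Ex) + 1) s t → hi.ok Γ.W t.reg ∧ hi.val t.reg = H)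
    (hp : ∀ i t τ', Frame (p ;; x ::= (x : Ex) + 1) s t → lo ≤ i → i < H → I i t →
      t.reg x = i → wp Γ (p ;; x ::= (x : Ex) + 1)
        (fun u τ'' => I (i + 1) u ∧ u.reg x = i + 1 ∧ τ'' + 1 + T i ≤ τ' + T (i + 1)) t τ') :
    wp Γ (.upTo x hi p) (fun t τ' => I H t ∧ t.reg x = H ∧ τ' + T lo ≤ τ + T H + 1) s τ := by
  refine wp_mono (p := .upTo x hi p) (wp_frame (wp_while (fun t τ' => ∃ i,
      lo ≤ i ∧ i ≤ H ∧ t.reg x = i ∧ I i t ∧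
    τ' + T lo ≤ τ + T i) (fun t => H - t.reg x) ⟨lo, le_rfl, hle, hlo, hI, le_rfl⟩ ?_ ?_)) ?_
  · intro t τ' hf _
    exact ⟨trivial, (hhi t hf).1⟩
  · rintro t τ' hf ⟨i, h1, h2, h3, h4, h5⟩ hc
    have hc' : t.reg x < hi.val t.reg := hc
    rw [(hhi t hf).2] at hc'
    refine wp_mono (hp i t (τ' + 1) hf h1 (by omega) h4 h3) fun u τ'' hu => ?_
    refine ⟨⟨i + 1, by omega, by omega, hu.2.1, hu.1, ?_⟩, ?_⟩
    · have := hu.2.2; omega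
    · have := hu.2.1; omega
  · rintro t τ' ⟨⟨τ'', rfl, ⟨i, h1, h2, h3, h4, h5⟩, hc⟩, hf⟩
    have hc' : ¬ t.reg x < hi.val t.reg := hc
    rw [(hhi t ⟨hf.1, hf.2, hf.3, hf.4, hf.5⟩).2] at hc'
    obtain rfl : i = H := by omega
    exact ⟨h4, h3, by omega⟩

end ExtMem

namespace ExtMem

/-! ## Compilation -/

def Ex.compile : Ex → Expr
  | lit v => .lit v
  | var x => .reg x.ctorIdx
  | add e f => .bin .add e.compile f.compile
  | sub e f => .bin .sub e.compile f.compile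
  | mul e f => .bin .mul e.compile f.compile
  | div e f => .bin .div e.compile f.compile
  | mod e f => .bin .mod e.compile f.compile

/-- Truth values are 0 and 1, so a conjunction is a product. Both conjuncts are always evaluated,
which is why `Cn.ok` asks that neither overflows. -/
def Cn.compile : Cn → Expr
  | lt e f => .bin .lt e.compile f.compile
  | le e f => .bin .eq (.bin .lt f.compile e.compile) (.lit 0)
  | eq e f => .bin .eq e.compile f.compile
  | and c d => .bin .mul c.compile d.compile

/-- Arithmetic modulo `2 ^ w` is exact as long as no result overflows or becomes negative, and `ok`
demands this of every subexpression. -/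
theorem Ex.eval_compile {w : ℕ} {ρ : ℕ → ℕ} {ρ' : Var → ℕ} (hρ : ∀ x : Var, ρ x.ctorIdx = ρ' x)
    {e : Ex} (he : e.ok (2 ^ w) ρ') : e.compile.eval w ρ = e.val ρ' := by
  induction e with
  | lit v => exact Nat.mod_eq_of_lt he
  | var x => exact hρ x
  | add e f ihe ihf =>
    simp only [compile, Expr.eval, BinOp.eval, val, ihe he.1, ihf he.2.1]
    exact Nat.mod_eq_of_lt he.2.2
  | sub e f ihe ihf =>
    simp only [compile, Expr.eval, BinOp.eval, val, ihe he.1, ihf he.2.1]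
    have h1 := he.2.2.1
    have h2 := he.2.2.2
    rw [show e.val ρ' + (2 ^ w - f.val ρ') = e.val ρ' - f.val ρ' + 2 ^ w by omega,
      Nat.add_mod_right]
    exact Nat.mod_eq_of_lt (by omega)
  | mul e f ihe ihf =>
    simp only [compile, Expr.eval, BinOp.eval, val, ihe he.1, ihf he.2.1]
    exact Nat.mod_eq_of_lt he.2.2
  | div e f ihe ihf =>
    simp only [compile, Expr.eval, BinOp.eval, val, ihe he.1, ihf he.2.1]
    exact Nat.mod_eq_of_lt ((Nat.div_le_self _ _).trans_lt he.2.2)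
  | mod e f ihe ihf =>
    simp only [compile, Expr.eval, BinOp.eval, val, ihe he.1, ihf he.2.1]
    exact Nat.mod_eq_of_lt ((Nat.mod_le _ _).trans_lt he.2.2)

open Classical in
theorem Cn.eval_compile {w : ℕ} (hw : 1 < 2 ^ w) {ρ : ℕ → ℕ} {ρ' : Var → ℕ}
    (hρ : ∀ x : Var, ρ x.ctorIdx = ρ' x) {c : Cn} (hc : c.ok (2 ^ w) ρ') :
    c.compile.eval w ρ = if c.holds ρ' then 1 else 0 := by
  induction c with
  | lt e f =>
    simp only [compile, Expr.eval, BinOp.eval, holds, Ex.eval_compile hρ hc.1,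
      Ex.eval_compile hρ hc.2]
    by_cases h : e.val ρ' < f.val ρ' <;> simp [h]
  | le e f =>
    simp only [compile, Expr.eval, BinOp.eval, holds, Ex.eval_compile hρ hc.1,
      Ex.eval_compile hρ hc.2]
    by_cases h : e.val ρ' ≤ f.val ρ'
    · simp [h, not_lt.2 h]
    · simp [h, not_le.1 h]
  | eq e f =>
    simp only [compile, Expr.eval, BinOp.eval, holds, Ex.eval_compile hρ hc.1,
      Ex.eval_compile hρ hc.2]
    by_cases h : e.val ρ' = f.val ρ' <;> simp [h]
  | and c d ihc ihd =>
    simp only [compile, Expr.eval, BinOp.eval, holds, ihc hc.1, ihd hc.2]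
    by_cases h1 : c.holds ρ' <;> by_cases h2 : d.holds ρ' <;> simp [h1, h2, Nat.mod_eq_of_lt hw]

/-- Registers beyond those of the variables: the array length, a temporary register, and the
registers that extend the internal memory. -/
def lenReg : ℕ := 64
def tmpReg : ℕ := 65
def slotReg (k : ℕ) : ℕ := 66 + k

/-- The address of an array element. -/
def addr (a : Arr) (e : Ex) : Expr :=
  .bin .add (.bin .mul (.lit a.ctorIdx) (.reg lenReg)) e.compile

/-- Load into `x` the register among the first `k` slots whose number is in `tmpReg`. -/
def loadSlot (x : ℕ) : ℕ → Cmd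
  | 0 => .nop
  | k + 1 => .cond (.bin .eq (.reg tmpReg) (.lit k)) (.assign x (.reg (slotReg k))) (loadSlot x k)

/-- Store `e` in the register among the first `k` slots whose number is in `tmpReg`. -/
def storeSlot (e : Expr) : ℕ → Cmd
  | 0 => .nop
  | k + 1 => .cond (.bin .eq (.reg tmpReg) (.lit k)) (.assign (slotReg k) e) (storeSlot e k)

def Prog.compile (H : ℕ) : Prog → Cmd
  | skip => .nop
  | assign x e => .assign x.ctorIdx e.compile
  | load x a e => .seq (.assign tmpReg (addr a e))
      (.cond (.bin .lt (.reg tmpReg) (.lit H)) (loadSlot x.ctorIdx H)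
        (.load x.ctorIdx (.bin .sub (.reg tmpReg) (.lit H))))
  | store a e f => .seq (.assign tmpReg (addr a e))
      (.cond (.bin .lt (.reg tmpReg) (.lit H)) (storeSlot f.compile H)
        (.store (.bin .sub (.reg tmpReg) (.lit H)) f.compile))
  | read x k => .read x.ctorIdx k
  | write k e => .write k e.compile
  | move k δ => .move k δ
  | seq p q => .seq (p.compile H) (q.compile H)
  | ite c p q => .cond c.compile (p.compile H) (q.compile H)
  | .loop c p => .loop c.compile (p.compile H)

/-- The number of machine steps for one step of the program. -/
def Prog.cost (H : ℕ) : Prog → ℕ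
  | assign _ e | write _ e => e.compile.cost + 1
  | load _ _ e => e.compile.cost + 4 * H + 20
  | store _ e f => e.compile.cost + f.compile.cost + 4 * H + 20
  | seq p q => max (p.cost H) (q.cost H)
  | ite c p q => max (c.compile.cost + 1) (max (p.cost H) (q.cost H))
  | .loop c p => max (c.compile.cost + 1) (p.cost H)
  | _ => 1

/-- The word at address `v` in the memory extended by `H` registers. -/
def State.cell (H : ℕ) (σ : State) (v : ℕ) : ℕ :=
  if v < H then σ.reg (slotReg v) else σ.mem (v - H)

/-- The number of arrays. -/
def numArr : ℕ := 14

/-- The machine state `σ` represents the program state `s` at time `τ`. -/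
structure Rel (H L κ : ℕ) (σ : State) (s : St) (τ : ℕ) : Prop where
  reg : ∀ x : Var, σ.reg x.ctorIdx = s.reg x
  len : σ.reg lenReg = L
  arr : ∀ (a : Arr) (i : ℕ), i < L → σ.cell H (a.ctorIdx * L + i) = s.arr a i
  tape : σ.tape = s.tape
  head : σ.head = s.head
  dir : σ.dir = s.dir
  passes : σ.passes = s.passes
  time : σ.time ≤ κ * τ

theorem Var.ctorIdx_lt (x : Var) : x.ctorIdx < 64 := by cases x <;> decide

theorem Arr.ctorIdx_lt (a : Arr) : a.ctorIdx < numArr := by cases a <;> decide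

theorem Var.ctorIdx_inj {x y : Var} : x.ctorIdx = y.ctorIdx ↔ x = y := by
  constructor
  · intro h
    rw [← Var.ofNat_ctorIdx x, ← Var.ofNat_ctorIdx y, h]
  · exact congrArg _

theorem Arr.ctorIdx_inj {x y : Arr} : x.ctorIdx = y.ctorIdx ↔ x = y := by
  constructor
  · intro h
    rw [← Arr.ofNat_ctorIdx x, ← Arr.ofNat_ctorIdx y, h]
  · exact congrArg _

theorem addr_inj {a a' L i i' : ℕ} (hi : i < L) (hi' : i' < L) (h : a * L + i = a' * L + i') :
    a = a' ∧ i = i' := by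
  have h1 : a = a' := by
    have := congrArg (· / L) h
    simpa [Nat.mul_comm _ L, Nat.mul_add_div (by omega : L > 0), Nat.div_eq_of_lt hi,
      Nat.div_eq_of_lt hi'] using this
  subst h1
  exact ⟨rfl, by omega⟩

theorem addr_lt {a : Arr} {L i : ℕ} (hi : i < L) : a.ctorIdx * L + i < numArr * L := by
  have h := Arr.ctorIdx_lt a
  have : (a.ctorIdx + 1) * L ≤ numArr * L := Nat.mul_le_mul_right L h
  rw [Nat.add_mul] at this
  omega

namespace Rel

variable {H L κ : ℕ} {σ : State} {s : St} {τ : ℕ}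

theorem _root_.ExtMem.State.cell_setReg (σ : State) (x : Var) (v : ℕ) (u : ℕ) :
    (σ.setReg x.ctorIdx v).cell H u = σ.cell H u := by
  have := Var.ctorIdx_lt x
  unfold State.cell State.setReg
  simp only [Function.update_apply, slotReg]
  rw [if_neg (show ¬ 66 + u = x.ctorIdx by omega)]

theorem set (h : Rel H L κ σ s τ) (x : Var) (v : ℕ) {t : ℕ} (ht : t ≤ κ) :
    Rel H L κ ((σ.setReg x.ctorIdx v).tick t) (s.set x v) (τ + 1) := by
  refine ⟨fun y => ?_, ?_, fun a i hi => ?_, h.tape, h.head, h.dir, h.passes, ?_⟩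
  · simp only [State.setReg, State.tick, St.set, Function.update_apply, Var.ctorIdx_inj, h.reg y]
  · have := Var.ctorIdx_lt x
    simp only [State.setReg, State.tick, Function.update_apply, lenReg]
    rw [if_neg (by omega)]
    exact h.len
  · exact (σ.cell_setReg x v _).trans (h.arr a i hi)
  · have := h.time
    simp only [State.setReg, State.tick, Nat.mul_add, Nat.mul_one]
    omega

theorem tick (h : Rel H L κ σ s τ) {t : ℕ} (ht : t ≤ κ) : Rel H L κ (σ.tick t) s (τ + 1) := by
  refine ⟨h.reg, h.len, h.arr, h.tape, h.head, h.dir, h.passes, ?_⟩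
  have := h.time
  simp only [State.tick, Nat.mul_add, Nat.mul_one]
  omega

theorem tmp (h : Rel H L κ σ s τ) (v : ℕ) {t κ' : ℕ} (ht : (σ.tick t).time ≤ κ' * τ) :
    Rel H L κ' ((σ.setReg tmpReg v).tick t) s τ := by
  refine ⟨fun y => ?_, ?_, fun a i hi => ?_, h.tape, h.head, h.dir, h.passes, ht⟩
  · have := Var.ctorIdx_lt y
    simp only [State.setReg, State.tick, Function.update_apply, tmpReg]
    rw [if_neg (by omega)]
    exact h.reg y
  · exact h.len
  · rw [← h.arr a i hi]
    unfold State.cell State.setReg State.tick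
    simp only [Function.update_apply, slotReg, tmpReg]
    rw [if_neg (show ¬ 66 + (a.ctorIdx * L + i) = 65 by omega)]

end Rel

/-- Registers cannot be addressed indirectly, so the number in `tmpReg` is compared with one
constant after the other. Linear time in `k` does no harm, because the number of extra registers
will depend on the alphabet only. -/
theorem loadSlot_exec (m : Machine) (x : ℕ) {k : ℕ} (hk : k ≤ 2 ^ m.w) (σ : State)
    (hv : σ.reg tmpReg < k) :
    ∃ t ≤ 4 * k + 2, Exec m (loadSlot x k) σ
      ((σ.setReg x (σ.reg (slotReg (σ.reg tmpReg)))).tick t) := by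
  induction k generalizing σ with
  | zero => omega
  | succ k ih =>
    have he : (Expr.bin .eq (.reg tmpReg) (.lit k)).eval m.w σ.reg =
        if σ.reg tmpReg = k then 1 else 0 := by
      simp [Expr.eval, BinOp.eval, Nat.mod_eq_of_lt (show k < 2 ^ m.w by omega)]
    by_cases h : σ.reg tmpReg = k
    · refine ⟨6, by omega, ?_⟩
      refine .condTrue (by rw [he]; simp [h]) ?_
      rw [h]
      exact Exec.assign _ _ _
    · obtain ⟨t, ht, hx⟩ := ih (by omega) (σ.tick 4) (by simp only [State.tick]; omega)
      refine ⟨4 + t, by omega, .condFalse (by rw [he]; simp [h]) ?_⟩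
      have e : (σ.setReg x (σ.reg (slotReg (σ.reg tmpReg)))).tick (4 + t) =
        ((σ.tick 4).setReg x ((σ.tick 4).reg (slotReg ((σ.tick 4).reg tmpReg)))).tick t := by
        simp [State.tick, State.setReg, Nat.add_assoc]
      rw [e]
      exact hx

theorem storeSlot_exec (m : Machine) (e : Expr) {k : ℕ} (hk : k ≤ 2 ^ m.w) (σ : State)
    (hv : σ.reg tmpReg < k) :
    ∃ t ≤ 4 * k + 2 + e.cost, Exec m (storeSlot e k) σ
      ((σ.setReg (slotReg (σ.reg tmpReg)) (e.eval m.w σ.reg)).tick t) := by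
  induction k generalizing σ with
  | zero => omega
  | succ k ih =>
    have he : (Expr.bin .eq (.reg tmpReg) (.lit k)).eval m.w σ.reg =
        if σ.reg tmpReg = k then 1 else 0 := by
      simp [Expr.eval, BinOp.eval, Nat.mod_eq_of_lt (show k < 2 ^ m.w by omega)]
    by_cases h : σ.reg tmpReg = k
    · refine ⟨4 + (1 + e.cost), by omega, ?_⟩
      refine .condTrue (by rw [he]; simp [h]) ?_
      rw [h]
      have := Exec.assign (m := m) (σ.tick 4) (slotReg k) e
      simpa [State.tick, State.setReg, Nat.add_assoc, Expr.cost] using this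
    · obtain ⟨t, ht, hx⟩ := ih (by omega) (σ.tick 4) (by simp only [State.tick]; omega)
      refine ⟨4 + t, by omega, .condFalse (by rw [he]; simp [h]) ?_⟩
      have e : (σ.setReg (slotReg (σ.reg tmpReg)) (e.eval m.w σ.reg)).tick (4 + t) =
        ((σ.tick 4).setReg (slotReg ((σ.tick 4).reg tmpReg))
          (e.eval m.w (σ.tick 4).reg)).tick t := by
        simp [State.tick, State.setReg, Nat.add_assoc]
      rw [e]
      exact hx

section Soundness

variable {m : Machine} {H L κ : ℕ}

theorem addr_eval (hL : numArr * L < 2 ^ m.w) {σ : State} {s : St} {τ : ℕ}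
    (h : Rel H L κ σ s τ) {a : Arr} {e : Ex} (he : e.ok (2 ^ m.w) s.reg) (hi : e.val s.reg < L) :
    (addr a e).eval m.w σ.reg = a.ctorIdx * L + e.val s.reg := by
  have h1 := addr_lt (a := a) hi
  have h2 : a.ctorIdx < 2 ^ m.w :=
    lt_of_le_of_lt (Nat.le_mul_of_pos_right _ (by omega : 0 < L)) (by omega)
  simp only [addr, Expr.eval, BinOp.eval, h.len, Ex.eval_compile h.reg he,
    Nat.mod_eq_of_lt h2]
  rw [Nat.mod_eq_of_lt (show a.ctorIdx * L < 2 ^ m.w by omega), Nat.mod_eq_of_lt (by omega)]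

/-- The arrays lie one after the other in an address space whose first `H` cells are registers and
whose remaining cells are the internal memory; `hM` says that they fit. -/
theorem load_exec (hH : H < 2 ^ m.w) (hL : numArr * L < 2 ^ m.w) (hM : numArr * L ≤ H + m.M)
    {x : Var} {a : Arr} {e : Ex} {s : St} {τ : ℕ} {σ : State} (hR : Rel H L κ σ s τ)
    (hκ : (Prog.load x a e).cost H ≤ κ) (he : e.ok (2 ^ m.w) s.reg) (hi : e.val s.reg < L) :
    ∃ σ', Exec m ((Prog.load x a e).compile H) σ σ' ∧
      Rel H L κ σ' (s.set x (s.arr a (e.val s.reg))) (τ + 1) := by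
  have hlt := addr_lt (a := a) hi
  have hadd := addr_eval hL hR (a := a) he hi
  set v := a.ctorIdx * L + e.val s.reg with hv
  have hcell := hR.arr a _ hi
  rw [← hv] at hcell
  have hcost : (addr a e).cost = e.compile.cost + 4 := by simp [addr, Expr.cost]; omega
  simp only [Prog.cost] at hκ
  set σ₁ := (σ.setReg tmpReg v).tick (1 + (addr a e).cost) with hσ₁
  have h1 : Exec m (.assign tmpReg (addr a e)) σ σ₁ := by
    rw [hσ₁, ← hadd]; exact .assign _ _ _
  have htmp : σ₁.reg tmpReg = v := by simp [hσ₁, State.setReg, State.tick]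
  have hcond : (Expr.bin .lt (.reg tmpReg) (.lit H)).eval m.w σ₁.reg = if v < H then 1 else 0 := by
    simp [Expr.eval, BinOp.eval, htmp, Nat.mod_eq_of_lt hH]
  have htime := hR.time
  have key : ∀ t, t ≤ κ → Rel H L κ ((((σ.setReg tmpReg v).tick 0).setReg x.ctorIdx
      (s.arr a (e.val s.reg))).tick t) (s.set x (s.arr a (e.val s.reg))) (τ + 1) := fun t ht =>
    (hR.tmp v (t := 0) (κ' := κ) (by simpa [State.tick] using htime)).set x _ ht
  by_cases hvH : v < H
  · obtain ⟨t, ht, hx⟩ := loadSlot_exec m x.ctorIdx hH.le (σ₁.tick 4)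
      (by simpa [State.tick, htmp] using hvH)
    refine ⟨_, .seq h1 (.condTrue (by rw [hcond]; simp [hvH]) hx), ?_⟩
    have e1 : (σ₁.tick 4).reg (slotReg ((σ₁.tick 4).reg tmpReg)) = s.arr a (e.val s.reg) := by
      rw [show (σ₁.tick 4).reg = σ₁.reg from rfl, htmp, ← hcell]
      simp [State.cell, hvH, hσ₁, State.setReg, State.tick, slotReg, tmpReg, Function.update_apply]
      omega
    rw [e1]
    have := key (1 + (addr a e).cost + 4 + t) (by omega)
    simpa [hσ₁, State.tick, State.setReg, Nat.add_assoc] using this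
  · have hsub : (Expr.bin .sub (.reg tmpReg) (.lit H)).eval m.w (σ₁.tick 4).reg = v - H := by
      simp only [Expr.eval, BinOp.eval, Nat.mod_eq_of_lt hH]
      rw [show (σ₁.tick 4).reg = σ₁.reg from rfl, htmp,
        show v + (2 ^ m.w - H) = v - H + 2 ^ m.w by omega, Nat.add_mod_right]
      exact Nat.mod_eq_of_lt (by omega)
    have hx := Exec.load (m := m) (σ₁.tick 4) x.ctorIdx (.bin .sub (.reg tmpReg) (.lit H))
      (by rw [hsub]; omega)
    refine ⟨_, .seq h1 (.condFalse (by rw [hcond]; simp [hvH]) hx), ?_⟩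
    rw [hsub]
    have e1 : (σ₁.tick 4).mem (v - H) = s.arr a (e.val s.reg) := by
      rw [← hcell]
      simp [State.cell, hvH, hσ₁, State.setReg, State.tick]
    rw [e1]
    have := key (1 + (addr a e).cost + 4 + 4) (by omega)
    simpa [hσ₁, State.tick, State.setReg, Nat.add_assoc, Expr.cost] using this

/-- Different array entries have different addresses, so changing one cell changes one entry.
Registers from 65 on may change freely, as they hold neither a variable nor the array length. -/
theorem Rel.setArr {σ : State} {s : St} {τ : ℕ} (hR : Rel H L κ σ s τ) {a : Arr} {i u : ℕ}
    (hi : i < L) {σ' : State} (hreg : ∀ y < 65, σ'.reg y = σ.reg y)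
    (hcell : ∀ v, σ'.cell H v = if v = a.ctorIdx * L + i then u else σ.cell H v)
    (ht : σ'.tape = σ.tape) (hh : σ'.head = σ.head) (hd : σ'.dir = σ.dir)
    (hp : σ'.passes = σ.passes) (htime : σ'.time ≤ σ.time + κ) :
    Rel H L κ σ' (s.setArr a i u) (τ + 1) := by
  refine ⟨fun y => ?_, ?_, fun b j hj => ?_, ht.trans hR.tape, hh.trans hR.head,
    hd.trans hR.dir, hp.trans hR.passes, ?_⟩
  · rw [hreg _ (by have := Var.ctorIdx_lt y; omega)]; exact hR.reg y
  · rw [hreg _ (by decide)]; exact hR.len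
  · rw [hcell]
    simp only [St.setArr, Function.update_apply]
    by_cases hb : b = a
    · subst hb
      by_cases hji : j = i
      · simp [hji]
      · rw [if_neg (by omega), if_pos rfl, Function.update_of_ne hji]
        exact hR.arr b j hj
    · rw [if_neg fun h => hb (Arr.ctorIdx_inj.1 (addr_inj hj hi h).1), if_neg hb]
      exact hR.arr b j hj
  · have := hR.time
    simp only [Nat.mul_add, Nat.mul_one]
    omega

theorem store_exec (hH : H < 2 ^ m.w) (hL : numArr * L < 2 ^ m.w) (hM : numArr * L ≤ H + m.M)
    {a : Arr} {e f : Ex} {s : St} {τ : ℕ} {σ : State} (hR : Rel H L κ σ s τ)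
    (hκ : (Prog.store a e f).cost H ≤ κ) (he : e.ok (2 ^ m.w) s.reg)
    (hf : f.ok (2 ^ m.w) s.reg) (hi : e.val s.reg < L) :
    ∃ σ', Exec m ((Prog.store a e f).compile H) σ σ' ∧
      Rel H L κ σ' (s.setArr a (e.val s.reg) (f.val s.reg)) (τ + 1) := by
  have hlt := addr_lt (a := a) hi
  have hadd := addr_eval hL hR (a := a) he hi
  set v := a.ctorIdx * L + e.val s.reg with hv
  have hcost : (addr a e).cost = e.compile.cost + 4 := by simp [addr, Expr.cost]; omega
  simp only [Prog.cost] at hκ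
  set σ₁ := (σ.setReg tmpReg v).tick (1 + (addr a e).cost) with hσ₁
  have h1 : Exec m (.assign tmpReg (addr a e)) σ σ₁ := by
    rw [hσ₁, ← hadd]; exact .assign _ _ _
  have htmp : σ₁.reg tmpReg = v := by simp [hσ₁, State.setReg, State.tick]
  have hcond : (Expr.bin .lt (.reg tmpReg) (.lit H)).eval m.w σ₁.reg = if v < H then 1 else 0 := by
    simp [Expr.eval, BinOp.eval, htmp, Nat.mod_eq_of_lt hH]
  have hval : f.compile.eval m.w (σ₁.tick 4).reg = f.val s.reg := by
    refine Ex.eval_compile (fun y => ?_) hf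
    have := Var.ctorIdx_lt y
    simp only [hσ₁, State.setReg, State.tick, Function.update_apply, tmpReg]
    rw [if_neg (by omega)]
    exact hR.reg y
  by_cases hvH : v < H
  · obtain ⟨t, ht, hx⟩ := storeSlot_exec m f.compile hH.le (σ₁.tick 4)
      (by simpa [State.tick, htmp] using hvH)
    refine ⟨_, .seq h1 (.condTrue (by rw [hcond]; simp [hvH]) hx), ?_⟩
    rw [hval, show (σ₁.tick 4).reg = σ₁.reg from rfl, htmp]
    refine hR.setArr hi (fun y hy => ?_) (fun v' => ?_) rfl rfl rfl rfl ?_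
    · simp only [hσ₁, State.setReg, State.tick, Function.update_apply, tmpReg, slotReg]
      rw [if_neg (by omega), if_neg (by omega)]
    · simp only [State.cell, hσ₁, State.setReg, State.tick, Function.update_apply, tmpReg, slotReg,
        ← hv]
      by_cases h1 : v' = v
      · simp [h1, hvH]
      · rw [if_neg (show ¬ (66 + v' = 66 + v) by omega), if_neg (show ¬ 66 + v' = 65 by omega),
          if_neg h1]
    · simp only [hσ₁, State.setReg, State.tick]; omega
  · have hsub : (Expr.bin .sub (.reg tmpReg) (.lit H)).eval m.w (σ₁.tick 4).reg = v - H := by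
      simp only [Expr.eval, BinOp.eval, Nat.mod_eq_of_lt hH]
      rw [show (σ₁.tick 4).reg = σ₁.reg from rfl, htmp,
        show v + (2 ^ m.w - H) = v - H + 2 ^ m.w by omega, Nat.add_mod_right]
      exact Nat.mod_eq_of_lt (by omega)
    have hx := Exec.store (m := m) (σ₁.tick 4) (.bin .sub (.reg tmpReg) (.lit H)) f.compile
      (by rw [hsub]; omega)
    refine ⟨_, .seq h1 (.condFalse (by rw [hcond]; simp [hvH]) hx), ?_⟩
    rw [hsub, hval]
    refine hR.setArr hi (fun y hy => ?_) (fun v' => ?_) rfl rfl rfl rfl ?_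
    · simp only [hσ₁, State.setReg, State.tick, State.setMem, Function.update_apply, tmpReg]
      rw [if_neg (by omega)]
    · simp only [State.cell, hσ₁, State.setReg, State.setMem, State.tick, Function.update_apply,
        tmpReg, slotReg, ← hv]
      by_cases h1 : v' = v
      · simp [h1, hvH]
      · rw [if_neg (show ¬ (66 + v' = 65) by omega), if_neg h1]
        by_cases h2 : v' < H
        · simp [h2]
        · rw [if_neg h2, if_neg h2, if_neg (by omega)]
    · simp only [hσ₁, State.setReg, State.setMem, State.tick, Expr.cost]; omega

/-- The bridge to the machine. One unit of program time stands for at most `κ` machine steps,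
because the cost of a statement or a test is bounded by its syntax. Since `wp` includes termination,
the induction also produces the halting execution. -/
theorem compile_sound (hH : H < 2 ^ m.w) (hL : numArr * L < 2 ^ m.w)
    (hM : numArr * L ≤ H + m.M) (hw : 1 < 2 ^ m.w) {p : Prog} {Q : St → ℕ → Prop} {s : St} {τ : ℕ}
    (hp : wp ⟨2 ^ m.w, L, m.size⟩ p Q s τ) (hκ : p.cost H ≤ κ) {σ : State}
    (hR : Rel H L κ σ s τ) :
    ∃ σ' s' τ', Exec m (p.compile H) σ σ' ∧ Rel H L κ σ' s' τ' ∧ Q s' τ' := by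
  induction p generalizing Q s τ σ with
  | skip => exact ⟨_, _, _, .nop _, hR.tick hκ, hp⟩
  | assign x e =>
    refine ⟨_, _, _, .assign _ _ _, ?_, hp.2⟩
    rw [Ex.eval_compile hR.reg hp.1]
    exact hR.set _ _ (by simpa [Prog.cost, Nat.add_comm] using hκ)
  | load x a e =>
    obtain ⟨σ', h1, h2⟩ := load_exec hH hL hM hR hκ hp.1 hp.2.1
    exact ⟨_, _, _, h1, h2, hp.2.2⟩
  | store a e f =>
    obtain ⟨σ', h1, h2⟩ := store_exec hH hL hM hR hκ hp.1 hp.2.1 hp.2.2.1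
    exact ⟨_, _, _, h1, h2, hp.2.2.2⟩
  | read x k =>
    refine ⟨_, _, _, .read _ _ _ (by rw [hR.head]; exact hp.1), ?_, hp.2⟩
    rw [hR.head, hR.tape]
    exact hR.set _ _ hκ
  | write k e =>
    refine ⟨_, _, _, .write _ _ _ (by rw [hR.head]; exact hp.2.1) hp.2.2.1, ?_, hp.2.2.2⟩
    rw [Ex.eval_compile hR.reg hp.1]
    refine ⟨hR.reg, hR.len, hR.arr, ?_, hR.head, hR.dir, hR.passes, ?_⟩
    · simp only [State.setBit, State.tick, St.setBit, hR.tape, hR.head]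
    · have := hR.time
      simp only [Prog.cost] at hκ
      simp only [State.setBit, State.tick, Nat.mul_add, Nat.mul_one]
      omega
  | move k δ =>
    have key : ∀ q, Rel H L κ ((σ.moveTo m k δ q).tick 1) (s.moveTo k δ q) (τ + 1) := fun q => by
      refine ⟨hR.reg, hR.len, hR.arr, hR.tape, ?_, ?_, ?_, ?_⟩
      · simp only [State.moveTo, State.tick, St.moveTo, hR.head]
      · simp only [State.moveTo, State.tick, St.moveTo, hR.dir]
      · simp only [State.moveTo, State.tick, St.moveTo, hR.dir, hR.passes]
      · have := hR.time
        simp only [Prog.cost] at hκ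
        simp only [State.moveTo, State.tick, Nat.mul_add, Nat.mul_one]
        omega
    cases δ
    · refine ⟨_, _, _, .moveLeft _ _ (by rw [hR.head]; exact hp.1), key _, ?_⟩
      rw [hR.head]; exact hp.2
    · refine ⟨_, _, _, .moveRight _ _ (by rw [hR.head]; exact hp.1), key _, ?_⟩
      rw [hR.head]; exact hp.2
  | seq p q ihp ihq =>
    simp only [Prog.cost] at hκ
    obtain ⟨σ₁, s₁, τ₁, h1, h2, h3⟩ := ihp hp (by omega) hR
    obtain ⟨σ₂, s₂, τ₂, h4, h5, h6⟩ := ihq h3 (by omega) h2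
    exact ⟨_, _, _, .seq h1 h4, h5, h6⟩
  | ite c p q ihp ihq =>
    classical
    simp only [Prog.cost] at hκ
    have he := Cn.eval_compile hw hR.reg hp.1
    by_cases hc : c.holds s.reg
    · obtain ⟨σ₁, s₁, τ₁, h1, h2, h3⟩ := ihp (hp.2.1 hc) (by omega)
        (hR.tick (t := 1 + c.compile.cost) (by omega))
      exact ⟨_, _, _, .condTrue (by rw [he]; simp [hc]) h1, h2, h3⟩
    · obtain ⟨σ₁, s₁, τ₁, h1, h2, h3⟩ := ihq (hp.2.2 hc) (by omega)
        (hR.tick (t := 1 + c.compile.cost) (by omega))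
      exact ⟨_, _, _, .condFalse (by rw [he]; simp [hc]) h1, h2, h3⟩
  | loop c p ih =>
    classical
    simp only [Prog.cost] at hκ
    change LoopWp _ _ _ _ _ _ at hp
    induction hp generalizing σ with
    | done hc hs hQ =>
      have he := Cn.eval_compile hw hR.reg hc
      exact ⟨_, _, _, .loopDone (by rw [he]; simp [hs]),
        hR.tick (t := 1 + c.compile.cost) (by omega), hQ⟩
    | step R hc hs hF _ ihR =>
      have he := Cn.eval_compile hw hR.reg hc
      obtain ⟨σ₁, s₁, τ₁, h1, h2, h3⟩ := ih hF (by omega)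
        (hR.tick (t := 1 + c.compile.cost) (by omega))
      obtain ⟨σ₂, s₂, τ₂, h4, h5, h6⟩ := ihR _ _ h3 h2
      exact ⟨_, _, _, .loopStep (by rw [he]; simp [hs]) h1 h4, h5, h6⟩

end Soundness

/-! ## Passes and page accesses -/

/-- Only a move opens a pass, and it takes a step. This crude bound serves for the texts of bounded
length. -/
theorem Exec.passes_le_time {m : Machine} {P : Cmd} {s t : State} (h : Exec m P s t) :
    t.passes + s.time ≤ s.passes + t.time := by
  induction h with
  | seq _ _ h1 h2 => omega
  | condTrue _ _ h | condFalse _ _ h => simp only [State.tick] at h; omega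
  | loopStep _ _ _ h1 h2 => simp only [State.tick] at h1; omega
  | moveLeft s k | moveRight s k =>
    simp only [State.moveTo, State.tick]
    split_ifs <;> omega
  | _ => simp only [State.tick, State.setReg, State.setMem, State.setBit]; omega

/-- Page accesses that the scan under way on disk `k` can still cause. -/
def State.rest (m : Machine) (R : ℕ) (s : State) (k : Disk) : ℕ :=
  match s.dir k with
  | none => 0
  | some .toLeft => 2 * (s.head k / (m.B * m.w))
  | some .toRight => 2 * (R - s.head k / (m.B * m.w))

/-- Amortization: crossing a page boundary in the direction of the scan lowers `rest` by 2, which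
pays for the write-back and the fetch. A new pass can raise the potential, but to no more than `2 *
R` together with the accesses of its first move. -/
theorem State.rest_moveTo {m : Machine} {R : ℕ} (s : State) (k : Disk) {δ : Dir} {q : ℕ}
    (hδ : δ = .toLeft ∧ s.head k = q + 1 ∨ δ = .toRight ∧ q = s.head k + 1)
    (hR : s.head k / (m.B * m.w) ≤ R) (hR' : q / (m.B * m.w) ≤ R) :
    (s.moveTo m k δ q).rest m R k + (if s.head k / (m.B * m.w) = q / (m.B * m.w) then 0 else 2) ≤
      s.rest m R k + 2 * R * (if s.dir k = some δ then 0 else 1) := by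
  have hsucc : ∀ h : ℕ, h / (m.B * m.w) ≤ (h + 1) / (m.B * m.w) ∧
      (h + 1) / (m.B * m.w) ≤ h / (m.B * m.w) + 1 := fun h => by
    rw [Nat.succ_div]; split_ifs <;> omega
  have hd : (s.moveTo m k δ q).dir k = some δ := by simp [State.moveTo]
  have hh : (s.moveTo m k δ q).head k = q := by simp [State.moveTo]
  unfold State.rest
  rw [hd, hh]
  clear hd hh
  rcases hδ with ⟨rfl, h⟩ | ⟨rfl, h⟩
  · have h1 := hsucc q
    rw [h] at hR ⊢
    generalize (q + 1) / (m.B * m.w) = a at *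
    generalize q / (m.B * m.w) = b at *
    rcases hdk : s.dir k with _ | _ | _ <;>
      simp only [reduceCtorEq, if_false, if_true, Option.some.injEq] <;> split_ifs <;> omega
  · have h1 := hsucc (s.head k)
    rw [h] at hR' ⊢
    generalize (s.head k + 1) / (m.B * m.w) = a at *
    generalize s.head k / (m.B * m.w) = b at *
    rcases hdk : s.dir k with _ | _ | _ <;>
      simp only [reduceCtorEq, if_false, if_true, Option.some.injEq] <;> split_ifs <;> omega

/-- A pass over a disk of at most `R + 1` pages causes at most `2 * R` page accesses. -/
theorem Exec.pageAccesses_le {m : Machine} {R : ℕ} (hsize : ∀ k, m.size k / (m.B * m.w) ≤ R)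
    {P : Cmd} {s t : State} (h : Exec m P s t) (hs : ∀ k, s.head k ≤ m.size k) :
    (∀ k, t.head k ≤ m.size k) ∧
      t.pageAccesses + t.rest m R .input + t.rest m R .output + t.rest m R .work +
        2 * R * s.passes ≤
      s.pageAccesses + s.rest m R .input + s.rest m R .output + s.rest m R .work +
        2 * R * t.passes := by
  have move : ∀ (s : State) (k : Disk) (δ : Dir) (q : ℕ), (∀ k, s.head k ≤ m.size k) →
      q ≤ m.size k → (δ = .toLeft ∧ s.head k = q + 1 ∨ δ = .toRight ∧ q = s.head k + 1) →
      (∀ l, (s.moveTo m k δ q).head l ≤ m.size l) ∧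
      (s.moveTo m k δ q).pageAccesses + (s.moveTo m k δ q).rest m R .input +
        (s.moveTo m k δ q).rest m R .output + (s.moveTo m k δ q).rest m R .work +
        2 * R * s.passes ≤
      s.pageAccesses + s.rest m R .input + s.rest m R .output + s.rest m R .work +
        2 * R * (s.moveTo m k δ q).passes := by
    intro s k δ q hs hq hδ
    have h1 := State.rest_moveTo s k hδ ((Nat.div_le_div_right (hs k)).trans (hsize k))
      ((Nat.div_le_div_right hq).trans (hsize k))
    have h2 : ∀ l, l ≠ k → (s.moveTo m k δ q).rest m R l = s.rest m R l := fun l hl => by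
      simp [State.rest, State.moveTo, Function.update_of_ne hl]
    have h3 : (s.moveTo m k δ q).pageAccesses = s.pageAccesses +
        (if s.head k / (m.B * m.w) = q / (m.B * m.w) then 0 else 2) := rfl
    have h4 : (s.moveTo m k δ q).passes = s.passes + (if s.dir k = some δ then 0 else 1) := rfl
    refine ⟨fun l => ?_, ?_⟩
    · by_cases hl : l = k
      · subst hl; simpa [State.moveTo] using hq
      · simpa [State.moveTo, Function.update_of_ne hl] using hs l
    · rw [h3, h4, Nat.mul_add]
      cases k
      · rw [h2 .output (by decide), h2 .work (by decide)]; omega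
      · rw [h2 .input (by decide), h2 .work (by decide)]; omega
      · rw [h2 .input (by decide), h2 .output (by decide)]; omega
  induction h with
  | seq _ _ h1 h2 =>
    obtain ⟨a1, b1⟩ := h1 hs
    obtain ⟨a2, b2⟩ := h2 a1
    exact ⟨a2, by omega⟩
  | condTrue _ _ h | condFalse _ _ h => exact h hs
  | loopStep _ _ _ h1 h2 =>
    obtain ⟨a1, b1⟩ := h1 hs
    obtain ⟨a2, b2⟩ := h2 a1
    refine ⟨a2, ?_⟩
    simp only [State.tick, State.rest] at b1 b2 ⊢
    omega
  | moveLeft s k hk => exact move s k _ _ hs (by have := hs k; omega) (.inl ⟨rfl, by omega⟩)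
  | moveRight s k hk => exact move s k _ _ hs (by have := hs k; omega) (.inr ⟨rfl, by omega⟩)
  | _ => exact ⟨hs, le_rfl⟩

end ExtMem

namespace SuffixIndex

/-! ## Orders on suffixes of integer strings -/

/-- The suffix of `S` at `i` is smaller than the one at `j`. -/
def slt (S : ℕ → ℕ) (i j : ℕ) : Prop :=
  ∃ k, (∀ l < k, S (i + l) = S (j + l)) ∧ S (i + k) < S (j + k)

theorem slt_irrefl (S : ℕ → ℕ) (i : ℕ) : ¬ slt S i i := fun ⟨_, _, h⟩ => lt_irrefl _ h

theorem slt_of_lt {S : ℕ → ℕ} {i j : ℕ} (h : S i < S j) : slt S i j :=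
  ⟨0, fun _ h => absurd h (Nat.not_lt_zero _), h⟩

theorem slt_trans {S : ℕ → ℕ} {i j k : ℕ} (h : slt S i j) (h' : slt S j k) : slt S i k := by
  obtain ⟨a, ha, ha'⟩ := h
  obtain ⟨b, hb, hb'⟩ := h'
  rcases lt_trichotomy a b with hab | rfl | hab
  · exact ⟨a, fun l hl => (ha l hl).trans (hb l (hl.trans hab)), (hb a hab) ▸ ha'⟩
  · exact ⟨a, fun l hl => (ha l hl).trans (hb l hl), ha'.trans hb'⟩
  · exact ⟨b, fun l hl => (ha l (hl.trans hab)).trans (hb l hl), (ha b hab) ▸ hb'⟩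

theorem slt_asymm {S : ℕ → ℕ} {i j : ℕ} (h : slt S i j) : ¬ slt S j i :=
  fun h' => slt_irrefl S i (slt_trans h h')

theorem slt_succ {S : ℕ → ℕ} {i j : ℕ} (h : S i = S j) : slt S i j ↔ slt S (i + 1) (j + 1) := by
  constructor
  · rintro ⟨k, hk, hk'⟩
    rcases k with _ | k
    · simp only [Nat.add_zero] at hk'; omega
    · refine ⟨k, fun l hl => ?_, ?_⟩
      · have := hk (l + 1) (by omega)
        rwa [Nat.add_right_comm, Nat.add_right_comm j]
      · rwa [Nat.add_right_comm, Nat.add_right_comm j]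
  · rintro ⟨k, hk, hk'⟩
    refine ⟨k + 1, fun l hl => ?_, ?_⟩
    · rcases l with _ | l
      · exact h
      · have := hk l (by omega)
        rwa [Nat.add_right_comm, Nat.add_right_comm j] at this
    · rwa [Nat.add_right_comm, Nat.add_right_comm j] at hk'

theorem slt_iff {S : ℕ → ℕ} {i j : ℕ} :
    slt S i j ↔ S i < S j ∨ S i = S j ∧ slt S (i + 1) (j + 1) := by
  rcases lt_trichotomy (S i) (S j) with h | h | h
  · simp [h, slt_of_lt h]
  · simp [h, slt_succ h]
  · simp only [h.ne', false_and, or_false, not_lt_of_gt h, iff_false]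
    exact slt_asymm (slt_of_lt h)

/-- The last character of the string `S` of length `N` is unique. -/
structure UL (S : ℕ → ℕ) (N : ℕ) : Prop where
  pos : 0 < N
  ne : ∀ i, i + 1 < N → S i ≠ S (N - 1)

/-- Read in parallel, two suffixes differ at the latest when the shorter one reaches the last
character, because the other one then sees a character from an earlier position. -/
theorem UL.total {S : ℕ → ℕ} {N : ℕ} (h : UL S N) {i j : ℕ} (hi : i < N) (hj : j < N)
    (hij : i ≠ j) : slt S i j ∨ slt S j i := by
  classical
  wlog hlt : i < j generalizing i j
  · exact (this hj hi hij.symm (by omega)).symm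
  have hex : ∃ k, S (i + k) ≠ S (j + k) := by
    refine ⟨N - 1 - j, ?_⟩
    rw [show j + (N - 1 - j) = N - 1 by omega]
    exact h.ne _ (by omega)
  have h1 := Nat.find_spec hex
  have h2 : ∀ l < Nat.find hex, S (i + l) = S (j + l) := fun l hl => by
    simpa using Nat.find_min hex hl
  rcases lt_or_gt_of_ne h1 with h3 | h3
  · exact .inl ⟨_, h2, h3⟩
  · exact .inr ⟨_, fun l hl => (h2 l hl).symm, h3⟩

/-- Transfer of suffix comparisons between strings. -/
theorem slt_transfer {X Y : ℕ → ℕ} {φ : ℕ → ℕ} {N : ℕ}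
    (h0 : ∀ p q, p < N → q < N → X p < X q → slt Y (φ p) (φ q))
    (h1 : ∀ p q, p < N → q < N → p ≠ q → X p = X q → p + 1 < N ∧ q + 1 < N ∧
      (slt Y (φ (p + 1)) (φ (q + 1)) → slt Y (φ p) (φ q)))
    (hX : UL X N) {p q : ℕ} (hp : p < N) (hq : q < N) : slt X p q ↔ slt Y (φ p) (φ q) := by
  have key : ∀ p q, p < N → q < N → slt X p q → slt Y (φ p) (φ q) := by
    rintro p q hp hq ⟨k, hk, hk'⟩
    induction k generalizing p q with
    | zero => exact h0 p q hp hq hk'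
    | succ k ih =>
      have hpq : p ≠ q := by rintro rfl; exact lt_irrefl _ hk'
      obtain ⟨a, b, c⟩ := h1 p q hp hq hpq (hk 0 (by omega))
      refine c (ih _ _ a b (fun l hl => ?_) ?_)
      · have := hk (l + 1) (by omega)
        rwa [Nat.add_right_comm, Nat.add_right_comm q]
      · rwa [Nat.add_right_comm, Nat.add_right_comm q]
  -- The converse is free: `slt X` is total on these positions and `slt Y` is asymmetric.
  refine ⟨key p q hp hq, fun h => ?_⟩
  have hpq : p ≠ q := by rintro rfl; exact slt_irrefl _ _ h
  refine (hX.total hp hq hpq).resolve_right fun h' => ?_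
  exact slt_asymm h (key q p hq hp h')

theorem UL.eq_lt {S : ℕ → ℕ} {N : ℕ} (h : UL S N) {i j : ℕ} (hi : i < N) (hj : j < N)
    (hij : i ≠ j) (e : S i = S j) : i + 1 < N ∧ j + 1 < N := by
  constructor
  · by_contra hc
    obtain rfl : i = N - 1 := by omega
    exact h.ne j (by omega) e.symm
  · by_contra hc
    obtain rfl : j = N - 1 := by omega
    exact h.ne i (by omega) e

/-! ## Ranks -/

/-- `R` ranks the numbers below `N` according to the strict order `lt`. -/
structure IsRank (lt : ℕ → ℕ → Prop) (N : ℕ) (R : ℕ → ℕ) : Prop where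
  lt_len : ∀ i < N, R i < N
  iff : ∀ i j, i < N → j < N → (R i < R j ↔ lt i j)

def Total (lt : ℕ → ℕ → Prop) (N : ℕ) : Prop :=
  ∀ i j, i < N → j < N → i ≠ j → lt i j ∨ lt j i

namespace IsRank

variable {lt : ℕ → ℕ → Prop} {N : ℕ} {R : ℕ → ℕ}

theorem inj (h : IsRank lt N R) (ht : Total lt N) {i j : ℕ} (hi : i < N) (hj : j < N)
    (e : R i = R j) : i = j := by
  by_contra hij
  rcases ht i j hi hj hij with h1 | h1
  · have := (h.iff i j hi hj).2 h1; omega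
  · have := (h.iff j i hj hi).2 h1; omega

/-- An injective map of a finite set into itself is onto. -/
theorem surj (h : IsRank lt N R) (ht : Total lt N) {r : ℕ} (hr : r < N) : ∃ i < N, R i = r := by
  have hsub : (Finset.range N).image R ⊆ Finset.range N := fun x hx => by
    obtain ⟨i, hi, rfl⟩ := Finset.mem_image.1 hx
    exact Finset.mem_range.2 (h.lt_len i (Finset.mem_range.1 hi))
  have hcard : ((Finset.range N).image R).card = N := by
    rw [Finset.card_image_of_injOn, Finset.card_range]
    intro i hi j hj e
    exact h.inj ht (by simpa using hi) (by simpa using hj) e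
  have heq := Finset.eq_of_subset_of_card_le hsub (by rw [hcard, Finset.card_range])
  have hmem : r ∈ (Finset.range N).image R := by rw [heq]; exact Finset.mem_range.2 hr
  obtain ⟨i, hi, e⟩ := Finset.mem_image.1 hmem
  exact ⟨i, Finset.mem_range.1 hi, e⟩

theorem card_lt (h : IsRank lt N R) (ht : Total lt N) {r : ℕ} (hr : r ≤ N) :
    ((Finset.range N).filter fun i => R i < r).card = r := by
  have himg : ((Finset.range N).filter fun i => R i < r).image R = Finset.range r := by
    ext x
    simp only [Finset.mem_image, Finset.mem_filter, Finset.mem_range]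
    constructor
    · rintro ⟨i, ⟨_, h1⟩, rfl⟩; exact h1
    · intro hx
      obtain ⟨i, hi, rfl⟩ := h.surj ht (by omega : x < N)
      exact ⟨i, ⟨hi, hx⟩, rfl⟩
  have hinj : Set.InjOn R ((Finset.range N).filter fun i => R i < r) := by
    intro i hi j hj e
    simp only [Finset.coe_filter, Finset.mem_range, Set.mem_ofPred_eq] at hi hj
    exact h.inj ht hi.1 hj.1 e
  rw [← Finset.card_image_of_injOn hinj, himg, Finset.card_range]

/-- Membership in a down-set is decided by its cardinality. -/
theorem mem_downset (h : IsRank lt N R) (ht : Total lt N) (P : ℕ → Prop) [DecidablePred P]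
    (hP : ∀ i j, i < N → j < N → lt i j → P j → P i) {i : ℕ} (hi : i < N) :
    P i ↔ R i < ((Finset.range N).filter P).card := by
  have hRi := h.lt_len i hi
  constructor
  · intro hPi
    have hsub : ((Finset.range N).filter fun j => R j < R i + 1) ⊆ (Finset.range N).filter P := by
      intro j hj
      simp only [Finset.mem_filter, Finset.mem_range] at hj ⊢
      refine ⟨hj.1, ?_⟩
      rcases Nat.lt_succ_iff_lt_or_eq.1 hj.2 with h1 | h1
      · exact hP j i hj.1 hi ((h.iff j i hj.1 hi).1 h1) hPi
      · rwa [h.inj ht hj.1 hi h1]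
    have := Finset.card_le_card hsub
    rw [h.card_lt ht (by omega)] at this
    omega
  · intro hlt
    by_contra hPi
    have hsub : (Finset.range N).filter P ⊆ (Finset.range N).filter fun j => R j < R i := by
      intro j hj
      simp only [Finset.mem_filter, Finset.mem_range] at hj ⊢
      refine ⟨hj.1, ?_⟩
      by_contra hc
      rcases Nat.lt_or_ge (R i) (R j) with h1 | h1
      · exact hPi (hP i j hi hj.1 ((h.iff i j hi hj.1).1 h1) hj.2)
      · exact hPi (h.inj ht hj.1 hi (by omega) ▸ hj.2)
    have := Finset.card_le_card hsub
    rw [h.card_lt ht hRi.le] at this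
    omega

end IsRank

/-! ## Ranks of suffixes among the suffixes in a block -/

open Classical in
/-- The number of positions in `[a, a + N)` at which the suffix of `t` is smaller than at `j`. -/
noncomputable def cnt (t : ℕ → ℕ) (a N j : ℕ) : ℕ :=
  ((Finset.range N).filter fun i => slt t (a + i) j).card

open Classical in
theorem cnt_succ (t : ℕ → ℕ) (a N j : ℕ) :
    cnt t a (N + 1) j = cnt t a N j + if slt t (a + N) j then 1 else 0 := by
  unfold cnt
  rw [Finset.range_add_one, Finset.filter_insert]
  split_ifs with h
  · rw [Finset.card_insert_of_notMem (by simp)]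
  · rfl

theorem cnt_le (t : ℕ → ℕ) (a N j : ℕ) : cnt t a N j ≤ N := by
  classical
  exact (Finset.card_filter_le _ _).trans (Finset.card_range N).le

theorem cnt_add (t : ℕ → ℕ) (a N N' j : ℕ) :
    cnt t a (N + N') j = cnt t a N j + cnt t (a + N) N' j := by
  induction N' with
  | zero => rfl
  | succ k ih => rw [← Nat.add_assoc, cnt_succ, ih, cnt_succ, Nat.add_assoc, Nat.add_assoc a]

section Block

variable {t : ℕ → ℕ} {a N : ℕ} {R : ℕ → ℕ}

/-- The block suffixes below suffix `j` form an initial segment of the sorted block, so their number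
alone decides every comparison of `j` with the block. This is why one counter per scanned position
is enough. -/
theorem slt_iff_lt_cnt (h : IsRank (fun i j => slt t (a + i) (a + j)) N R)
    (ht : Total (fun i j => slt t (a + i) (a + j)) N) {i : ℕ} (hi : i < N) (j : ℕ) :
    slt t (a + i) j ↔ R i < cnt t a N j := by
  classical
  exact h.mem_downset ht (fun i => slt t (a + i) j) (fun i k _ _ h1 h2 => slt_trans h1 h2) hi

theorem rank_eq_cnt (h : IsRank (fun i j => slt t (a + i) (a + j)) N R)
    (ht : Total (fun i j => slt t (a + i) (a + j)) N) {i : ℕ} (hi : i < N) :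
    R i = cnt t a N (a + i) := by
  classical
  rw [cnt, ← h.card_lt ht (h.lt_len i hi).le]
  congr 1
  refine Finset.filter_congr fun j hj => ?_
  exact h.iff j i (Finset.mem_range.1 hj) hi

/-- Backward search: the rank of a suffix from the rank of the next one. -/
theorem cnt_step {e : ℕ} (h : IsRank (fun i j => slt t (a + i) (a + j)) (e + 1) R)
    (ht : Total (fun i j => slt t (a + i) (a + j)) (e + 1)) (j : ℕ) [Decidable (slt t (a + e) j)] :
    cnt t a (e + 1) j = ((Finset.range e).filter fun i => t (a + i) < t j).card +
      ((Finset.range e).filter fun i =>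
        t (a + i) = t j ∧ R (i + 1) < cnt t a (e + 1) (j + 1)).card +
      if slt t (a + e) j then 1 else 0 := by
  classical
  rw [cnt_succ]
  congr 1
  · rw [cnt, ← Finset.card_union_of_disjoint]
    · congr 1
      ext i
      simp only [Finset.mem_filter, Finset.mem_union, Finset.mem_range]
      rw [← and_or_left]
      refine and_congr_right fun hi => ?_
      rw [slt_iff, ← slt_iff_lt_cnt h ht (by omega : i + 1 < e + 1)]
      rfl
    · rw [Finset.disjoint_filter]
      intro i _ h1 h2
      omega
  · congr

end Block

/-! ## Texts as padded strings -/

/-- The text with characters starting from 1, followed by zeros. -/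
def padded {σ n : ℕ} (T : Fin n → Fin σ) (p : ℕ) : ℕ :=
  if h : p < n then (T ⟨p, h⟩ : ℕ) + 1 else 0

section Padded

variable {σ n : ℕ} (T : Fin n → Fin σ)

theorem padded_le (p : ℕ) : padded T p ≤ σ := by
  unfold padded
  split_ifs with h
  · exact (T ⟨p, h⟩).isLt
  · exact Nat.zero_le _

theorem padded_pos {p : ℕ} (h : p < n) : 0 < padded T p := by simp [padded, h]

theorem padded_eq_zero {p : ℕ} (h : n ≤ p) : padded T p = 0 := by simp [padded, not_lt.2 h]

/-- With characters from 1 on and zeros behind the text, a proper prefix loses at the first zero, so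
the lexicographic order of lists becomes a comparison at the first mismatch. -/
theorem suffix_lt_iff (i j : Fin n) : suffix T i < suffix T j ↔ slt (padded T) i j := by
  have key : ∀ i j : Fin n, suffix T i < suffix T j → slt (padded T) i j := by
    intro i j h
    have get : ∀ (i : Fin n) (l : ℕ) (hl : l < (suffix T i).length),
        padded T (i + l) = ((suffix T i)[l] : ℕ) + 1 := by
      intro i l hl
      have : (i : ℕ) + l < n := by simp [suffix] at hl; omega
      simp [padded, this, suffix]
    rcases (List.lt_iff_exists).1 h with ⟨h1, h2⟩ | ⟨k, h1, h2, h3, h4⟩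
    · refine ⟨(suffix T i).length, fun l hl => ?_, ?_⟩
      · rw [get i l hl, get j l (hl.trans h2)]
        have : (suffix T i)[l] = ((suffix T j).take (suffix T i).length)[l]'(by
          simp; omega) := by congr 1
        rw [this]
        simp
      · rw [padded_eq_zero T (by simp [suffix])]
        exact padded_pos T (by simp [suffix] at h2 ⊢; omega)
    · refine ⟨k, fun l hl => ?_, ?_⟩
      · rw [get i l (hl.trans h1), get j l (hl.trans h2), h3 l hl]
      · rw [get i k h1, get j k h2]
        have : ((suffix T i)[k] : ℕ) < (suffix T j)[k] := h4
        omega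
  refine ⟨key i j, fun h => ?_⟩
  rcases lt_trichotomy (suffix T i) (suffix T j) with h1 | h1 | h1
  · exact h1
  · have : i = j := by
      have h' := congrArg List.length h1
      simp only [suffix, List.length_drop, List.length_ofFn] at h'
      exact Fin.ext (by omega)
    subst this
    exact absurd h (slt_irrefl _ _)
  · exact absurd h (slt_asymm (key j i h1))

/-- The form of the rank that is additive over the blocks of the text. -/
theorem pos_eq_cnt (i : Fin n) : pos T i = 1 + cnt (padded T) 0 n i := by
  classical
  have h1 : cnt (padded T) 0 n i =
      ((Finset.univ : Finset (Fin n)).filter fun j => suffix T j < suffix T i).card := by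
    unfold cnt
    symm
    refine Finset.card_bij (fun j _ => (j : ℕ)) (fun j hj => ?_) (fun j _ k _ e => Fin.ext e)
      (fun j hj => ?_)
    · simp only [Finset.mem_filter, Finset.mem_univ, true_and, Finset.mem_range] at hj ⊢
      exact ⟨j.isLt, by rw [Nat.zero_add]; exact (suffix_lt_iff T j i).1 hj⟩
    · simp only [Finset.mem_filter, Finset.mem_range, Nat.zero_add] at hj
      exact ⟨⟨j, hj.1⟩, by simpa [suffix_lt_iff] using hj.2, rfl⟩
  have h2 : ((Finset.univ : Finset (Fin n)).filter fun j => suffix T j < suffix T i).card =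
      ((sa T).symm i : ℕ) := by
    rw [← Fin.card_Iio ((sa T).symm i)]
    symm
    refine Finset.card_bij (fun k _ => sa T k) (fun k hk => ?_)
      (fun k _ l _ e => (sa T).injective e) (fun j hj => ?_)
    · simp only [Finset.mem_filter, Finset.mem_univ, true_and, Finset.mem_Iio] at hk ⊢
      have := sa_strictMono T hk
      simpa using this
    · refine ⟨(sa T).symm j, ?_, by simp⟩
      simp only [Finset.mem_filter, Finset.mem_univ, true_and, Finset.mem_Iio] at hj ⊢
      rw [← (sa_strictMono T).lt_iff_lt]
      simpa using hj
  rw [pos, h1, h2, Nat.add_comm]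

end Padded

/-! ## The string that represents a block -/

section BlockString

open Classical in
/-- The suffixes of the block `[a, a + e]` of `t` are sorted like those of the string whose
characters are augmented by the result of the comparison with the last of these suffixes. -/
theorem block_string {t X : ℕ → ℕ} {a e : ℕ}
    (hX : ∀ i < e, X i = t (a + i) + 2 * if slt t (a + e) (a + i) then 1 else 0)
    (he : X e = t (a + e) + 1) (ht : Total (fun i j => slt t (a + i) (a + j)) (e + 1)) :
    UL X (e + 1) ∧ ∀ i j, i < e + 1 → j < e + 1 → (slt X i j ↔ slt t (a + i) (a + j)) := by
  -- The outcome adds 0 or 2, and the last character gets 1. A smaller suffix has `X i ≤ t (a + e) <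
  -- X e`, a larger one `X i ≥ t (a + e) + 2 > X e`. So the last character is unique and separates
  -- the two kinds.
  have hlast : ∀ i < e, (X i < X e ∧ slt t (a + i) (a + e)) ∨
      (X e < X i ∧ slt t (a + e) (a + i)) := by
    intro i hi
    rcases ht i e (by omega) (by omega) (by omega) with h | h
    · left
      refine ⟨?_, h⟩
      rw [hX i hi, he, if_neg (slt_asymm h)]
      rcases slt_iff.1 h with h1 | h1 <;> omega
    · right
      refine ⟨?_, h⟩
      rw [hX i hi, he, if_pos h]
      rcases slt_iff.1 h with h1 | h1 <;> omega
  have hul : UL X (e + 1) := by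
    refine ⟨Nat.succ_pos _, fun i hi => ?_⟩
    rcases hlast i (by omega) with h | h
    · exact h.1.ne
    · exact h.1.ne'
  refine ⟨hul, fun i j hi hj => ?_⟩
  refine slt_transfer (Y := t) (φ := fun p => a + p) (fun p q hp hq hpq => ?_)
    (fun p q hp hq hpq h => ?_) hul hi hj
  · rcases Nat.lt_succ_iff_lt_or_eq.1 hp with hp' | rfl
    · rcases Nat.lt_succ_iff_lt_or_eq.1 hq with hq' | rfl
      · rw [hX p hp', hX q hq'] at hpq
        split_ifs at hpq with h1 h2 h2
        · exact slt_of_lt (by omega)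
        · exact slt_of_lt (by omega)
        -- Here `p` is below the suffix at `e` and `q` is above it, so no characters need to be
        -- compared.
        · rcases ht p e (by omega) (by omega) (by omega) with h3 | h3
          · exact slt_trans h3 h2
          · exact absurd h3 h1
        · exact slt_of_lt (by omega)
      · rcases hlast p hp' with h | h
        · exact h.2
        · omega
    · rcases Nat.lt_succ_iff_lt_or_eq.1 hq with hq' | rfl
      · rcases hlast q hq' with h | h
        · omega
        · exact h.2
      · omega
  · obtain ⟨h1, h2⟩ := hul.eq_lt hp hq hpq h
    refine ⟨h1, h2, fun h3 => ?_⟩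
    rw [hX p (by omega), hX q (by omega)] at h
    -- Equal characters of `X` come from equal outcomes: otherwise the suffix above the one at `e`
    -- would begin with a character smaller by 2 than the suffix below it.
    have h4 : t (a + p) = t (a + q) := by
      split_ifs at h with h5 h6 h6
      · omega
      · rcases ht q e (by omega) (by omega) (by omega) with h7 | h7
        · have := slt_iff.1 (slt_trans h7 h5); omega
        · exact absurd h7 h6
      · rcases ht p e (by omega) (by omega) (by omega) with h7 | h7
        · have := slt_iff.1 (slt_trans h7 h6); omega
        · exact absurd h7 h5
      · omega
    exact (slt_succ h4).2 h3

end BlockString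

/-! ## The recursion on triples -/

/-- The positions of a string of length `N` that are not divisible by three. -/
def smp (N p : ℕ) : ℕ := if p < (N + 1) / 3 then 3 * p + 1 else 3 * (p - (N + 1) / 3) + 2

/-- The lexicographic order of triples of characters. -/
def tlt (S : ℕ → ℕ) (x y : ℕ) : Prop :=
  S x < S y ∨ S x = S y ∧ (S (x + 1) < S (y + 1) ∨
    S (x + 1) = S (y + 1) ∧ S (x + 2) < S (y + 2))

theorem slt_of_tlt {S : ℕ → ℕ} {x y : ℕ} (h : tlt S x y) : slt S x y := by
  rcases h with h | ⟨h, h' | ⟨h', h''⟩⟩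
  · exact slt_of_lt h
  · exact (slt_succ h).2 (slt_of_lt h')
  · exact (slt_succ h).2 ((slt_succ h').2 (slt_of_lt h''))

/-- The two summands count the positions congruent to 1 and to 2 modulo 3; `smp` lists the former
first. -/
theorem smp_card (N : ℕ) : 2 * N / 3 = (N + 1) / 3 + N / 3 := by
  have : N % 3 = 0 ∨ N % 3 = 1 ∨ N % 3 = 2 := by omega
  rcases this with h | h | h <;> omega

theorem smp_lt {N p : ℕ} (hp : p < 2 * N / 3) : smp N p < N := by
  have := smp_card N
  unfold smp; split_ifs <;> omega

/-- The names `R` of the triples at the sampled positions form a string whose suffixes are sorted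
like those of `S` at the sampled positions. -/
theorem triples {S R : ℕ → ℕ} {N : ℕ} (hS : UL S N) (hN : 2 ≤ N)
    (hR : ∀ p q, p < 2 * N / 3 → q < 2 * N / 3 → (R p < R q ↔ tlt S (smp N p) (smp N q))) :
    UL R (2 * N / 3) ∧ ∀ p q, p < 2 * N / 3 → q < 2 * N / 3 →
      (slt R p q ↔ slt S (smp N p) (smp N q)) := by
  -- Equal triples at different positions cannot contain the unique last character of `S`. Hence
  -- both positions have a successor in their residue class, three places on, and no separator is
  -- needed where one class ends in the string of names.
  have key : ∀ p q, p < 2 * N / 3 → q < 2 * N / 3 → p ≠ q → R p = R q →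
      p + 1 < 2 * N / 3 ∧ q + 1 < 2 * N / 3 ∧ smp N (p + 1) = smp N p + 3 ∧
        smp N (q + 1) = smp N q + 3 ∧ S (smp N p) = S (smp N q) ∧
        S (smp N p + 1) = S (smp N q + 1) ∧ S (smp N p + 2) = S (smp N q + 2) := by
    intro p q hp hq hpq h
    have h1 : ¬ tlt S (smp N p) (smp N q) := fun hc => by
      have := (hR p q hp hq).2 hc; omega
    have h2 : ¬ tlt S (smp N q) (smp N p) := fun hc => by
      have := (hR q p hq hp).2 hc; omega
    have hne : smp N p ≠ smp N q := by unfold smp; split_ifs <;> omega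
    have hp' := smp_lt hp
    have hq' := smp_lt hq
    unfold tlt at h1 h2
    have e0 : S (smp N p) = S (smp N q) := by omega
    have e1 : S (smp N p + 1) = S (smp N q + 1) := by omega
    have e2 : S (smp N p + 2) = S (smp N q + 2) := by omega
    obtain ⟨a0, b0⟩ := hS.eq_lt hp' hq' hne e0
    obtain ⟨a1, b1⟩ := hS.eq_lt a0 b0 (by omega) e1
    obtain ⟨a2, b2⟩ := hS.eq_lt a1 b1 (by omega) e2
    have step : ∀ p, p < 2 * N / 3 → smp N p + 3 < N →
        p + 1 < 2 * N / 3 ∧ smp N (p + 1) = smp N p + 3 := fun p hp h => by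
      have := smp_card N
      unfold smp at h ⊢; split_ifs at h ⊢ <;> omega
    obtain ⟨c, d⟩ := step p hp a2
    obtain ⟨c', d'⟩ := step q hq b2
    exact ⟨c, c', d, d', e0, e1, e2⟩
  -- A name equal to the last one would provide the last index with a successor.
  have hul : UL R (2 * N / 3) := by
    refine ⟨by omega, fun i hi h => ?_⟩
    have := (key i (2 * N / 3 - 1) (by omega) (by omega) (by omega) h).2.1
    omega
  refine ⟨hul, fun p q hp hq => slt_transfer (fun p q hp hq h => ?_)
    (fun p q hp hq hpq h => ?_) hul hp hq⟩
  · exact slt_of_tlt ((hR p q hp hq).1 h)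
  · obtain ⟨a, b, c, d, e0, e1, e2⟩ := key p q hp hq hpq h
    refine ⟨a, b, fun h' => ?_⟩
    rw [c, d] at h'
    exact (slt_succ e0).2 ((slt_succ e1).2 ((slt_succ e2).2 h'))

end SuffixIndex

namespace ExtMem

/-! ## Symbolic execution -/

attribute [simp] Ex.val_var Ex.val_lit Ex.val_ofNat Ex.val_add Ex.val_sub Ex.val_mul Ex.val_div
  Ex.val_mod Ex.ok_var Ex.ok_lit Ex.ok_ofNat Ex.ok_add Ex.ok_sub Ex.ok_mul Ex.ok_div Ex.ok_mod

section

variable (ρ : Var → ℕ) (W : ℕ) (e f : Ex) (c d : Cn)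

@[simp] theorem Cn.holds_lt : (Cn.lt e f).holds ρ ↔ e.val ρ < f.val ρ := Iff.rfl
@[simp] theorem Cn.holds_le : (Cn.le e f).holds ρ ↔ e.val ρ ≤ f.val ρ := Iff.rfl
@[simp] theorem Cn.holds_eq : (Cn.eq e f).holds ρ ↔ e.val ρ = f.val ρ := Iff.rfl
@[simp] theorem Cn.holds_and : (Cn.and c d).holds ρ ↔ c.holds ρ ∧ d.holds ρ := Iff.rfl
@[simp] theorem Cn.ok_lt : (Cn.lt e f).ok W ρ ↔ e.ok W ρ ∧ f.ok W ρ := Iff.rfl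
@[simp] theorem Cn.ok_le : (Cn.le e f).ok W ρ ↔ e.ok W ρ ∧ f.ok W ρ := Iff.rfl
@[simp] theorem Cn.ok_eq : (Cn.eq e f).ok W ρ ↔ e.ok W ρ ∧ f.ok W ρ := Iff.rfl
@[simp] theorem Cn.ok_and : (Cn.and c d).ok W ρ ↔ c.ok W ρ ∧ d.ok W ρ := Iff.rfl

end

section

variable (s : St) (x : Var) (v i : ℕ) (a : Arr) (k : Disk) (b : Bool) (δ : Dir)

@[simp] theorem St.set_reg : (s.set x v).reg = Function.update s.reg x v := rfl
@[simp] theorem St.set_arr : (s.set x v).arr = s.arr := rfl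
@[simp] theorem St.set_tape : (s.set x v).tape = s.tape := rfl
@[simp] theorem St.set_head : (s.set x v).head = s.head := rfl
@[simp] theorem St.setArr_reg : (s.setArr a i v).reg = s.reg := rfl
@[simp] theorem St.setArr_arr : (s.setArr a i v).arr =
    Function.update s.arr a (Function.update (s.arr a) i v) := rfl
@[simp] theorem St.setArr_tape : (s.setArr a i v).tape = s.tape := rfl
@[simp] theorem St.setArr_head : (s.setArr a i v).head = s.head := rfl
@[simp] theorem St.setBit_reg : (s.setBit k b).reg = s.reg := rfl
@[simp] theorem St.setBit_arr : (s.setBit k b).arr = s.arr := rfl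
@[simp] theorem St.setBit_tape : (s.setBit k b).tape =
    Function.update s.tape k (Function.update (s.tape k) (s.head k) b) := rfl
@[simp] theorem St.setBit_head : (s.setBit k b).head = s.head := rfl
@[simp] theorem St.moveTo_reg : (s.moveTo k δ i).reg = s.reg := rfl
@[simp] theorem St.moveTo_arr : (s.moveTo k δ i).arr = s.arr := rfl
@[simp] theorem St.moveTo_tape : (s.moveTo k δ i).tape = s.tape := rfl
@[simp] theorem St.moveTo_head : (s.moveTo k δ i).head = Function.update s.head k i := rfl

end

section

variable {Γ : Env} {Q : St → ℕ → Prop} {s : St} {τ : ℕ}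

@[simp] theorem wp_skip_iff : wp Γ .skip Q s τ ↔ Q s (τ + 1) := Iff.rfl
@[simp] theorem wp_assign_iff {x : Var} {e : Ex} :
    wp Γ (x ::= e) Q s τ ↔ e.ok Γ.W s.reg ∧ Q (s.set x (e.val s.reg)) (τ + 1) := Iff.rfl
@[simp] theorem wp_load_iff {x : Var} {a : Arr} {e : Ex} : wp Γ (.load x a e) Q s τ ↔
    e.ok Γ.W s.reg ∧ e.val s.reg < Γ.L ∧ Q (s.set x (s.arr a (e.val s.reg))) (τ + 1) := Iff.rfl
@[simp] theorem wp_store_iff {a : Arr} {e f : Ex} : wp Γ (.store a e f) Q s τ ↔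
    e.ok Γ.W s.reg ∧ f.ok Γ.W s.reg ∧ e.val s.reg < Γ.L ∧
      Q (s.setArr a (e.val s.reg) (f.val s.reg)) (τ + 1) := Iff.rfl
@[simp] theorem wp_read_iff {x : Var} {k : Disk} : wp Γ (.read x k) Q s τ ↔
    s.head k < Γ.size k ∧ Q (s.set x (s.tape k (s.head k)).toNat) (τ + 1) := Iff.rfl
@[simp] theorem wp_write_iff {k : Disk} {e : Ex} : wp Γ (.write k e) Q s τ ↔
    e.ok Γ.W s.reg ∧ s.head k < Γ.size k ∧ k ≠ .input ∧
      Q (s.setBit k ((e.val s.reg).testBit 0)) (τ + 1) := Iff.rfl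
@[simp] theorem wp_moveLeft_iff {k : Disk} : wp Γ (.move k .toLeft) Q s τ ↔
    0 < s.head k ∧ Q (s.moveTo k .toLeft (s.head k - 1)) (τ + 1) := Iff.rfl
@[simp] theorem wp_moveRight_iff {k : Disk} : wp Γ (.move k .toRight) Q s τ ↔
    s.head k < Γ.size k ∧ Q (s.moveTo k .toRight (s.head k + 1)) (τ + 1) := Iff.rfl
@[simp] theorem wp_seq_iff {p q : Prog} : wp Γ (p ;; q) Q s τ ↔ wp Γ p (wp Γ q Q) s τ := Iff.rfl
@[simp] theorem wp_ite_iff {c : Cn} {p q : Prog} : wp Γ (.ite c p q) Q s τ ↔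
    c.ok Γ.W s.reg ∧ (c.holds s.reg → wp Γ p Q s (τ + 1)) ∧
      (¬ c.holds s.reg → wp Γ q Q s (τ + 1)) := Iff.rfl

end

/-- A loop that counts from 0 and whose iterations take time at most `c`. -/
theorem wp_for {Γ : Env} {x : Var} {hi : Ex} {p : Prog} (I : ℕ → St → Prop) (c H : ℕ)
    {s : St} {τ : ℕ} (hW : 0 < Γ.W) (hI : I 0 (s.set x 0))
    (hhi : ∀ t, Frame (p ;; x ::= (x : Ex) + 1) (s.set x 0) t →
      hi.ok Γ.W t.reg ∧ hi.val t.reg = H)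
    (hp : ∀ i t τ', Frame (p ;; x ::= (x : Ex) + 1) (s.set x 0) t → i < H → I i t →
      t.reg x = i → wp Γ (p ;; x ::= (x : Ex) + 1)
        (fun u τ'' => I (i + 1) u ∧ u.reg x = i + 1 ∧ τ'' ≤ τ' + c) t τ') :
    wp Γ (x ::= 0 ;; .upTo x hi p)
      (fun t τ' => I H t ∧ t.reg x = H ∧ τ' ≤ τ + H * (c + 1) + 2) s τ := by
  refine ⟨hW, ?_⟩
  refine wp_mono (wp_upTo (Γ := Γ) (s := s.set x 0) I (fun i => i * (c + 1)) 0 H (by simp)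
    (Nat.zero_le _) hI hhi fun i t τ' hf _ hi hIt hx => ?_) fun t τ' ht => ⟨ht.1, ht.2.1, ?_⟩
  · refine wp_mono (hp i t τ' hf hi hIt hx) fun u τ'' hu => ⟨hu.1, hu.2.1, ?_⟩
    have := hu.2.2
    rw [Nat.add_mul]
    omega
  · have := ht.2.2
    omega

/-! ## Counting sort -/

/-- Stable sort of the `len` positions in the array `a` into `b` by the character at the distance
`δ`; the characters plus one are less than `K`. -/
def csort (a b : Arr) (δ : ℕ) : Prog :=
  (.i ::= 0 ;; .upTo .i Var.K (.store .CNT Var.i 0)) ;;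
  (.i ::= 0 ;; .upTo .i Var.len (.load .x a Var.i ;; .load .y .S (Var.off + Var.x + .lit δ) ;;
    .y ::= Var.y + 1 ;; .load .c .CNT Var.y ;; .store .CNT Var.y (Var.c + 1))) ;;
  .f ::= 0 ;;
  (.i ::= 0 ;; .upTo .i Var.K (.load .y .CNT Var.i ;; .f ::= Var.f + Var.y ;;
    .store .CNT Var.i Var.f)) ;;
  (.i ::= 0 ;; .upTo .i Var.len (.load .x a Var.i ;; .load .y .S (Var.off + Var.x + .lit δ) ;;
    .load .c .CNT Var.y ;; .store b Var.c Var.x ;; .store .CNT Var.y (Var.c + 1)))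

/-- The place of the item `q` after a stable sort of `n` items by the keys `k`. -/
def place (k : ℕ → ℕ) (n q : ℕ) : ℕ :=
  Nat.count (fun r => k r < k q) n + Nat.count (fun r => k r = k q) q

theorem count_lt_succ (k : ℕ → ℕ) (n v : ℕ) : Nat.count (fun r => k r < v + 1) n =
    Nat.count (fun r => k r < v) n + Nat.count (fun r => k r = v) n := by
  induction n with
  | zero => rfl
  | succ n ih =>
    simp only [Nat.count_succ, ih]
    split_ifs <;> omega

theorem count_lt_count {P : ℕ → Prop} [DecidablePred P] {q n : ℕ} (hq : q < n) (h : P q) :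
    Nat.count P q < Nat.count P n := Nat.count_strict_mono h hq

theorem place_lt (k : ℕ → ℕ) {n q : ℕ} (hq : q < n) : place k n q < n := by
  have h1 := count_lt_succ k n (k q)
  have h2 := count_lt_count (P := fun r => k r = k q) hq rfl
  have h3 := Nat.count_le (p := fun r => k r < k q + 1) (n := n)
  unfold place
  omega

theorem place_lt_place (k : ℕ → ℕ) {n q r : ℕ} (hq : q < n)
    (h : k q < k r ∨ k q = k r ∧ q < r) : place k n q < place k n r := by
  rcases h with h | ⟨h, h'⟩
  · have h1 := count_lt_succ k n (k q)
    have h2 := count_lt_count (P := fun r => k r = k q) hq rfl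
    have h3 : Nat.count (fun r => k r < k q + 1) n ≤ Nat.count (fun s => k s < k r) n :=
      Nat.count_mono_left fun x _ hx => by omega
    unfold place
    omega
  · have h2 := count_lt_count (P := fun r => k r = k q) h' rfl
    unfold place
    rw [← h]
    omega

open SuffixIndex in
-- Counting the smaller keys and the earlier equal ones gives the rank by key, then index. Being a
-- rank, `place` is a permutation.
theorem place_isRank (k : ℕ → ℕ) (n : ℕ) :
    IsRank (fun q r => k q < k r ∨ k q = k r ∧ q < r) n (place k n) ∧
      Total (fun q r => k q < k r ∨ k q = k r ∧ q < r) n := by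
  refine ⟨⟨fun i hi => place_lt k hi, fun i j hi hj => ⟨fun h => ?_, place_lt_place k hi⟩⟩,
    fun i j _ _ hij => by omega⟩
  by_contra hc
  rcases eq_or_ne i j with rfl | hij
  · omega
  · have := place_lt_place k hj (show k j < k i ∨ k j = k i ∧ j < i by omega)
    omega

/-- A key `v` is tallied at `v + 1`, so that inclusive prefix sums leave in `CNT` at `v` the number
of keys below `v`, which is the place of the first item with this key. The last loop advances it
whenever an item is placed. -/
theorem csort_wp {Γ : Env} {a b : Arr} {δ : ℕ} {s : St} {τ n K : ℕ} {k : ℕ → ℕ}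
    (ha : a ≠ .CNT) (hb : b ≠ .CNT) (hab : a ≠ b) (hbS : b ≠ .S)
    (hn : s.reg .len = n) (hK : s.reg .K = K) (hnL : n ≤ Γ.L) (hKL : K ≤ Γ.L) (hW : Γ.L < Γ.W)
    (hδ : δ < Γ.W) (hk : ∀ q < n, s.arr .S (s.reg .off + s.arr a q + δ) = k q)
    (hkK : ∀ q < n, k q + 1 < K) (hL : ∀ q < n, s.reg .off + s.arr a q + δ < Γ.L) :
    wp Γ (csort a b δ) (fun t τ' => (∀ q < n, t.arr b (place k n q) = s.arr a q) ∧
      τ' ≤ τ + 20 * n + 20 * K + 20) s τ := by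
  unfold csort
  refine wp_seq (wp_for (fun i t => ∀ v < i, t.arr .CNT v = 0) 2 K (by omega) (by simp) ?_ ?_) ?_
  · intro t hf
    simpa [hK] using hf.reg .K rfl
  · intro i t τ' hf hi hI hx
    simp [hx, and_assoc]
    refine ⟨by omega, by omega, by omega, by omega, fun v hv => ?_⟩
    simp only [Function.update_apply]
    split_ifs with h
    · rfl
    · exact hI v (by omega)
  rintro t1 τ1 ⟨hI1, -, hτ1⟩ hf1
  have hS1 : t1.arr .S = s.arr .S := hf1.arr .S rfl
  have hA1 : t1.arr a = s.arr a := hf1.arr a (by simp [Prog.upTo, Prog.modA, ha])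
  have hoff1 : t1.reg .off = s.reg .off := hf1.reg .off rfl
  have hlen1 : t1.reg .len = n := (hf1.reg .len rfl).trans hn
  have hK1 : t1.reg .K = K := (hf1.reg .K rfl).trans hK
  clear hf1
  refine wp_seq (wp_for (fun i t => ∀ v < K, t.arr .CNT v = Nat.count (fun q => k q + 1 = v) i) 6 n
    (by omega) (by simpa using hI1) ?_ ?_) ?_
  · intro t hf
    simpa [hlen1] using hf.reg .len rfl
  · intro i t τ' hf hi hI hx
    have e1 : t.arr a i = s.arr a i := by
      rw [hf.arr a (by simp [Prog.modA, ha])]; simp [hA1]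
    have e2 : t.reg .off = s.reg .off := by rw [hf.reg .off rfl]; simpa using hoff1
    have e3 : t.arr .S = s.arr .S := by rw [hf.arr .S rfl]; simpa using hS1
    have b1 := hkK i hi
    have b2 := hL i hi
    have b3 := hk i hi
    have b4 := hI _ b1
    have b5 := Nat.count_le (p := fun q => k q = k i) (n := i)
    simp [hx, e1, e2, e3, b3, b4, and_assoc]
    repeat refine ⟨by omega, ?_⟩
    intro v hv
    simp only [Function.update_apply, Nat.count_succ]
    by_cases h : v = k i + 1
    · subst h
      simp
    · rw [if_neg h, if_neg (by omega), hI v hv, Nat.add_zero]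
  rintro t2 τ2 ⟨hI2, -, hτ2⟩ hf2
  have hS2 : t2.arr .S = s.arr .S := (hf2.arr .S rfl).trans hS1
  have hA2 : t2.arr a = s.arr a := (hf2.arr a (by simp [Prog.upTo, Prog.modA, ha])).trans hA1
  have hoff2 : t2.reg .off = s.reg .off := (hf2.reg .off rfl).trans hoff1
  have hlen2 : t2.reg .len = n := (hf2.reg .len rfl).trans hlen1
  have hK2 : t2.reg .K = K := (hf2.reg .K rfl).trans hK1
  clear hf2
  refine wp_seq_iff.2 (wp_assign_iff.2 ⟨by simp; omega, ?_⟩)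
  refine wp_seq (wp_for (fun i t => t.reg .f = Nat.count (fun q => k q + 1 < i) n ∧
    (∀ v < i, t.arr .CNT v = Nat.count (fun q => k q < v) n) ∧
    ∀ v < K, i ≤ v → t.arr .CNT v = Nat.count (fun q => k q + 1 = v) n) 4 K
    (by omega) (by simpa using hI2) ?_ ?_) ?_
  · intro t hf
    simpa [hK2] using hf.reg .K rfl
  · rintro i t τ' hf hi ⟨hI, hI', hI''⟩ hx
    have b4 := hI'' i hi le_rfl
    have b5 := count_lt_succ (fun q => k q + 1) n i
    have b6 := Nat.count_le (p := fun q => k q + 1 < i + 1) (n := n)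
    have b7 : Nat.count (fun q => k q + 1 < i + 1) n = Nat.count (fun q => k q < i) n := by simp
    simp only [wp_seq_iff, wp_load_iff, wp_assign_iff, wp_store_iff, Ex.val_var, Ex.ok_var, hx,
      St.set_reg, St.set_arr, b4, hI, Ex.ok_add, Ex.val_add, Function.update_self, ne_eq,
      reduceCtorEq, not_false_eq_true, Function.update_of_ne, true_and, St.setArr_reg,
      Ex.ok_ofNat, St.setArr_arr, Ex.val_ofNat]
    refine ⟨by omega, by omega, by omega, ⟨by omega, by omega⟩, ⟨by omega, fun v hv => ?_,
      fun v hv hv' => ?_⟩, by omega⟩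
    · simp only [Function.update_apply]
      split_ifs with h
      · subst h; omega
      · exact hI' v (by omega)
    · simp only [Function.update_apply]
      rw [if_neg (by omega)]
      exact hI'' v hv (by omega)
  rintro t3 τ3 ⟨⟨-, hI3, -⟩, -, hτ3⟩ hf3
  have hS3 : t3.arr .S = s.arr .S := (hf3.arr .S rfl).trans (by simpa using hS2)
  have hA3 : t3.arr a = s.arr a :=
    (hf3.arr a (by simp [Prog.upTo, Prog.modA, ha])).trans (by simpa using hA2)
  have hoff3 : t3.reg .off = s.reg .off := (hf3.reg .off rfl).trans (by simpa using hoff2)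
  have hlen3 : t3.reg .len = n := (hf3.reg .len rfl).trans (by simpa using hlen2)
  clear hf3
  refine wp_mono (wp_for (fun i t => (∀ q < i, t.arr b (place k n q) = s.arr a q) ∧
    ∀ v < K, t.arr .CNT v = Nat.count (fun q => k q < v) n + Nat.count (fun q => k q = v) i) 6 n
    (by omega) (by simpa using hI3) ?_ ?_) ?_
  · intro t hf
    simpa [hlen3] using hf.reg .len rfl
  · rintro i t τ' hf hi ⟨hI, hI'⟩ hx
    have e1 : t.arr a i = s.arr a i := by
      rw [hf.arr a (by simp [Prog.modA, ha, hab])]; simp [hA3]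
    have e2 : t.reg .off = s.reg .off := by rw [hf.reg .off rfl]; simpa using hoff3
    have e3 : t.arr .S = s.arr .S := by
      rw [hf.arr .S (by simp [Prog.modA, hbS.symm])]; simpa using hS3
    have b1 := hkK i hi
    have b2 := hL i hi
    have b3 := hk i hi
    have b4 : t.arr .CNT (k i) = place k n i := hI' (k i) (by omega)
    have b5 := place_lt k hi
    simp [hx, e1, e2, e3, b3, b4, and_assoc, hb.symm, hb]
    repeat refine ⟨by omega, ?_⟩
    refine ⟨fun q hq => ?_, fun v hv => ?_⟩
    · simp only [Function.update_apply]
      rcases Nat.lt_or_eq_of_le hq with h | rfl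
      · have hne : place k n q ≠ place k n i := fun h' => by
          have := (place_isRank k n).1.inj (place_isRank k n).2 (by omega) hi h'
          omega
        rw [if_neg hne, hI q h]
      · simp
    · simp only [Function.update_apply, Nat.count_succ]
      by_cases h : v = k i
      · subst h
        simp [place, Nat.add_assoc]
      · rw [if_neg h, if_neg (Ne.symm h), hI' v hv, Nat.add_zero]
  · rintro t τ' ⟨⟨h1, -⟩, -, h2⟩
    refine ⟨h1, ?_⟩
    rw [show 6 + 1 = 7 from rfl] at h2 hτ2
    rw [show 4 + 1 = 5 from rfl] at hτ3
    omega

/-- `A` lists the `n` numbers with the property `P` in the order `lt`. -/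
structure Enum (n : ℕ) (A : ℕ → ℕ) (P : ℕ → Prop) (lt : ℕ → ℕ → Prop) : Prop where
  mem : ∀ q < n, P (A q)
  surj : ∀ x, P x → ∃ q < n, A q = x
  mono : ∀ q r, q < r → r < n → lt (A q) (A r)

/-- One round of a radix sort: stability keeps the old order among equal keys. -/
theorem Enum.place {n : ℕ} {A B k : ℕ → ℕ} {P : ℕ → Prop} {lt : ℕ → ℕ → Prop}
    (h : Enum n A P lt) (hB : ∀ q < n, B (place (fun q => k (A q)) n q) = A q) :
    Enum n B P (fun x y => k x < k y ∨ k x = k y ∧ lt x y) := by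
  obtain ⟨h1, h2⟩ := place_isRank (fun q => k (A q)) n
  refine ⟨fun r hr => ?_, fun x hx => ?_, fun r r' hrr hr' => ?_⟩
  · obtain ⟨q, hq, rfl⟩ := h1.surj h2 hr
    rw [hB q hq]
    exact h.mem q hq
  · obtain ⟨q, hq, rfl⟩ := h.surj x hx
    exact ⟨_, place_lt _ hq, hB q hq⟩
  · obtain ⟨q, hq, rfl⟩ := h1.surj h2 (hrr.trans hr')
    obtain ⟨q', hq', rfl⟩ := h1.surj h2 hr'
    rw [hB q hq, hB q' hq']
    rcases (h1.iff q q' hq hq').1 hrr with h3 | ⟨h3, h4⟩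
    · exact .inl h3
    · exact .inr ⟨h3, h.mono q q' h4 hq'⟩

/-- Sorting an enumeration by the characters at distance `δ` from its items. -/
theorem csort_enum {Γ : Env} {a b : Arr} {δ : ℕ} {s : St} {τ n K : ℕ} {S : ℕ → ℕ}
    {P : ℕ → Prop} {lt : ℕ → ℕ → Prop} (h : Enum n (s.arr a) P lt)
    (ha : a ≠ .CNT) (hb : b ≠ .CNT) (hab : a ≠ b) (hbS : b ≠ .S)
    (hn : s.reg .len = n) (hK : s.reg .K = K) (hnL : n ≤ Γ.L) (hKL : K ≤ Γ.L) (hW : Γ.L < Γ.W)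
    (hδ : δ < Γ.W) (hS : ∀ x, P x → s.arr .S (s.reg .off + x + δ) = S (x + δ))
    (hSK : ∀ x, P x → S (x + δ) + 1 < K) (hL : ∀ x, P x → s.reg .off + x + δ < Γ.L) :
    wp Γ (csort a b δ) (fun t τ' => Enum n (t.arr b) P
      (fun x y => S (x + δ) < S (y + δ) ∨ S (x + δ) = S (y + δ) ∧ lt x y) ∧
      τ' ≤ τ + 20 * n + 20 * K + 20) s τ := by
  refine wp_mono (csort_wp (k := fun q => S (s.arr a q + δ)) ha hb hab hbS hn hK hnL hKL hW hδ
    (fun q hq => hS _ (h.mem q hq)) (fun q hq => hSK _ (h.mem q hq))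
    fun q hq => hL _ (h.mem q hq)) fun t τ' ht => ⟨?_, ht.2⟩
  exact h.place (k := fun x => S (x + δ)) ht.1

end ExtMem

namespace ExtMem

open SuffixIndex

/-! ## Names of triples -/

/-- The index of the sampled position `x`. -/
def smpIdx (N x : ℕ) : ℕ := if x % 3 = 1 then x / 3 else (N + 1) / 3 + x / 3

theorem smpIdx_smp {N p : ℕ} : smpIdx N (smp N p) = p := by
  unfold smpIdx smp
  split_ifs <;> omega

theorem smp_mod {N p : ℕ} : smp N p % 3 ≠ 0 := by
  unfold smp
  split_ifs <;> omega

theorem smpIdx_lt {N x : ℕ} (hx : x < N) (h : x % 3 ≠ 0) : smpIdx N x < 2 * N / 3 := by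
  have := smp_card N
  unfold smpIdx
  split_ifs <;> omega

theorem smp_smpIdx {N x : ℕ} (hx : x < N) (h : x % 3 ≠ 0) : smp N (smpIdx N x) = x := by
  unfold smpIdx smp
  split_ifs <;> omega

/-- List the sampled positions in the array `A`. -/
def listSamples : Prog :=
  .q ::= 0 ;; .upTo .q Var.np (.ite (.lt Var.q Var.n1) (.x ::= 3 * (Var.q : Ex) + 1)
    (.x ::= 3 * (Var.q - Var.n1 : Ex) + 2) ;; .store .A Var.q Var.x)

theorem listSamples_wp {Γ : Env} {s : St} {τ N : ℕ} (hnp : s.reg .np = 2 * N / 3)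
    (hn1 : s.reg .n1 = (N + 1) / 3) (hL : 6 * N + 10 ≤ Γ.L) (hW : Γ.L < Γ.W) :
    wp Γ listSamples (fun t τ' => Enum (2 * N / 3) (t.arr .A) (fun x => x < N ∧ x % 3 ≠ 0)
      (fun x y => smpIdx N x < smpIdx N y) ∧ τ' ≤ τ + 10 * N + 10) s τ := by
  refine wp_mono (wp_for (fun i t => ∀ v < i, t.arr .A v = smp N v) 4 (2 * N / 3) (by omega)
    (by simp) ?_ ?_) ?_
  · intro t hf
    simpa [hnp] using hf.reg .np rfl
  · intro i t τ' hf hi hI hx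
    have e1 : t.reg .n1 = (N + 1) / 3 := by rw [hf.reg .n1 rfl]; simpa using hn1
    have hstep : ∀ u v, u = smp N i → v < i + 1 → Function.update (t.arr .A) i u v = smp N v := by
      intro u v hu hv
      simp only [Function.update_apply]
      split_ifs with h
      · rw [hu, h]
      · exact hI v (by omega)
    simp [hx, e1, and_assoc]
    refine ⟨fun h => ?_, fun h => ?_⟩
    · repeat refine ⟨by omega, ?_⟩
      exact fun v hv => hstep _ v (by simp [smp, h]) (by omega)
    · repeat refine ⟨by omega, ?_⟩
      exact fun v hv => hstep _ v (by simp [smp, not_lt.2 h]) (by omega)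
  · rintro t τ' ⟨h1, -, h2⟩
    refine ⟨⟨fun q hq => ?_, fun x hx => ?_, fun q r hqr hr => ?_⟩, by omega⟩
    · rw [h1 q hq]; exact ⟨smp_lt hq, smp_mod⟩
    · refine ⟨smpIdx N x, smpIdx_lt hx.1 hx.2, ?_⟩
      rw [h1 _ (smpIdx_lt hx.1 hx.2), smp_smpIdx hx.1 hx.2]
    · rw [h1 q (by omega), h1 r hr, smpIdx_smp, smpIdx_smp]
      exact hqr

/-- The lexicographic order of triples, with ties broken by the index. -/
def tlex (S : ℕ → ℕ) (N x y : ℕ) : Prop :=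
  S (x + 0) < S (y + 0) ∨ S (x + 0) = S (y + 0) ∧ (S (x + 1) < S (y + 1) ∨
    S (x + 1) = S (y + 1) ∧ (S (x + 2) < S (y + 2) ∨ S (x + 2) = S (y + 2) ∧
      smpIdx N x < smpIdx N y))

/-- Sort the sampled positions by their triples. -/
def sortTriples : Prog :=
  listSamples ;; csort .A .B 2 ;; csort .B .A 1 ;; csort .A .B 0

/-- The string `S` of length `N` with characters from 1 on is stored at `o`, followed by two
zeros. -/
structure Stored (A : ℕ → ℕ) (o N K : ℕ) (S : ℕ → ℕ) : Prop where
  eq : ∀ i < N, A (o + i) = S i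
  pad : A (o + N) = 0
  pad' : A (o + N + 1) = 0
  zero : S N = 0
  zero' : S (N + 1) = 0
  pos : ∀ i < N, 0 < S i
  lt : ∀ i < N, S i + 1 < K

theorem Stored.get {A : ℕ → ℕ} {o N K : ℕ} {S : ℕ → ℕ} (h : Stored A o N K S) {i : ℕ}
    (hi : i < N + 2) : A (o + i) = S i := by
  rcases Nat.lt_or_ge i N with h1 | h1
  · exact h.eq i h1
  · rcases (by omega : i = N ∨ i = N + 1) with rfl | rfl
    · rw [h.pad, h.zero]
    · rw [← Nat.add_assoc, h.pad', h.zero']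

theorem Stored.le {A : ℕ → ℕ} {o N K : ℕ} {S : ℕ → ℕ} (h : Stored A o N K S) (hK : 1 < K) {i : ℕ}
    (hi : i < N + 2) : S i + 1 < K := by
  rcases Nat.lt_or_ge i N with h1 | h1
  · exact h.lt i h1
  · rcases (by omega : i = N ∨ i = N + 1) with rfl | rfl
    · rw [h.zero]; omega
    · rw [h.zero']; omega

/-- Radix sort from the least significant character. The two zeros behind the string let triples
overlap its end. -/
theorem sortTriples_wp {Γ : Env} {s : St} {τ N K : ℕ} {S : ℕ → ℕ} (hnp : s.reg .np = 2 * N / 3)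
    (hn1 : s.reg .n1 = (N + 1) / 3) (hlen : s.reg .len = 2 * N / 3) (hK : s.reg .K = K)
    (hL : s.reg .off + 6 * N + 10 ≤ Γ.L) (hKL : K ≤ Γ.L) (hNK : N + 2 ≤ K) (hW : Γ.L < Γ.W)
    (hS : Stored (s.arr .S) (s.reg .off) N K S) :
    wp Γ sortTriples (fun t τ' => Enum (2 * N / 3) (t.arr .B) (fun x => x < N ∧ x % 3 ≠ 0)
      (tlex S N) ∧ τ' ≤ τ + 200 * K) s τ := by
  have get : ∀ x δ, δ ≤ 2 → x < N ∧ x % 3 ≠ 0 → s.arr .S (s.reg .off + x + δ) = S (x + δ) :=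
    fun x δ hδ hx => by rw [Nat.add_assoc]; exact hS.get (by omega)
  have lt : ∀ x δ, δ ≤ 2 → x < N ∧ x % 3 ≠ 0 → S (x + δ) + 1 < K :=
    fun x δ hδ hx => hS.le (by omega) (by omega)
  unfold sortTriples
  refine wp_seq (listSamples_wp hnp hn1 (by omega) hW) ?_
  rintro t1 τ1 ⟨h1, hτ1⟩ hf1
  have S1 := hf1.arr .S rfl
  have o1 := hf1.reg .off rfl
  have l1 := (hf1.reg .len rfl).trans hlen
  have K1 := (hf1.reg .K rfl).trans hK
  clear hf1
  refine wp_seq (csort_enum (S := S) h1 (by decide) (by decide) (by decide) (by decide) l1 K1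
    (by omega) hKL hW (by omega) (fun x hx => by rw [S1, o1]; exact get x 2 le_rfl hx)
    (fun x hx => lt x 2 le_rfl hx) (fun x hx => by rw [o1]; omega)) ?_
  rintro t2 τ2 ⟨h2, hτ2⟩ hf2
  have S2 := (hf2.arr .S rfl).trans S1
  have o2 := (hf2.reg .off rfl).trans o1
  have l2 := (hf2.reg .len rfl).trans l1
  have K2 := (hf2.reg .K rfl).trans K1
  clear hf2
  refine wp_seq (csort_enum (S := S) h2 (by decide) (by decide) (by decide) (by decide) l2 K2
    (by omega) hKL hW (by omega) (fun x hx => by rw [S2, o2]; exact get x 1 (by omega) hx)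
    (fun x hx => lt x 1 (by omega) hx) (fun x hx => by rw [o2]; omega)) ?_
  rintro t3 τ3 ⟨h3, hτ3⟩ hf3
  have S3 := (hf3.arr .S rfl).trans S2
  have o3 := (hf3.reg .off rfl).trans o2
  have l3 := (hf3.reg .len rfl).trans l2
  have K3 := (hf3.reg .K rfl).trans K2
  clear hf3
  refine wp_mono (csort_enum (S := S) h3 (by decide) (by decide) (by decide) (by decide) l3 K3
    (by omega) hKL hW (by omega) (fun x hx => by rw [S3, o3]; exact get x 0 (by omega) hx)
    (fun x hx => lt x 0 (by omega) hx) (fun x hx => by rw [o3]; omega)) ?_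
  rintro t4 τ4 ⟨h4, hτ4⟩
  exact ⟨h4, by omega⟩

/-- Name the triples of the sorted positions in the array `B`. -/
def nameTriples : Prog :=
  .g ::= 0 ;; .u0 ::= 0 ;; .v0 ::= 0 ;; .y0 ::= 0 ;; (.q ::= 0 ;; .upTo .q Var.np (
    .load .x .B Var.q ;; .load .u .S (Var.off + Var.x) ;; .load .v .S (Var.off + Var.x + 1) ;;
    .load .y .S (Var.off + Var.x + 2) ;;
    .ite (.and (.eq Var.u Var.u0) (.and (.eq Var.v Var.v0) (.eq Var.y Var.y0))) .skip
      (.g ::= Var.g + 1 ;; .u0 ::= Var.u ;; .v0 ::= Var.v ;; .y0 ::= Var.y) ;;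
    .ite (.eq (Var.x % 3) 1) (.z ::= Var.x / 3) (.z ::= Var.n1 + Var.x / 3) ;;
    .store .S (Var.off + Var.N + 2 + Var.z) Var.g))

/-- Equal triples are adjacent in the sorted list, so comparing each with its predecessor is enough.
The initial `u0 = 0` differs from every character of the string, which gives the first triple a new
name and makes all names positive. -/
theorem nameTriples_wp {Γ : Env} {s : St} {τ N K : ℕ} {S : ℕ → ℕ} (hnp : s.reg .np = 2 * N / 3)
    (hn1 : s.reg .n1 = (N + 1) / 3) (hN : s.reg .N = N)
    (hL : s.reg .off + 6 * N + 10 ≤ Γ.L) (hW : Γ.L < Γ.W)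
    (hS : Stored (s.arr .S) (s.reg .off) N K S)
    (hB : Enum (2 * N / 3) (s.arr .B) (fun x => x < N ∧ x % 3 ≠ 0) (tlex S N)) :
    wp Γ nameTriples (fun t τ' =>
      (∀ i < s.reg .off + N + 2, t.arr .S i = s.arr .S i) ∧
      (∀ p < 2 * N / 3, 0 < t.arr .S (s.reg .off + N + 2 + p) ∧
        t.arr .S (s.reg .off + N + 2 + p) ≤ 2 * N / 3) ∧
      (∀ p q, p < 2 * N / 3 → q < 2 * N / 3 →
        (t.arr .S (s.reg .off + N + 2 + p) < t.arr .S (s.reg .off + N + 2 + q) ↔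
          tlt S (smp N p) (smp N q))) ∧ τ' ≤ τ + 20 * N + 10) s τ := by
  obtain ⟨o, ho⟩ : ∃ o, s.reg .off = o := ⟨_, rfl⟩
  obtain ⟨B, hBd⟩ : ∃ B, s.arr .B = B := ⟨_, rfl⟩
  rw [ho] at hL hS ⊢
  rw [hBd] at hB
  unfold nameTriples
  refine wp_seq_iff.2 (wp_assign_iff.2 ⟨by simp; omega, ?_⟩)
  refine wp_seq_iff.2 (wp_assign_iff.2 ⟨by simp; omega, ?_⟩)
  refine wp_seq_iff.2 (wp_assign_iff.2 ⟨by simp; omega, ?_⟩)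
  refine wp_seq_iff.2 (wp_assign_iff.2 ⟨by simp; omega, ?_⟩)
  refine wp_mono (wp_for (fun i t =>
    (∀ i < o + N + 2, t.arr .S i = s.arr .S i) ∧
    (∀ r < i, 0 < t.arr .S (o + N + 2 + smpIdx N (B r)) ∧
      t.arr .S (o + N + 2 + smpIdx N (B r)) ≤ t.reg .g) ∧
    (∀ r r', r < i → r' < i → (t.arr .S (o + N + 2 + smpIdx N (B r)) <
      t.arr .S (o + N + 2 + smpIdx N (B r')) ↔ tlt S (B r) (B r'))) ∧
    t.reg .g ≤ i ∧
    (i = 0 → t.reg .u0 = 0) ∧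
    (∀ j, i = j + 1 → t.reg .u0 = S (B j) ∧ t.reg .v0 = S (B j + 1) ∧ t.reg .y0 = S (B j + 2) ∧
      t.arr .S (o + N + 2 + smpIdx N (B j)) = t.reg .g)) 16 (2 * N / 3)
    (by omega) ?_ ?_ ?_) ?_
  · simp
  · intro t hf
    simpa [hnp] using hf.reg .np rfl
  · rintro i t τ' hf hi ⟨I1, I2, I3, I4, I5, I6⟩ hx
    have e1 : t.reg .n1 = (N + 1) / 3 := by rw [hf.reg .n1 rfl]; simpa using hn1
    have e2 : t.reg .off = o := by rw [hf.reg .off rfl]; simpa using ho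
    have e3 : t.reg .N = N := by rw [hf.reg .N rfl]; simpa using hN
    have e4 : t.arr .B = B := by rw [hf.arr .B rfl]; simpa using hBd
    have hBi := hB.mem i hi
    have gS : ∀ δ < 3, t.arr .S (o + (B i + δ)) = S (B i + δ) := fun δ hδ => by
      rw [I1 _ (by omega)]; exact hS.get (by omega)
    have g0 : t.arr .S (o + B i) = S (B i) := gS 0 (by omega)
    have g1 : t.arr .S (o + B i + 1) = S (B i + 1) := by rw [Nat.add_assoc]; exact gS 1 (by omega)
    have g2 : t.arr .S (o + B i + 2) = S (B i + 2) := by rw [Nat.add_assoc]; exact gS 2 (by omega)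
    have hidx := smpIdx_lt hBi.1 hBi.2
    have hpos := hS.pos _ hBi.1
    have hlex : ∀ r < i, tlex S N (B r) (B i) := fun r hr => hB.mono r i hr hi
    have hne : ∀ r < i, smpIdx N (B r) ≠ smpIdx N (B i) := fun r hr h => by
      have h1 := hlex r hr
      have h2 := hB.mem r (by omega)
      have h3 : B r = B i := by
        rw [← smp_smpIdx h2.1 h2.2, h, smp_smpIdx hBi.1 hBi.2]
      unfold tlex at h1
      rw [h3] at h1
      omega
    -- the state after storing the name `v` with the current triple
    have main : ∀ v, (v = t.reg .g ∧ (∀ j, i = j + 1 → S (B i) = S (B j) ∧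
          S (B i + 1) = S (B j + 1) ∧ S (B i + 2) = S (B j + 2)) ∧ i ≠ 0 ∨
        v = t.reg .g + 1 ∧ (∀ j, i = j + 1 → ¬ (S (B i) = S (B j) ∧ S (B i + 1) = S (B j + 1) ∧
          S (B i + 2) = S (B j + 2)))) →
        ∀ A, A = Function.update (t.arr .S) (o + N + 2 + smpIdx N (B i)) v →
        (∀ i < o + N + 2, A i = s.arr .S i) ∧
        (∀ r ≤ i, 0 < A (o + N + 2 + smpIdx N (B r)) ∧ A (o + N + 2 + smpIdx N (B r)) ≤ v) ∧
        (∀ r r', r ≤ i → r' ≤ i → (A (o + N + 2 + smpIdx N (B r)) <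
          A (o + N + 2 + smpIdx N (B r')) ↔ tlt S (B r) (B r'))) ∧ v ≤ i + 1 ∧
        A (o + N + 2 + smpIdx N (B i)) = v := by
      intro v hv A hA
      have A1 : A (o + N + 2 + smpIdx N (B i)) = v := by rw [hA]; simp
      have A2 : ∀ r < i, A (o + N + 2 + smpIdx N (B r)) =
          t.arr .S (o + N + 2 + smpIdx N (B r)) := fun r hr => by
        rw [hA, Function.update_of_ne]
        have := hne r hr
        omega
      have hvg : t.reg .g ≤ v := by rcases hv with h | h <;> omega
      have hv0 : 0 < v := by
        rcases hv with ⟨h, _, h'⟩ | h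
        · have h1 := I6 (i - 1) (by omega)
          have h2 := I2 (i - 1) (by omega)
          omega
        · omega
      -- An unchanged name means that triple `i` equals the one before and inherits its comparisons.
      -- A new name exceeds all earlier names, and then triple `i` is strictly larger than its
      -- predecessor, hence than all earlier triples.
      have cmp : ∀ r < i, (t.arr .S (o + N + 2 + smpIdx N (B r)) < v ↔ tlt S (B r) (B i)) ∧
          (v < t.arr .S (o + N + 2 + smpIdx N (B r)) ↔ tlt S (B i) (B r)) := by
        intro r hr
        have h1 := hlex r hr
        have h2 := I2 r hr
        have h3 : ¬ tlt S (B i) (B r) := by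
          unfold tlt; unfold tlex at h1; simp only [Nat.add_zero] at h1; omega
        refine ⟨?_, by constructor <;> intro h <;> [omega; exact absurd h h3]⟩
        obtain ⟨j, hj⟩ : ∃ j, i = j + 1 := ⟨i - 1, by omega⟩
        rcases hv with ⟨hv, h4, _⟩ | ⟨hv, h4⟩
        · obtain ⟨c0, c1, c2⟩ := h4 j hj
          have h5 := I3 r j hr (by omega)
          rw [(I6 j hj).2.2.2] at h5
          rw [hv, h5]
          unfold tlt
          rw [c0, c1, c2]
        · refine ⟨fun _ => ?_, fun _ => by omega⟩
          have h5 := h4 j hj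
          have h6 := hlex j (by omega)
          by_contra hc
          have h7 : r = j ∨ r < j := by omega
          rcases h7 with rfl | h7
          · unfold tlex at h1; unfold tlt at hc; simp only [Nat.add_zero] at h1; omega
          · have h8 := hB.mono r j h7 (by omega)
            unfold tlex at h1 h6 h8; unfold tlt at hc; simp only [Nat.add_zero] at h1 h6 h8
            omega
      refine ⟨fun k hk => ?_, fun r hr => ?_, fun r r' hr hr' => ?_, by
        rcases hv with h | h <;> omega, A1⟩
      · rw [hA, Function.update_of_ne (by omega)]; exact I1 k hk
      · rcases Nat.lt_or_eq_of_le hr with h | rfl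
        · rw [A2 r h]; have := I2 r h; omega
        · rw [A1]; omega
      · rcases Nat.lt_or_eq_of_le hr with h | rfl
        · rcases Nat.lt_or_eq_of_le hr' with h' | rfl
          · rw [A2 r h, A2 r' h']; exact I3 r r' h h'
          · rw [A2 r h, A1]; exact (cmp r h).1
        · rcases Nat.lt_or_eq_of_le hr' with h' | rfl
          · rw [A2 r' h', A1]; exact (cmp r' h').2
          · refine ⟨fun h => absurd h (lt_irrefl _), fun h => ?_⟩
            unfold tlt at h; omega
    have hz : (B i % 3 = 1 → B i / 3 = smpIdx N (B i)) ∧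
        (¬ B i % 3 = 1 → (N + 1) / 3 + B i / 3 = smpIdx N (B i)) := by
      unfold smpIdx; constructor <;> intro h <;> simp [h]
    simp [hx, e1, e2, e3, e4, g0, g1, g2, and_assoc]
    repeat refine ⟨by omega, ?_⟩
    refine ⟨fun c0 c1 c2 => ?_, fun hc => ?_⟩
    · have m := main (t.reg .g) (.inl ⟨rfl, fun j hj => ?_, fun h0 => ?_⟩) _ rfl
      · repeat refine ⟨by omega, ?_⟩
        refine ⟨fun hm => ?_, fun hm => ?_⟩
        · rw [hz.1 hm]
          repeat refine ⟨by omega, ?_⟩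
          exact ⟨m.1, m.2.1, m.2.2.1, m.2.2.2.1, c0.symm, c1.symm, c2.symm, m.2.2.2.2⟩
        · rw [hz.2 hm]
          repeat refine ⟨by omega, ?_⟩
          exact ⟨m.1, m.2.1, m.2.2.1, m.2.2.2.1, c0.symm, c1.symm, c2.symm, m.2.2.2.2⟩
      · have := I6 j hj
        rw [c0, c1, c2, this.1, this.2.1, this.2.2.1]
        exact ⟨rfl, rfl, rfl⟩
      · have := I5 h0
        omega
    · have m := main (t.reg .g + 1) (.inr ⟨rfl, fun j hj h => ?_⟩) _ rfl
      · repeat refine ⟨by omega, ?_⟩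
        refine ⟨fun hm => ?_, fun hm => ?_⟩
        · rw [hz.1 hm]
          repeat refine ⟨by omega, ?_⟩
          exact ⟨m.1, m.2.1, m.2.2.1, by omega, m.2.2.2.2⟩
        · rw [hz.2 hm]
          repeat refine ⟨by omega, ?_⟩
          exact ⟨m.1, m.2.1, m.2.2.1, by omega, m.2.2.2.2⟩
      · have := I6 j hj
        exact hc (by omega) (by omega) (by omega)
  · rintro t τ' ⟨⟨I1, I2, I3, I4, -, -⟩, -, hτ⟩
    have key : ∀ p < 2 * N / 3, ∃ r < 2 * N / 3, B r = smp N p ∧ smpIdx N (B r) = p := by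
      intro p hp
      obtain ⟨r, hr, h⟩ := hB.surj (smp N p) ⟨smp_lt hp, smp_mod⟩
      exact ⟨r, hr, h, by rw [h, smpIdx_smp]⟩
    refine ⟨I1, fun p hp => ?_, fun p q hp hq => ?_, by omega⟩
    · obtain ⟨r, hr, h1, h2⟩ := key p hp
      have := I2 r hr
      rw [h2] at this
      omega
    · obtain ⟨r, hr, h1, h2⟩ := key p hp
      obtain ⟨r', hr', h1', h2'⟩ := key q hq
      have := I3 r r' hr hr'
      rwa [h2, h2', h1, h1'] at this

/-- Replace the string at `off` by the string of the names of its triples. -/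
def descend (k : ℕ) : Prog :=
  .np ::= 2 * (Var.N : Ex) / 3 ;; .n1 ::= (Var.N + 1) / 3 ;; .K ::= Var.N + .lit k ;;
  .len ::= Var.np ;; sortTriples ;; nameTriples ;; .store .LN Var.lev Var.N ;;
  .lev ::= Var.lev + 1 ;; .off ::= Var.off + Var.N + 2 ;; .N ::= Var.np ;;
  .store .S (Var.off + Var.N) 0 ;; .store .S (Var.off + Var.N + 1) 0

/-- `R` names the triples of `S`. -/
def Names (S : ℕ → ℕ) (N : ℕ) (R : ℕ → ℕ) : Prop :=
  ∀ p q, p < 2 * N / 3 → q < 2 * N / 3 → (R p < R q ↔ tlt S (smp N p) (smp N q))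

/-- The names are written behind the two zeros of the old string, so the strings of all levels form
a stack in one array. As names are at most `2 * N / 3`, the key range stays within length plus `k`.
-/
theorem descend_wp {Γ : Env} {s : St} {τ N o l k : ℕ} {S : ℕ → ℕ} (hN : s.reg .N = N)
    (ho : s.reg .off = o) (hl : s.reg .lev = l) (hN2 : 2 ≤ N) (hk : 2 ≤ k) (hlL : l < Γ.L)
    (hL : o + 6 * N + 10 ≤ Γ.L) (hKL : N + k ≤ Γ.L) (hW : Γ.L < Γ.W)
    (hS : Stored (s.arr .S) o N (N + k) S) :
    wp Γ (descend k) (fun t τ' => t.reg .N = 2 * N / 3 ∧ t.reg .off = o + N + 2 ∧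
      t.reg .lev = l + 1 ∧ t.arr .LN = Function.update (s.arr .LN) l N ∧
      (∀ i < o + N + 2, t.arr .S i = s.arr .S i) ∧
      (∃ R, Names S N R ∧ Stored (t.arr .S) (o + N + 2) (2 * N / 3) (2 * N / 3 + k) R) ∧
      τ' ≤ τ + 300 * (N + k)) s τ := by
  unfold descend
  simp only [wp_seq_iff (p := .np ::= _), wp_seq_iff (p := .n1 ::= _), wp_seq_iff (p := .K ::= _),
    wp_seq_iff (p := .len ::= _), wp_assign_iff]
  simp only [Ex.ok_mul, Ex.ok_add, Ex.ok_div, Ex.ok_ofNat, Ex.ok_var, Ex.ok_lit, Ex.val_var,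
    Ex.val_add, Ex.val_div, Ex.val_mul, Ex.val_lit, Ex.val_ofNat, St.set_reg, hN, true_and,
    Function.update_self, ne_eq, reduceCtorEq, not_false_eq_true, Function.update_of_ne]
  refine ⟨⟨⟨by omega, by omega⟩, by omega, by omega⟩, ⟨⟨by omega, by omega⟩, by omega, by omega⟩,
    ⟨by omega, by omega⟩, ?_⟩
  refine wp_seq (sortTriples_wp (N := N) (K := N + k) (S := S) (by simp) (by simp) (by simp)
    (by simp) (by simpa [ho] using hL) hKL (by omega) hW (by simpa [ho] using hS)) ?_
  rintro t1 τ1 ⟨hB, hτ1⟩ hf1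
  have a1 : t1.arr .S = s.arr .S := hf1.arr .S rfl
  have a2 : t1.arr .LN = s.arr .LN := hf1.arr .LN rfl
  have a3 : t1.reg .off = o := by rw [hf1.reg .off rfl]; simpa using ho
  have a4 : t1.reg .lev = l := by rw [hf1.reg .lev rfl]; simpa using hl
  have a5 : t1.reg .np = 2 * N / 3 := by rw [hf1.reg .np rfl]; simp
  have a6 : t1.reg .n1 = (N + 1) / 3 := by rw [hf1.reg .n1 rfl]; simp
  have a7 : t1.reg .N = N := by rw [hf1.reg .N rfl]; simpa using hN
  clear hf1
  refine wp_seq (nameTriples_wp (K := N + k) (S := S) a5 a6 a7 (by omega) hW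
    (by rw [a1, a3]; exact hS) hB) ?_
  rintro t2 τ2 ⟨I1, I2, I3, hτ2⟩ hf2
  have b2 : t2.arr .LN = s.arr .LN := (hf2.arr .LN rfl).trans a2
  have b3 : t2.reg .off = o := (hf2.reg .off rfl).trans a3
  have b4 : t2.reg .lev = l := (hf2.reg .lev rfl).trans a4
  have b5 : t2.reg .np = 2 * N / 3 := (hf2.reg .np rfl).trans a5
  have b7 : t2.reg .N = N := (hf2.reg .N rfl).trans a7
  rw [a3] at I1 I2 I3
  rw [a1] at I1
  simp [b2, b3, b4, b5, b7, and_assoc]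
  repeat refine ⟨by omega, ?_⟩
  have hA : ∀ i < o + N + 2 + 2 * N / 3, Function.update (Function.update (t2.arr .S)
      (o + N + 2 + 2 * N / 3) 0) (o + N + 2 + 2 * N / 3 + 1) 0 i = t2.arr .S i := fun i hi => by
    rw [Function.update_of_ne (by omega), Function.update_of_ne (by omega)]
  refine ⟨fun i hi => ?_, ⟨fun p => if p < 2 * N / 3 then t2.arr .S (o + N + 2 + p) else 0,
    fun p q hp hq => ?_, ⟨fun i hi => ?_, ?_, ?_, ?_, ?_, fun i hi => ?_, fun i hi => ?_⟩⟩, ?_⟩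
  · rw [hA i (by omega), I1 i hi]
  · simp only [hp, hq, if_true]
    exact I3 p q hp hq
  · simp only [hi, if_true]
    exact hA _ (by omega)
  · rw [Function.update_of_ne (by omega)]; simp
  · simp
  · simp
  · simp
  · simp only [hi, if_true]; exact (I2 i hi).1
  · simp only [hi, if_true]; have := (I2 i hi).2; omega
  · omega

end ExtMem

namespace ExtMem

open SuffixIndex

/-! ## Merging -/

/-- Set `h` to 1 if the suffix at the sampled position `x` is smaller than the one at the position
`y` divisible by three, and to 0 otherwise. -/
def less : Prog :=
  .load .u .S (Var.off + Var.x) ;; .load .v .S (Var.off + Var.y) ;;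
  .ite (.eq Var.u Var.v)
    (.ite (.eq (Var.x % 3) 1)
      (.load .u .RB (Var.x + 1) ;; .load .v .RB (Var.y + 1))
      (.load .u .S (Var.off + Var.x + 1) ;; .load .v .S (Var.off + Var.y + 1) ;;
        .ite (.eq Var.u Var.v) (.load .u .RB (Var.x + 2) ;; .load .v .RB (Var.y + 2)) .skip))
    .skip ;;
  .ite (.lt Var.u Var.v) (.h ::= 1) (.h ::= 0)

/-- Moving on by one place if `x % 3 = 1`, and by two if `x % 3 = 2`, turns both positions into
sampled ones, whose ranks are known. The characters passed over are equal, so by uniqueness of the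
last one the new positions are still in the string. -/
theorem less_wp {Γ : Env} {s : St} {τ N o x y : ℕ} {S : ℕ → ℕ} (ho : s.reg .off = o)
    (hx : s.reg .x = x) (hy : s.reg .y = y) (hxN : x < N) (hyN : y < N) (hx3 : x % 3 ≠ 0)
    (hy3 : y % 3 = 0) (hL : o + N + 4 ≤ Γ.L) (hW : Γ.L < Γ.W) (hS : UL S N)
    (hA : ∀ i < N, s.arr .S (o + i) = S i)
    (hR : ∀ i j, i < N → j < N → i % 3 ≠ 0 → j % 3 ≠ 0 →
      (s.arr .RB i < s.arr .RB j ↔ slt S i j)) :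
    wp Γ less (fun t τ' => ((t.reg .h = 1 ∧ slt S x y) ∨ (t.reg .h = 0 ∧ ¬ slt S x y)) ∧
      τ' ≤ τ + 20) s τ := by
  have h1 := slt_iff (S := S) (i := x) (j := y)
  have h2 := slt_iff (S := S) (i := x + 1) (j := y + 1)
  have a1 := hA x hxN
  have a2 := hA y hyN
  have hne : x ≠ y := by rintro rfl; omega
  simp [less, ho, hx, hy, a1, a2, and_assoc]
  repeat refine ⟨by omega, ?_⟩
  refine ⟨fun he => ?_, fun he => ⟨fun hlt => ?_, fun hlt => ?_⟩⟩
  · obtain ⟨b1, b2⟩ := hS.eq_lt hxN hyN hne he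
    have a3 : s.arr .S (o + x + 1) = S (x + 1) := hA (x + 1) b1
    have a4 : s.arr .S (o + y + 1) = S (y + 1) := hA (y + 1) b2
    repeat refine ⟨by omega, ?_⟩
    refine ⟨fun hm => ?_, fun hm => ?_⟩
    · have h3 := hR (x + 1) (y + 1) b1 b2 (by omega) (by omega)
      repeat refine ⟨by omega, ?_⟩
      refine ⟨fun hlt => ?_, fun hlt => ?_⟩
      · refine ⟨by omega, (h1.2 (.inr ⟨he, h3.1 hlt⟩))⟩
      · refine ⟨by omega, fun hc => ?_⟩
        have := (slt_succ he).1 hc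
        have := h3.2 this
        omega
    · simp only [a3, a4]
      repeat refine ⟨by omega, ?_⟩
      refine ⟨fun he' => ?_, fun he' => ?_⟩
      · obtain ⟨b3, b4⟩ := hS.eq_lt b1 b2 (by omega) he'
        have h3 := hR (x + 2) (y + 2) b3 b4 (by omega) (by omega)
        repeat refine ⟨by omega, ?_⟩
        refine ⟨fun hlt => ?_, fun hlt => ?_⟩
        · exact ⟨by omega, (h1.2 (.inr ⟨he, h2.2 (.inr ⟨he', h3.1 hlt⟩)⟩))⟩
        · refine ⟨by omega, fun hc => ?_⟩
          have := (slt_succ he').1 ((slt_succ he).1 hc)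
          have := h3.2 this
          omega
      · refine ⟨fun hlt => ?_, fun hlt => ?_⟩
        · exact ⟨by omega, (h1.2 (.inr ⟨he, slt_of_lt hlt⟩))⟩
        · refine ⟨by omega, fun hc => ?_⟩
          have := (slt_succ he).1 hc
          rcases slt_iff.1 this with h | h <;> omega
  · exact ⟨by omega, (slt_of_lt hlt)⟩
  · refine ⟨by omega, fun hc => ?_⟩
    rcases slt_iff.1 hc with h | h <;> omega

/-- Merge the sorted sampled positions in `A` and the sorted other positions in `C`. -/
def merge : Prog :=
  .p ::= 0 ;; .r ::= 0 ;; (.k ::= 0 ;; .upTo .k Var.N (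
    .ite (.lt Var.p Var.np)
      (.ite (.lt Var.r Var.len) (.load .x .A Var.p ;; .load .y .C Var.r ;; less) (.h ::= 1))
      (.h ::= 0) ;;
    .ite (.eq Var.h 1) (.load .x .A Var.p ;; .p ::= Var.p + 1)
      (.load .x .C Var.r ;; .r ::= Var.r + 1) ;;
    .store .RK Var.x Var.k))

/-- A strictly increasing list has no repetitions. It follows that the two lists to be merged have
`N` entries together, so that `N` steps exhaust both. -/
theorem Enum.card {n N : ℕ} {A : ℕ → ℕ} {P : ℕ → Prop} [DecidablePred P] {S : ℕ → ℕ}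
    (h : Enum n A (fun x => x < N ∧ P x) (slt S)) : n = ((Finset.range N).filter P).card := by
  rw [← Finset.card_range n]
  refine Finset.card_bij (fun q _ => A q) (fun q hq => ?_) (fun q hq r hr e => ?_) fun x hx => ?_
  · simpa using h.mem q (by simpa using hq)
  · simp only [Finset.mem_range] at hq hr
    by_contra hqr
    rcases Nat.lt_or_gt_of_ne hqr with h1 | h1
    · have := h.mono q r h1 hr; rw [e] at this; exact slt_irrefl _ _ this
    · have := h.mono r q h1 hq; rw [e] at this; exact slt_irrefl _ _ this
  · obtain ⟨q, hq, e⟩ := h.surj x (by simpa using hx)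
    exact ⟨q, by simpa using hq, e⟩

/-- The order of the positions with `Pl` is reflected by the ranks `R` below `k`, and the other
positions below `N` come later. -/
structure Merged (S : ℕ → ℕ) (N k : ℕ) (Pl : ℕ → Prop) (R : ℕ → ℕ) : Prop where
  lt : ∀ x, Pl x → R x < k
  iff : ∀ x y, Pl x → Pl y → (R x < R y ↔ slt S x y)
  rest : ∀ x y, Pl x → y < N → ¬ Pl y → slt S x y

/-- The smallest remaining position gets the next rank: everything already placed is below it,
everything else above. -/
theorem Merged.step {S : ℕ → ℕ} {N k : ℕ} {Pl Pl' : ℕ → Prop} {R : ℕ → ℕ} {x : ℕ}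
    (h : Merged S N k Pl R) (hx : ¬ Pl x) (hxN : x < N)
    (hmin : ∀ y < N, ¬ Pl y → y ≠ x → slt S x y) (hP : ∀ y, Pl' y ↔ Pl y ∨ y = x) :
    Merged S N (k + 1) Pl' (Function.update R x k) := by
  have e1 : ∀ y, Pl y → Function.update R x k y = R y := fun y hy =>
    Function.update_of_ne (by rintro rfl; exact hx hy) _ _
  refine ⟨fun y hy => ?_, fun y z hy hz => ?_, fun y z hy hzN hz => ?_⟩
  · rcases (hP y).1 hy with h1 | rfl
    · rw [e1 y h1]; exact (h.lt y h1).trans (Nat.lt_succ_self _)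
    · simp
  · rcases (hP y).1 hy with h1 | rfl <;> rcases (hP z).1 hz with h2 | rfl
    · rw [e1 y h1, e1 z h2]; exact h.iff y z h1 h2
    · rw [e1 y h1, Function.update_self]
      exact iff_of_true (h.lt y h1) (h.rest y z h1 hxN hx)
    · rw [e1 z h2, Function.update_self]
      exact iff_of_false (by have := h.lt z h2; omega) (slt_asymm (h.rest z y h2 hxN hx))
    · exact iff_of_false (lt_irrefl _) (slt_irrefl _ _)
  · have hz' : ¬ Pl z ∧ z ≠ x := by
      constructor
      · exact fun h1 => hz ((hP z).2 (.inl h1))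
      · exact fun h1 => hz ((hP z).2 (.inr h1))
    rcases (hP y).1 hy with h1 | rfl
    · exact h.rest y z h1 hzN hz'.1
    · exact hmin z hzN hz'.1 hz'.2

theorem merge_wp {Γ : Env} {s : St} {τ N o z : ℕ} {S : ℕ → ℕ} (ho : s.reg .off = o)
    (hN : s.reg .N = N) (hnp : s.reg .np = 2 * N / 3) (hz : s.reg .len = z)
    (hL : o + 6 * N + 10 ≤ Γ.L) (hW : Γ.L < Γ.W) (hS : UL S N)
    (hSt : ∀ i < N, s.arr .S (o + i) = S i)
    (hR : ∀ i j, i < N → j < N → i % 3 ≠ 0 → j % 3 ≠ 0 →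
      (s.arr .RB i < s.arr .RB j ↔ slt S i j))
    (hA : Enum (2 * N / 3) (s.arr .A) (fun x => x < N ∧ x % 3 ≠ 0) (slt S))
    (hC : Enum z (s.arr .C) (fun x => x < N ∧ x % 3 = 0) (slt S)) :
    wp Γ merge (fun t τ' => IsRank (slt S) N (t.arr .RK) ∧ τ' ≤ τ + 40 * N + 10) s τ := by
  have hcard : 2 * N / 3 + z = N := by
    rw [hA.card, hC.card, Nat.add_comm]
    have := Finset.card_filter_add_card_filter_not (s := Finset.range N) (fun x => x % 3 = 0)
    simpa using this
  obtain ⟨A, hAd⟩ : ∃ A, s.arr .A = A := ⟨_, rfl⟩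
  obtain ⟨C, hCd⟩ : ∃ C, s.arr .C = C := ⟨_, rfl⟩
  rw [hAd] at hA
  rw [hCd] at hC
  unfold merge
  refine wp_seq_iff.2 (wp_assign_iff.2 ⟨by simp; omega, ?_⟩)
  refine wp_seq_iff.2 (wp_assign_iff.2 ⟨by simp; omega, ?_⟩)
  refine wp_mono (wp_for (fun k t => t.reg .p + t.reg .r = k ∧ t.reg .p ≤ 2 * N / 3 ∧
    t.reg .r ≤ z ∧ Merged S N k (fun x => (∃ i < t.reg .p, A i = x) ∨ ∃ i < t.reg .r, C i = x)
      (t.arr .RK)) 32 N (by omega) ?_ ?_ ?_) ?_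
  · simp
    exact ⟨fun _ h => h.elim, fun _ _ h => h.elim, fun _ _ h => h.elim⟩
  · intro t hf
    simpa [hN] using hf.reg .N rfl
  · rintro k t τ' hf hk ⟨I1, I2, I3, I4⟩ hx
    have e1 : t.reg .np = 2 * N / 3 := by rw [hf.reg .np rfl]; simpa using hnp
    have e2 : t.reg .off = o := by rw [hf.reg .off rfl]; simpa using ho
    have e3 : t.reg .len = z := by rw [hf.reg .len rfl]; simpa using hz
    have e4 : t.arr .A = A := by rw [hf.arr .A rfl]; simpa using hAd
    have e5 : t.arr .C = C := by rw [hf.arr .C rfl]; simpa using hCd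
    have e6 : t.arr .S = s.arr .S := by rw [hf.arr .S rfl]; simp
    have e7 : t.arr .RB = s.arr .RB := by rw [hf.arr .RB rfl]; simp
    clear hf
    obtain ⟨p, hp⟩ : ∃ p, t.reg .p = p := ⟨_, rfl⟩
    obtain ⟨r, hr⟩ : ∃ r, t.reg .r = r := ⟨_, rfl⟩
    rw [hp, hr] at I1 I4
    rw [hp] at I2
    rw [hr] at I3
    have npA : ∀ p' r', p ≤ p' → p' < 2 * N / 3 → r' ≤ z →
        ¬ ((∃ i < p, A i = A p') ∨ ∃ i < r', C i = A p') := by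
      rintro p' r' h h' h'' (⟨i, hi, he⟩ | ⟨i, hi, he⟩)
      · have := hA.mono i p' (by omega) h'
        rw [he] at this
        exact slt_irrefl _ _ this
      · have h1 := hC.mem i (by omega)
        rw [he] at h1
        exact (hA.mem p' h').2 h1.2
    have npC : ∀ p' r', r ≤ r' → r' < z → p' ≤ 2 * N / 3 →
        ¬ ((∃ i < p', A i = C r') ∨ ∃ i < r, C i = C r') := by
      rintro p' r' h h' h'' (⟨i, hi, he⟩ | ⟨i, hi, he⟩)
      · have h1 := hA.mem i (by omega)
        rw [he] at h1
        exact h1.2 (hC.mem r' h').2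
      · have := hC.mono i r' (by omega) h'
        rw [he] at this
        exact slt_irrefl _ _ this
    have unpl : ∀ y < N, ¬ ((∃ i < p, A i = y) ∨ ∃ i < r, C i = y) →
        (∃ i, p ≤ i ∧ i < 2 * N / 3 ∧ A i = y) ∨ ∃ i, r ≤ i ∧ i < z ∧ C i = y := by
      intro y hy hn
      by_cases h3 : y % 3 = 0
      · obtain ⟨i, hi, he⟩ := hC.surj y ⟨hy, h3⟩
        refine .inr ⟨i, ?_, hi, he⟩
        by_contra hc
        exact hn (.inr ⟨i, by omega, he⟩)
      · obtain ⟨i, hi, he⟩ := hA.surj y ⟨hy, h3⟩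
        refine .inl ⟨i, ?_, hi, he⟩
        by_contra hc
        exact hn (.inl ⟨i, by omega, he⟩)
    -- What the choice of `h` ensures: the selected list is not exhausted, and its head is smaller
    -- than the head of the other list, if that has one.
    refine wp_seq_iff.2 (wp_seq (P := fun t' τ'' => ((t'.reg .h = 1 ∧ p < 2 * N / 3 ∧
      (r < z → slt S (A p) (C r))) ∨ (t'.reg .h = 0 ∧ r < z ∧
      (p < 2 * N / 3 → slt S (C r) (A p)))) ∧ τ'' ≤ τ' + 25) ?_ ?_)
    · refine wp_ite_iff.2 ⟨by simp, fun h1 => wp_ite_iff.2 ⟨by simp, fun h2 => ?_, fun h2 => ?_⟩,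
        fun h1 => ?_⟩
      · simp [e1, e3, hp, hr] at h1 h2
        have mA := hA.mem p h1
        have mC := hC.mem r h2
        refine wp_seq_iff.2 (wp_load_iff.2 ⟨trivial, by simp [hp]; omega, ?_⟩)
        refine wp_seq_iff.2 (wp_load_iff.2 ⟨trivial, by simp [hr]; omega, ?_⟩)
        refine wp_mono (less_wp (N := N) (o := o) (x := A p) (y := C r) (S := S) (by simp [e2])
          (by simp [e4, hp]) (by simp [e5, hr]) mA.1 mC.1 mA.2 mC.2 (by omega) hW hS
          (by simpa [e6] using hSt) (by simpa [e7] using hR)) ?_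
        rintro u τ'' ⟨h3, h4⟩
        refine ⟨?_, by omega⟩
        rcases h3 with h3 | h3
        · exact .inl ⟨h3.1, h1, fun _ => h3.2⟩
        · refine .inr ⟨h3.1, h2, fun _ => ?_⟩
          refine (hS.total mA.1 mC.1 ?_).resolve_left h3.2
          intro he
          rw [he] at mA
          exact mA.2 mC.2
      · simp [e3, hr] at h2
        simp [e1, hp] at h1
        simp [h1]
        omega
      · simp [e1, hp] at h1
        simp
        refine ⟨by omega, by omega, fun h => by omega⟩
    · rintro t' τ'' ⟨hh, hτ⟩ hf
      have f1 : t'.reg .p = p := (hf.reg .p rfl).trans hp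
      have f2 : t'.reg .r = r := (hf.reg .r rfl).trans hr
      have f3 : t'.arr .A = A := (hf.arr .A rfl).trans e4
      have f4 : t'.arr .C = C := (hf.arr .C rfl).trans e5
      have f5 : t'.arr .RK = t.arr .RK := hf.arr .RK rfl
      have f6 : t'.reg .k = k := (hf.reg .k rfl).trans hx
      clear hf
      rcases hh with ⟨hh, h1, h2⟩ | ⟨hh, h1, h2⟩
      · have mA := hA.mem p h1
        simp [hh, f1, f2, f3, f4, f5, f6, and_assoc]
        repeat refine ⟨by omega, ?_⟩
        refine ⟨I4.step (npA p r le_rfl h1 I3) mA.1 (fun y hy hn hne => ?_) fun y => ?_, by omega⟩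
        · rcases unpl y hy hn with ⟨i, h3, h4, rfl⟩ | ⟨i, h3, h4, rfl⟩
          · refine hA.mono p i (lt_of_le_of_ne h3 ?_) h4
            rintro rfl; exact hne rfl
          · rcases Nat.lt_or_eq_of_le h3 with h5 | rfl
            · exact slt_trans (h2 (by omega)) (hC.mono r i h5 h4)
            · exact h2 h4
        · constructor
          · rintro (⟨i, h3, rfl⟩ | h3)
            · rcases Nat.lt_or_eq_of_le (Nat.lt_succ_iff.1 (by omega : i < p + 1)) with h5 | rfl
              · exact .inl (.inl ⟨i, h5, rfl⟩)
              · exact .inr rfl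
            · exact .inl (.inr h3)
          · rintro ((⟨i, h3, rfl⟩ | h3) | rfl)
            · exact .inl ⟨i, by omega, rfl⟩
            · exact .inr h3
            · exact .inl ⟨p, by omega, rfl⟩
      · have mC := hC.mem r h1
        simp [hh, f1, f2, f3, f4, f5, f6, and_assoc]
        repeat refine ⟨by omega, ?_⟩
        refine ⟨I4.step (npC p r le_rfl h1 I2) mC.1 (fun y hy hn hne => ?_) fun y => ?_, by omega⟩
        · rcases unpl y hy hn with ⟨i, h3, h4, rfl⟩ | ⟨i, h3, h4, rfl⟩
          · rcases Nat.lt_or_eq_of_le h3 with h5 | rfl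
            · exact slt_trans (h2 (by omega)) (hA.mono p i h5 h4)
            · exact h2 h4
          · refine hC.mono r i (lt_of_le_of_ne h3 ?_) h4
            rintro rfl; exact hne rfl
        · constructor
          · rintro (h3 | ⟨i, h3, rfl⟩)
            · exact .inl (.inl h3)
            · rcases Nat.lt_or_eq_of_le (Nat.lt_succ_iff.1 (by omega : i < r + 1)) with h5 | rfl
              · exact .inl (.inr ⟨i, h5, rfl⟩)
              · exact .inr rfl
          · rintro ((h3 | ⟨i, h3, rfl⟩) | rfl)
            · exact .inl h3
            · exact .inr ⟨i, by omega, rfl⟩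
            · exact .inr ⟨r, by omega, rfl⟩
  · rintro t τ' ⟨⟨I1, I2, I3, I4⟩, -, hτ⟩
    have hp : t.reg .p = 2 * N / 3 := by omega
    have hr : t.reg .r = z := by omega
    rw [hp, hr] at I4
    have hall : ∀ x < N, (∃ i < 2 * N / 3, A i = x) ∨ ∃ i < z, C i = x := by
      intro x hx
      by_cases h3 : x % 3 = 0
      · exact .inr (hC.surj x ⟨hx, h3⟩)
      · exact .inl (hA.surj x ⟨hx, h3⟩)
    exact ⟨⟨fun x hx => I4.lt x (hall x hx), fun x y hx hy => I4.iff x y (hall x hx) (hall y hy)⟩,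
      by omega⟩

end ExtMem

namespace ExtMem

open SuffixIndex

/-! ## From the sampled suffixes to all suffixes -/

/-- Store the sampled positions in the order of their ranks in `A`, and the ranks in `RB`. -/
def sortedSamples : Prog :=
  .q ::= 0 ;; .upTo .q Var.np (.ite (.lt Var.q Var.n1) (.x ::= 3 * (Var.q : Ex) + 1)
    (.x ::= 3 * (Var.q - Var.n1 : Ex) + 2) ;; .load .y .RK Var.q ;; .store .A Var.y Var.x ;;
    .store .RB Var.x Var.y)

/-- By `triples`, the ranks in the string of names are the ranks of the sampled suffixes among
themselves. -/
theorem sortedSamples_wp {Γ : Env} {s : St} {τ N : ℕ} {S R : ℕ → ℕ} (hnp : s.reg .np = 2 * N / 3)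
    (hn1 : s.reg .n1 = (N + 1) / 3) (hL : 6 * N + 10 ≤ Γ.L) (hW : Γ.L < Γ.W) (hN : 2 ≤ N)
    (hS : UL S N) (hR : Names S N R) (hRK : IsRank (slt R) (2 * N / 3) (s.arr .RK)) :
    wp Γ sortedSamples (fun t τ' => Enum (2 * N / 3) (t.arr .A) (fun x => x < N ∧ x % 3 ≠ 0)
      (slt S) ∧ (∀ i j, i < N → j < N → i % 3 ≠ 0 → j % 3 ≠ 0 →
        (t.arr .RB i < t.arr .RB j ↔ slt S i j)) ∧ τ' ≤ τ + 10 * N + 10) s τ := by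
  obtain ⟨hUR, hsl⟩ := triples hS hN hR
  have htot : Total (slt R) (2 * N / 3) := fun i j hi hj h => hUR.total hi hj h
  obtain ⟨RK, hRKd⟩ : ∃ RK, s.arr .RK = RK := ⟨_, rfl⟩
  rw [hRKd] at hRK
  refine wp_mono (wp_for (fun i t => ∀ v < i, t.arr .A (RK v) = smp N v ∧
    t.arr .RB (smp N v) = RK v) 8 (2 * N / 3) (by omega) (by simp) ?_ ?_) ?_
  · intro t hf
    simpa [hnp] using hf.reg .np rfl
  · intro i t τ' hf hi hI hx
    have e1 : t.reg .n1 = (N + 1) / 3 := by rw [hf.reg .n1 rfl]; simpa using hn1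
    have e2 : t.arr .RK = RK := by rw [hf.arr .RK rfl]; simpa using hRKd
    have hr := hRK.lt_len i hi
    have hs := smp_lt hi
    have hstep : ∀ u, u = smp N i → ∀ v < i + 1,
        Function.update (t.arr .A) (RK i) u (RK v) = smp N v ∧
        Function.update (t.arr .RB) u (RK i) (smp N v) = RK v := by
      rintro u rfl v hv
      rcases (by omega : v = i ∨ v < i) with rfl | hv
      · simp
      · rw [Function.update_of_ne, Function.update_of_ne]
        · exact hI v hv
        · intro h
          have := congrArg (smpIdx N) h
          rw [smpIdx_smp, smpIdx_smp] at this
          omega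
        · intro h
          have := hRK.inj htot (by omega) hi h
          omega
    simp [hx, e1, e2, and_assoc]
    refine ⟨fun h => ?_, fun h => ?_⟩
    · have : 3 * i + 1 = smp N i := by simp [smp, h]
      repeat refine ⟨by omega, ?_⟩
      exact fun v hv => hstep _ this v (by omega)
    · have : 3 * (i - (N + 1) / 3) + 2 = smp N i := by simp [smp, not_lt.2 h]
      repeat refine ⟨by omega, ?_⟩
      exact fun v hv => hstep _ this v (by omega)
  · rintro t τ' ⟨h1, -, h2⟩
    refine ⟨⟨fun r hr => ?_, fun x hx => ?_, fun r r' hrr hr => ?_⟩, fun i j hi hj hi3 hj3 => ?_,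
      by omega⟩
    · obtain ⟨q, hq, rfl⟩ := hRK.surj htot hr
      rw [(h1 q hq).1]; exact ⟨smp_lt hq, smp_mod⟩
    · have hlt := smpIdx_lt hx.1 hx.2
      exact ⟨_, hRK.lt_len _ hlt, by rw [(h1 _ hlt).1, smp_smpIdx hx.1 hx.2]⟩
    · obtain ⟨q, hq, rfl⟩ := hRK.surj htot (hrr.trans hr)
      obtain ⟨q', hq', rfl⟩ := hRK.surj htot hr
      rw [(h1 q hq).1, (h1 q' hq').1, ← hsl q q' hq hq', ← hRK.iff q q' hq hq']
      exact hrr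
    · have a := smpIdx_lt hi hi3
      have b := smpIdx_lt hj hj3
      have a' := (h1 _ a).2
      have b' := (h1 _ b).2
      rw [smp_smpIdx hi hi3] at a'
      rw [smp_smpIdx hj hj3] at b'
      rw [a', b', hRK.iff _ _ a b, hsl _ _ a b, smp_smpIdx hi hi3, smp_smpIdx hj hj3]

/-- List the positions divisible by three in `B`, sorted by the suffixes that follow them. -/
def listOthers : Prog :=
  .z ::= 0 ;; .ite (.eq (Var.N % 3) 1) (.store .B 0 (Var.N - 1) ;; .z ::= 1) .skip ;;
  (.q ::= 0 ;; .upTo .q Var.np (.load .x .A Var.q ;;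
    .ite (.eq (Var.x % 3) 1) (.store .B Var.z (Var.x - 1) ;; .z ::= Var.z + 1) .skip)) ;;
  .len ::= Var.z

/-- The tail of a suffix at a position divisible by three starts at a position congruent to 1, so a
run through the sorted sampled positions lists the others by their tails. Only `N - 1`, if divisible
by three, has no tail within the string; it is put first. -/
theorem listOthers_wp {Γ : Env} {s : St} {τ N : ℕ} {S : ℕ → ℕ} (hnp : s.reg .np = 2 * N / 3)
    (hN : s.reg .N = N) (hL : 6 * N + 10 ≤ Γ.L) (hW : Γ.L < Γ.W) (hN2 : 2 ≤ N)
    (hA : Enum (2 * N / 3) (s.arr .A) (fun x => x < N ∧ x % 3 ≠ 0) (slt S)) :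
    wp Γ listOthers (fun t τ' => t.reg .len ≤ N ∧
      Enum (t.reg .len) (t.arr .B) (fun x => x < N ∧ x % 3 = 0)
      (fun x y => y ≠ N - 1 ∧ (x = N - 1 ∨ slt S (x + 1) (y + 1))) ∧ τ' ≤ τ + 10 * N + 20) s τ := by
  obtain ⟨A, hAd⟩ : ∃ A, s.arr .A = A := ⟨_, rfl⟩
  rw [hAd] at hA
  unfold listOthers
  refine wp_seq_iff.2 (wp_assign_iff.2 ⟨by simp; omega, ?_⟩)
  refine wp_seq (P := fun t τ' => ((t.reg .z = 0 ∧ N % 3 ≠ 1) ∨ (t.reg .z = 1 ∧ N % 3 = 1 ∧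
    t.arr .B 0 = N - 1)) ∧ τ' ≤ τ + 4) ?_ ?_
  · simp [hN, and_assoc]
    repeat refine ⟨by omega, ?_⟩
    omega
  rintro t1 τ1 ⟨h1, hτ1⟩ hf1
  have a1 : t1.reg .np = 2 * N / 3 := (hf1.reg .np rfl).trans (by simpa using hnp)
  have a2 : t1.arr .A = A := (hf1.arr .A rfl).trans (by simpa using hAd)
  clear hf1
  refine wp_seq (wp_for (fun i t => t.reg .z ≤ i + 1 ∧
    (∀ j < t.reg .z, (t.arr .B j < N ∧ t.arr .B j % 3 = 0) ∧
      (t.arr .B j = N - 1 ∨ ∃ r < i, A r = t.arr .B j + 1)) ∧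
    (∀ r < i, A r % 3 = 1 → ∃ j < t.reg .z, t.arr .B j + 1 = A r) ∧
    (N % 3 = 1 → ∃ j < t.reg .z, t.arr .B j = N - 1) ∧
    (∀ j k, j < k → k < t.reg .z → t.arr .B k ≠ N - 1 ∧ (t.arr .B j = N - 1 ∨
      slt S (t.arr .B j + 1) (t.arr .B k + 1)))) 8 (2 * N / 3) (by omega) ?_ ?_ ?_) ?_
  · rcases h1 with ⟨b1, b2⟩ | ⟨b1, b2, b3⟩
    · simp [b1, b2]
    · simp [b1, b3]
      exact ⟨by omega, fun j k _ _ => by omega⟩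
  · intro t hf
    simpa [a1] using hf.reg .np rfl
  · rintro i t τ' hf hi ⟨I1, I2, I3, I4, I5⟩ hx
    have e2 : t.arr .A = A := by rw [hf.arr .A rfl]; simpa using a2
    clear hf
    obtain ⟨z, hz⟩ : ∃ z, t.reg .z = z := ⟨_, rfl⟩
    rw [hz] at I1 I2 I3 I4 I5
    have hAi := hA.mem i hi
    simp [hx, e2, hz, and_assoc]
    repeat refine ⟨by omega, ?_⟩
    refine ⟨fun h => ?_, fun h => ?_⟩
    · repeat refine ⟨by omega, ?_⟩
      have u1 : Function.update (t.arr .B) z (A i - 1) z = A i - 1 := by simp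
      have u2 : ∀ j < z, Function.update (t.arr .B) z (A i - 1) j = t.arr .B j := fun j hj =>
        Function.update_of_ne (by omega) _ _
      refine ⟨fun j hj => ?_, fun r hr hr1 => ?_, fun h1 => ?_, fun j k hjk hk => ?_⟩
      · rcases (by omega : j < z ∨ j = z) with hj | rfl
        · rw [u2 j hj]
          obtain ⟨c1, c2⟩ := I2 j hj
          refine ⟨c1.1, c1.2, c2.imp_right fun ⟨r, h3, h4⟩ => ⟨r, by omega, h4⟩⟩
        · rw [u1]
          exact ⟨by omega, by omega, .inr ⟨i, by omega, by omega⟩⟩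
      · rcases (by omega : r < i ∨ r = i) with hr | rfl
        · obtain ⟨j, hj, h3⟩ := I3 r hr hr1
          exact ⟨j, by omega, by rw [u2 j hj, h3]⟩
        · exact ⟨z, by omega, by rw [u1]; omega⟩
      · obtain ⟨j, hj, h3⟩ := I4 h1
        exact ⟨j, by omega, by rw [u2 j hj, h3]⟩
      · rw [u2 j (by omega)]
        rcases (by omega : k < z ∨ k = z) with hk | rfl
        · rw [u2 k hk]; exact I5 j k hjk hk
        · rw [u1]
          refine ⟨by omega, (I2 j hjk).2.imp_right fun ⟨r, h3, h4⟩ => ?_⟩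
          rw [← h4, Nat.sub_add_cancel (by omega)]
          exact hA.mono r i h3 hi
    · refine ⟨by omega, by omega, by omega, fun j hj => ?_, fun r hr hr1 => ?_, I4, I5⟩
      · obtain ⟨c1, c2⟩ := I2 j hj
        exact ⟨c1.1, c1.2, c2.imp_right fun ⟨r, h3, h4⟩ => ⟨r, by omega, h4⟩⟩
      · rcases (by omega : r < i ∨ r = i) with hr | rfl
        · exact I3 r hr hr1
        · exact absurd hr1 h
  · rintro t τ' ⟨⟨I1, I2, I3, I4, I5⟩, -, hτ⟩ -
    simp only [wp_assign_iff, Ex.ok_var, Ex.val_var, St.set_reg, Function.update_self, St.set_arr,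
      true_and]
    refine ⟨by omega, ⟨fun q hq => (I2 q hq).1, fun x hx => ?_, I5⟩, by omega⟩
    by_cases h : x = N - 1
    · obtain ⟨j, hj, h3⟩ := I4 (by omega)
      exact ⟨j, hj, by omega⟩
    · obtain ⟨r, hr, h3⟩ := hA.surj (x + 1) (by omega)
      obtain ⟨j, hj, h4⟩ := I3 r hr (by omega)
      exact ⟨j, hj, by omega⟩

/-- Sort the suffixes of the string of the previous level, when those of the string of names are
sorted. -/
def ascend (k : ℕ) : Prog :=
  .lev ::= Var.lev - 1 ;; .load .N .LN Var.lev ;; .off ::= Var.off - (Var.N + 2) ;;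
  .np ::= 2 * (Var.N : Ex) / 3 ;; .n1 ::= (Var.N + 1) / 3 ;; .K ::= Var.N + .lit k ;;
  sortedSamples ;; listOthers ;; csort .B .C 0 ;; merge

/-- A stable sort by the first character, applied to positions already ordered by their tails, sorts
the suffixes at the positions divisible by three; merging them with the sampled ones gives all
ranks. -/
theorem ascend_wp {Γ : Env} {s : St} {τ N o l k : ℕ} {S R : ℕ → ℕ} (hN : s.arr .LN l = N)
    (ho : s.reg .off = o + N + 2) (hl : s.reg .lev = l + 1) (hN2 : 2 ≤ N) (hk : 2 ≤ k)
    (hlL : l + 1 < Γ.L) (hL : o + 6 * N + 10 ≤ Γ.L) (hKL : N + k ≤ Γ.L) (hW : Γ.L < Γ.W)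
    (hS : Stored (s.arr .S) o N (N + k) S) (hU : UL S N) (hR : Names S N R)
    (hRK : IsRank (slt R) (2 * N / 3) (s.arr .RK)) :
    wp Γ (ascend k) (fun t τ' => t.reg .N = N ∧ t.reg .off = o ∧ t.reg .lev = l ∧
      IsRank (slt S) N (t.arr .RK) ∧ τ' ≤ τ + 300 * (N + k)) s τ := by
  unfold ascend
  simp only [wp_seq_iff (p := .np ::= _), wp_seq_iff (p := .n1 ::= _), wp_seq_iff (p := .K ::= _),
    wp_seq_iff (p := .lev ::= _), wp_seq_iff (p := .load _ _ _), wp_seq_iff (p := .off ::= _),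
    wp_assign_iff, wp_load_iff]
  simp only [Ex.ok_mul, Ex.ok_add, Ex.ok_div, Ex.ok_sub, Ex.ok_ofNat, Ex.ok_var, Ex.ok_lit,
    Ex.val_var, Ex.val_sub, St.set_arr, hl, ho, Nat.add_sub_cancel,
    Ex.val_add, Ex.val_div, Ex.val_mul, Ex.val_lit, Ex.val_ofNat, St.set_reg, hN, true_and,
    Function.update_self, ne_eq, reduceCtorEq, not_false_eq_true, Function.update_of_ne]
  refine ⟨⟨by omega, by omega, by omega⟩, by omega, ⟨⟨by omega, by omega⟩, by omega, by omega⟩,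
    ⟨⟨by omega, by omega⟩, by omega, by omega⟩, ⟨⟨by omega, by omega⟩, by omega, by omega⟩,
    ⟨by omega, by omega⟩, ?_⟩
  refine wp_seq (sortedSamples_wp (N := N) (S := S) (R := R) (by simp) (by simp) (by omega) hW hN2
    hU hR (by simpa using hRK)) ?_
  rintro t1 τ1 ⟨hA, hRB, hτ1⟩ hf1
  have a1 : t1.arr .S = s.arr .S := hf1.arr .S rfl
  have a2 : t1.reg .N = N := by rw [hf1.reg .N rfl]; simp
  have a3 : t1.reg .off = o := by rw [hf1.reg .off rfl]; simp
  have a4 : t1.reg .lev = l := by rw [hf1.reg .lev rfl]; simp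
  have a5 : t1.reg .np = 2 * N / 3 := by rw [hf1.reg .np rfl]; simp
  have a6 : t1.reg .K = N + k := by rw [hf1.reg .K rfl]; simp
  clear hf1
  refine wp_seq (listOthers_wp a5 a2 (by omega) hW hN2 hA) ?_
  rintro t2 τ2 ⟨hlen, hB, hτ2⟩ hf2
  have b1 : t2.arr .S = s.arr .S := (hf2.arr .S rfl).trans a1
  have b2 : t2.reg .N = N := (hf2.reg .N rfl).trans a2
  have b3 : t2.reg .off = o := (hf2.reg .off rfl).trans a3
  have b4 : t2.reg .lev = l := (hf2.reg .lev rfl).trans a4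
  have b5 : t2.reg .np = 2 * N / 3 := (hf2.reg .np rfl).trans a5
  have b6 : t2.reg .K = N + k := (hf2.reg .K rfl).trans a6
  have b7 : t2.arr .A = t1.arr .A := hf2.arr .A rfl
  have b8 : t2.arr .RB = t1.arr .RB := hf2.arr .RB rfl
  clear hf2
  refine wp_seq (csort_enum (S := S) hB (by decide) (by decide) (by decide) (by decide) rfl b6
    (by omega) hKL hW (by omega) (fun x hx => by rw [b1, b3]; exact hS.eq x hx.1)
    (fun x hx => hS.lt x hx.1) (fun x hx => by rw [b3]; omega)) ?_
  rintro t3 τ3 ⟨hC, hτ3⟩ hf3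
  have c1 : t3.arr .S = s.arr .S := (hf3.arr .S rfl).trans b1
  have c2 : t3.reg .N = N := (hf3.reg .N rfl).trans b2
  have c3 : t3.reg .off = o := (hf3.reg .off rfl).trans b3
  have c4 : t3.reg .lev = l := (hf3.reg .lev rfl).trans b4
  have c5 : t3.reg .np = 2 * N / 3 := (hf3.reg .np rfl).trans b5
  have c6 : t3.reg .len = t2.reg .len := hf3.reg .len rfl
  have c7 : t3.arr .A = t1.arr .A := (hf3.arr .A rfl).trans b7
  have c8 : t3.arr .RB = t1.arr .RB := (hf3.arr .RB rfl).trans b8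
  clear hf3
  refine wp_mono (wp_frame (merge_wp (S := S) c3 c2 c5 c6 hL hW hU
    (fun i hi => by rw [c1]; exact hS.eq i hi) (by rwa [c8]) (by rwa [c7])
    ⟨hC.mem, hC.surj, fun q r hqr hr => ?_⟩)) ?_
  -- The place given to `N - 1` does not matter: its character is unique, so it is never involved in
  -- a tie.
  · rcases hC.mono q r hqr hr with h | ⟨h, h1, h2⟩
    · exact slt_of_lt h
    · rcases h2 with h2 | h2
      · have hm := hC.mem r hr
        have := hU.ne (t3.arr .C r) (by omega)
        rw [h2, Nat.add_zero, Nat.add_zero] at h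
        exact absurd h.symm this
      · exact slt_iff.2 (.inr ⟨h, h2⟩)
  · rintro t4 τ4 ⟨⟨h1, h2⟩, hf⟩
    refine ⟨(hf.reg .N rfl).trans c2, (hf.reg .off rfl).trans c3, (hf.reg .lev rfl).trans c4, h1,
        ?_⟩
    omega

/-- The strings of all levels, from `S₀` of length `N₀` to `S`: every one consists of the names of
the triples of the previous one. -/
def Chain (LN A : ℕ → ℕ) (k N₀ : ℕ) (S₀ : ℕ → ℕ) : ℕ → ℕ → ℕ → (ℕ → ℕ) → Prop
  | 0, off, N, S => off = 0 ∧ N = N₀ ∧ S = S₀ ∧ UL S N ∧ Stored A off N (N + k) S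
  | l + 1, off, N, S => ∃ off' N' S', Chain LN A k N₀ S₀ l off' N' S' ∧ 2 ≤ N' ∧ LN l = N' ∧
      off = off' + N' + 2 ∧ N = 2 * N' / 3 ∧ UL S N ∧ Names S' N' S ∧ Stored A off N (N + k) S

theorem Chain.last {LN A : ℕ → ℕ} {k N₀ : ℕ} {S₀ : ℕ → ℕ} {l off N : ℕ} {S : ℕ → ℕ}
    (h : Chain LN A k N₀ S₀ l off N S) : UL S N ∧ Stored A off N (N + k) S := by
  rcases l with _ | l
  · exact h.2.2.2
  · obtain ⟨_, _, _, h⟩ := h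
    exact ⟨h.2.2.2.2.2.1, h.2.2.2.2.2.2.2⟩

/-- A level moves the offset by `N' + 2` and leaves at most two thirds of the length `N'`, so `off +
5 * N` grows by at most 2. The length drops at every level, so there are fewer than `N₀` levels, and
the whole stack has linear size. -/
theorem Chain.bound {LN A : ℕ → ℕ} {k N₀ : ℕ} {S₀ : ℕ → ℕ} {l off N : ℕ} {S : ℕ → ℕ}
    (h : Chain LN A k N₀ S₀ l off N S) :
    off + 5 * N ≤ 5 * N₀ + 2 * l ∧ l + N ≤ N₀ ∧ 1 ≤ N := by
  induction l generalizing off N S with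
  | zero =>
    have := h.2.2.2.1.pos
    obtain ⟨h1, h2, -⟩ := h
    omega
  | succ l ih =>
    obtain ⟨_, _, _, h, h1, h2, h3, h4, -⟩ := h
    have := ih h
    omega

theorem Stored.congr {A A' : ℕ → ℕ} {o N K : ℕ} {S : ℕ → ℕ} (h : Stored A o N K S)
    (e : ∀ i < o + N + 2, A' i = A i) : Stored A' o N K S :=
  ⟨fun i hi => by rw [e _ (by omega), h.eq i hi], by rw [e _ (by omega), h.pad],
    by rw [e _ (by omega), h.pad'], h.zero, h.zero', h.pos, h.lt⟩

theorem Chain.congr {LN LN' A A' : ℕ → ℕ} {k N₀ : ℕ} {S₀ : ℕ → ℕ} {l off N : ℕ} {S : ℕ → ℕ}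
    (h : Chain LN A k N₀ S₀ l off N S) (e : ∀ i < off + N + 2, A' i = A i)
    (e' : ∀ i < l, LN' i = LN i) : Chain LN' A' k N₀ S₀ l off N S := by
  induction l generalizing off N S with
  | zero => exact ⟨h.1, h.2.1, h.2.2.1, h.2.2.2.1, h.2.2.2.2.congr e⟩
  | succ l ih =>
    obtain ⟨o', N', S', h, h1, h2, h3, h4, h5, h6, h7⟩ := h
    exact ⟨o', N', S', ih h (fun i hi => e i (by omega)) (fun i hi => e' i (by omega)), h1,
      by rw [e' l (by omega), h2], h3, h4, h5, h6, h7.congr e⟩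

/-- The geometric series of the levels: at most two thirds of the budget `1000 * k * M` go to the
next level, and the remaining third covers the work on this one, as `M + k ≤ k * M`. -/
theorem level_time {k M : ℕ} (hk : 2 ≤ k) (hM : 2 ≤ M) :
    1000 * k * (2 * M / 3) + 300 * (M + k) + 1 ≤ 1000 * k * M := by
  have h1 : k * (1000 * (2 * M / 3) + 301 * M) ≤ k * (1000 * M) :=
    Nat.mul_le_mul_left _ (by omega)
  obtain ⟨k, rfl⟩ := Nat.exists_eq_add_of_le hk
  obtain ⟨M, rfl⟩ := Nat.exists_eq_add_of_le hM
  have h2 : 2 + M + (2 + k) ≤ (2 + k) * (2 + M) := by nlinarith [Nat.zero_le (k * M)]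
  have h3 : (2 + k) * (1000 * (2 * (2 + M) / 3) + 301 * (2 + M)) =
    1000 * (2 + k) * (2 * (2 + M) / 3) + 301 * ((2 + k) * (2 + M)) := by ring
  have h4 : (2 + k) * (1000 * (2 + M)) = 1000 * (2 + k) * (2 + M) := by ring
  omega

/-- The ranks of the suffixes of the string of length `N` in `S`, by recursion on the triples. -/
def dc3 (k : ℕ) : Prog :=
  .lev ::= 0 ;; .off ::= 0 ;; .loop (.lt 1 Var.N) (descend k) ;; .store .RK 0 0 ;;
  .loop (.lt 0 Var.lev) (ascend k)

/-- The recursion is unrolled into a loop that descends to length 1, where the only suffix has rank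
0, and a loop that climbs back. `Chain` is the invariant of both; the second one adds that the top
string has been ranked. -/
theorem dc3_wp {Γ : Env} {s : St} {τ N k : ℕ} {S : ℕ → ℕ} (hN : s.reg .N = N) (hk : 2 ≤ k)
    (hL : 8 * N + k + 10 ≤ Γ.L) (hW : Γ.L < Γ.W) (hU : UL S N)
    (hS : Stored (s.arr .S) 0 N (N + k) S) :
    wp Γ (dc3 k) (fun t τ' => IsRank (slt S) N (t.arr .RK) ∧ t.reg .N = N ∧
      τ' ≤ τ + 2000 * k * N + 10) s τ := by
  have hN1 := hU.pos
  unfold dc3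
  refine wp_seq_iff.2 (wp_assign_iff.2 ⟨by simp; omega, ?_⟩)
  refine wp_seq_iff.2 (wp_assign_iff.2 ⟨by simp; omega, ?_⟩)
  refine wp_seq (wp_while (fun t τ' => (∃ S', Chain (t.arr .LN) (t.arr .S) k N S (t.reg .lev)
    (t.reg .off) (t.reg .N) S') ∧ τ' + 1000 * k * t.reg .N ≤ τ + 1000 * k * N + 2)
    (fun t => t.reg .N) ?_ ?_ ?_) ?_
  · refine ⟨⟨S, ?_⟩, ?_⟩
    · simp [Chain, hN]
      exact ⟨hU, hS⟩
    · simp [hN]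
      omega
  · intro t τ' _ _
    simp
    omega
  · rintro t τ' - ⟨⟨S', hc⟩, hτ⟩ h1
    have h1' : 1 < t.reg .N := h1
    have hb := hc.bound
    obtain ⟨hU', hS'⟩ := hc.last
    refine wp_mono (descend_wp (S := S') rfl rfl rfl h1' hk (by omega) (by omega) (by omega) hW
      hS') ?_
    rintro u τ'' ⟨e1, e2, e3, e4, e5, ⟨R, hR, hSR⟩, e6⟩
    refine ⟨⟨⟨R, ?_⟩, ?_⟩, by rw [e1]; omega⟩
    · rw [e1, e2, e3, e4]
      refine ⟨_, _, S', hc.congr e5 (fun i hi => Function.update_of_ne (by omega) _ _), h1',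
        by simp, rfl, rfl, (triples hU' h1' hR).1, hR, hSR⟩
    · rw [e1]
      have := level_time hk h1'
      omega
  rintro t1 τ1 ⟨τ1', rfl, ⟨⟨S1, hc1⟩, hτ1⟩, hN1'⟩ hf1
  have hN1'' : ¬ 1 < t1.reg .N := hN1'
  have hb1 := hc1.bound
  have e1 : t1.reg .N = 1 := by omega
  refine wp_seq_iff.2 (wp_store_iff.2 ⟨by simp; omega, by simp; omega, by simp; omega, ?_⟩)
  refine wp_mono (wp_while (fun t τ' => ∃ S', Chain (t.arr .LN) (t.arr .S) k N S (t.reg .lev)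
    (t.reg .off) (t.reg .N) S' ∧ IsRank (slt S') (t.reg .N) (t.arr .RK) ∧
      τ' ≤ τ + 1000 * k * N + 1000 * k * t.reg .N + 5) (fun t => t.reg .lev) ?_ ?_ ?_) ?_
  · refine ⟨S1, hc1, ?_, ?_⟩
    · rw [St.setArr_reg, e1]
      refine ⟨fun i hi => ?_, fun i j hi hj => ?_⟩
      · obtain rfl : i = 0 := by omega
        simp
      · obtain rfl : i = 0 := by omega
        obtain rfl : j = 0 := by omega
        simp [slt_irrefl]
    · rw [e1] at hτ1; simp [e1]
      omega
  · intro t τ' _ _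
    simp
    omega
  · rintro t τ' - ⟨S', hc, hRK, hτ⟩ h1
    have h1' : 0 < t.reg .lev := h1
    have hb := hc.bound
    obtain ⟨l, hl⟩ : ∃ l, t.reg .lev = l + 1 := ⟨t.reg .lev - 1, by omega⟩
    rw [hl] at hc
    obtain ⟨o', N', S'', hc', g1, g2, g3, g4, g5, g6, g7⟩ := hc
    have hb' := hc'.bound
    obtain ⟨hU', hS'⟩ := hc'.last
    rw [g4] at hRK
    refine wp_mono (wp_frame (ascend_wp (S := S'') (R := S') g2 g3 hl g1 hk (by omega) (by omega)
      (by omega) hW hS' hU' g6 hRK)) ?_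
    rintro u τ'' ⟨⟨e1, e2, e3, e4, e5⟩, hf⟩
    refine ⟨⟨S'', ?_, ?_, ?_⟩, by rw [e3]; omega⟩
    · rw [e1, e2, e3, hf.arr .LN rfl, hf.arr .S rfl]
      exact hc'
    · rw [e1]; exact e4
    · rw [e1]
      rw [g4] at hτ
      have := level_time hk g1
      omega
  · rintro t τ' ⟨τ'', rfl, ⟨S', hc, hRK, hτ⟩, h1⟩
    have h1' : ¬ 0 < t.reg .lev := h1
    rw [show t.reg .lev = 0 by omega] at hc
    obtain ⟨-, h2, rfl, -⟩ := hc
    rw [h2] at hRK hτ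
    refine ⟨hRK, h2, ?_⟩
    have : 2000 * k * N = 1000 * k * N + 1000 * k * N := by ring
    omega

end ExtMem

/-! ### Longest common prefixes -/

namespace SuffixIndex

/-- `z` is the length of the longest common prefix of `U` and its suffix at `p`. -/
structure IsZ (U : ℕ → ℕ) (n p z : ℕ) : Prop where
  le : z + p ≤ n
  eq : ∀ l < z, U (p + l) = U l
  ne : z + p < n → U (p + z) ≠ U z

theorem slt_add {S : ℕ → ℕ} {i j z : ℕ} (h : ∀ l < z, S (i + l) = S (j + l)) :
    slt S i j ↔ slt S (i + z) (j + z) := by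
  induction z with
  | zero => rfl
  | succ z ih => rw [ih fun l hl => h l (by omega), slt_succ (h z (by omega))]; rfl

end SuffixIndex

namespace ExtMem

open SuffixIndex

/-! ## Sorting the suffixes that start in a block -/

/-- Store the lengths of the longest common prefixes of the string in `U` and its suffixes. -/
def zArray : Prog :=
  .store .Z 0 Var.N ;; .i ::= 1 ;; .l ::= 1 ;; .r ::= 1 ;;
  .loop (.lt Var.i Var.N) (
    .load .y .Z (Var.i - Var.l) ;;
    .ite (.lt Var.y (Var.r - Var.i)) (.store .Z Var.i Var.y ;; .i ::= Var.i + 1)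
      (.f ::= 0 ;;
      .ite (.lt Var.r Var.N) (.load .u .U Var.r ;; .load .v .U (Var.r - Var.i) ;;
        .ite (.eq Var.u Var.v) (.f ::= 1) .skip) .skip ;;
      .l ::= Var.i ;;
      .ite (.eq Var.f 1) (.r ::= Var.r + 1)
        (.store .Z Var.i (Var.r - Var.i) ;; .i ::= Var.i + 1 ;;
          .ite (.lt Var.r Var.i) (.r ::= Var.i ;; .l ::= Var.i) .skip)))

/-- The window from `l` to `r` equals a prefix of `U`, so inside it earlier entries can be reused.
Every round increases `i + r`, which bounds both the number of rounds and the time. -/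
theorem zArray_wp {Γ : Env} {s : St} {τ N : ℕ} (hN : s.reg .N = N) (hN1 : 1 ≤ N) (hL : N < Γ.L)
    (hW : Γ.L < Γ.W) : wp Γ zArray (fun t τ' =>
      (∀ p < N, IsZ (s.arr .U) N p (t.arr .Z p)) ∧ τ' ≤ τ + 60 * N + 10) s τ := by
  obtain ⟨U, hU⟩ : ∃ U, s.arr .U = U := ⟨_, rfl⟩
  rw [hU]
  unfold zArray
  -- The entry at 0 is the full length. After `l` has been set to `i`, the lookup at `i - l = 0` is
  -- therefore never below `r - i`, and the extension of the window resumes where it stopped.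
  refine wp_seq_iff.2 (wp_store_iff.2 ⟨by simp; omega, by simp, by simp; omega, ?_⟩)
  refine wp_seq_iff.2 (wp_assign_iff.2 ⟨by simp; omega, ?_⟩)
  refine wp_seq_iff.2 (wp_assign_iff.2 ⟨by simp; omega, ?_⟩)
  refine wp_seq_iff.2 (wp_assign_iff.2 ⟨by simp; omega, ?_⟩)
  refine wp_mono (wp_frame (wp_while (fun t τ' => 1 ≤ t.reg .l ∧ t.reg .l ≤ t.reg .i ∧
    t.reg .i ≤ t.reg .r ∧ t.reg .r ≤ N ∧
    (∀ x, t.reg .l + x < t.reg .r → U (t.reg .l + x) = U x) ∧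
    (∀ p < t.reg .i, IsZ U N p (t.arr .Z p)) ∧
    τ' ≤ τ + 30 * (t.reg .i + t.reg .r)) (fun t => 2 * N - t.reg .i - t.reg .r) ?_ ?_ ?_)) ?_
  · simp [hN]
    refine ⟨by omega, by simp, fun l hl => by simp, fun h => by omega⟩
  · intro t τ' _ _
    simp
  · rintro t τ' hf ⟨I1, I2, I3, I4, I5, I6, I7⟩ hi
    have e1 : t.reg .N = N := by rw [hf.reg .N rfl]; simpa using hN
    have e2 : t.arr .U = U := by rw [hf.arr .U rfl]; simpa using hU
    clear hf
    obtain ⟨i, hid⟩ : ∃ i, t.reg .i = i := ⟨_, rfl⟩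
    obtain ⟨l, hld⟩ : ∃ l, t.reg .l = l := ⟨_, rfl⟩
    obtain ⟨r, hrd⟩ : ∃ r, t.reg .r = r := ⟨_, rfl⟩
    obtain ⟨y, hyd⟩ : ∃ y, t.arr .Z (i - l) = y := ⟨_, rfl⟩
    simp [e1, hid] at hi
    rw [hld] at I1 I2 I5
    rw [hid] at I2 I3 I6 I7
    rw [hrd] at I3 I4 I5 I7
    have hy := I6 (i - l) (by omega)
    rw [hyd] at hy
    have hZ : ∀ v, IsZ U N i v → ∀ p < i + 1, IsZ U N p (Function.update (t.arr .Z) i v p) := by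
      intro v hv p hp
      rcases (by omega : p = i ∨ p < i) with rfl | hp
      · simpa using hv
      · rw [Function.update_of_ne (by omega)]; exact I6 p hp
    have hI5 : ∀ x, i + x < r → U (i + x) = U (i - l + x) := fun x hx => by
      have := I5 (i - l + x) (by omega)
      rwa [show l + (i - l + x) = i + x by omega] at this
    simp only [wp_seq_iff, wp_load_iff, wp_ite_iff, wp_store_iff, wp_assign_iff, Ex.ok_sub,
      Ex.ok_var, Ex.val_var, Ex.val_sub, Ex.ok_add, Ex.ok_ofNat, Ex.val_add, Ex.val_ofNat,
      Cn.ok_lt, Cn.ok_eq, Cn.holds_lt, Cn.holds_eq, St.set_reg, St.set_arr, St.setArr_reg,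
      St.setArr_arr, Function.update_self, ne_eq, reduceCtorEq, not_false_eq_true,
      Function.update_of_ne, hid, hld, hrd, hyd, e1, e2, wp_skip_iff, true_and, and_true]
    refine ⟨⟨by omega, by omega⟩, by omega, ⟨by omega, by omega⟩, fun hlt => ?_, fun hlt => ?_⟩
    · repeat refine ⟨by omega, ?_⟩
      refine ⟨⟨by omega, by omega, by omega, by omega, I5, hZ y ⟨by omega, fun x hx => ?_,
        fun hx => ?_⟩, by omega⟩, by omega⟩
      · rw [hI5 x (by omega)]; exact hy.eq x hx
      · rw [hI5 y (by omega)]; exact hy.ne (by omega)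
    · have hpre : ∀ x, i + x < r → U (i + x) = U x := fun x hx => by
        rw [hI5 x hx]; exact hy.eq x (by omega)
      have fin : (r < N → U r ≠ U (r - i)) → IsZ U N i (r - i) := fun h =>
        ⟨by omega, fun x hx => hpre x (by omega), fun hx => by
          rw [show i + (r - i) = r by omega]; exact h (by omega)⟩
      refine ⟨by omega, fun hrN => ?_, fun hrN => ?_⟩
      · refine ⟨by omega, ⟨by omega, by omega⟩, by omega, fun huv => ?_, fun huv => ?_⟩
        · repeat refine ⟨by omega, ?_⟩
          refine ⟨fun _ => ?_, fun h => absurd trivial h⟩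
          repeat refine ⟨by omega, ?_⟩
          refine ⟨⟨by omega, by omega, by omega, by omega, fun x hx => ?_, I6, by omega⟩,
            by omega⟩
          rcases (by omega : i + x < r ∨ x = r - i) with h | rfl
          · exact hpre x h
          · rw [show i + (r - i) = r by omega]; exact huv
        · repeat refine ⟨by omega, ?_⟩
          refine ⟨fun h => by simp at h, fun _ => ?_⟩
          repeat refine ⟨by omega, ?_⟩
          have hz := hZ _ (fin fun _ => huv)
          refine ⟨fun hri => ?_, fun hri => ?_⟩
          · exact ⟨⟨by omega, by omega, by omega, by omega, fun x hx => by omega, hz, by omega⟩,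
              by omega⟩
          · exact ⟨⟨by omega, by omega, by omega, by omega, hpre, hz, by omega⟩, by omega⟩
      · refine ⟨by omega, fun h => by simp at h, fun _ => ?_⟩
        repeat refine ⟨by omega, ?_⟩
        have hz := hZ _ (fin fun h => absurd h hrN)
        · exact fun hri => ⟨⟨by omega, by omega, by omega, by omega, hpre, hz, by omega⟩, by omega⟩
  · rintro t τ' ⟨⟨τ'', rfl, ⟨I1, I2, I3, I4, I5, I6, I7⟩, hi⟩, hf⟩
    have h1 : ¬ t.reg .i < t.reg .N := hi
    have h2 : t.reg .N = N := by rw [hf.reg .N rfl]; simpa using hN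
    exact ⟨fun p hp => I6 p (by omega), by omega⟩

/-- Store in `S` a string whose suffixes are ordered like those of the text in the block. -/
def blockString : Prog :=
  .N ::= Var.m + Var.el ;; zArray ;;
  (.i ::= 0 ;; .upTo .i Var.el (
    .load .z .Z (Var.m + Var.i) ;;
    .ite (.eq Var.z (Var.el - Var.i)) (.load .g .G (Var.el - Var.i))
      (.load .u .U (Var.m + Var.i + Var.z) ;; .load .v .U Var.z ;;
        .ite (.lt Var.v Var.u) (.g ::= 1) (.g ::= 0)) ;;
    .load .u .U (Var.m + Var.i) ;; .store .S Var.i (Var.u + 2 * (Var.g : Ex)))) ;;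
  .load .u .U 0 ;; .store .S Var.el (Var.u + 1) ;; .N ::= Var.el + 1 ;; .store .S Var.N 0 ;;
  .store .S (Var.N + 1) 0

/-- The text `t` of length `n` over the characters from 1 to `σ`, followed by zeros. -/
structure Text (σ n : ℕ) (t : ℕ → ℕ) : Prop where
  pos : ∀ p < n, 0 < t p
  le : ∀ p, t p ≤ σ
  zero : ∀ p, n ≤ p → t p = 0

/-- The position `n` is admitted: the zero there acts as a unique end marker. Thus the rightmost
block, whose end is `n`, needs no special treatment. -/
theorem Text.total {σ n : ℕ} {t : ℕ → ℕ} (h : Text σ n t) {i j : ℕ} (hi : i ≤ n) (hj : j ≤ n)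
    (hij : i ≠ j) : slt t i j ∨ slt t j i := by
  have hU : UL t (n + 1) := ⟨Nat.succ_pos _, fun i hi => by
    rw [h.zero _ (show n ≤ n + 1 - 1 by omega)]
    exact (h.pos _ (by omega)).ne'⟩
  exact hU.total (by omega) (by omega) hij

/-- In the string of the `m` characters from `a + e` on followed by the block, the Z-function gives
the common prefixes of the block suffixes with the suffix at `a + e`. If one ends inside the block,
the mismatch decides. If it reaches the end of the block after `k` characters, what remains is to
compare the suffixes at `a + e` and `a + e + k`, and `G` holds the answer. -/
theorem blockString_wp {Γ : Env} {s : St} {τ σ n m a e : ℕ} {t : ℕ → ℕ} (ht : Text σ n t)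
    (hm : s.reg .m = m) (hel : s.reg .el = e) (he : 0 < e) (hem : e ≤ m) (hae : a + e ≤ n)
    (hL : 8 * m + σ + 22 ≤ Γ.L) (hW : Γ.L < Γ.W)
    (hU : ∀ k < m, s.arr .U k = t (a + e + k)) (hU' : ∀ i < e, s.arr .U (m + i) = t (a + i))
    (hG : ∀ k ≤ m, (s.arr .G k = 1 ∧ slt t (a + e + k) (a + e)) ∨
      (s.arr .G k = 0 ∧ ¬ slt t (a + e + k) (a + e))) :
    wp Γ blockString (fun u τ' => u.reg .N = e + 1 ∧ (∃ X, UL X (e + 1) ∧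
      Stored (u.arr .S) 0 (e + 1) (e + 1 + (σ + 4)) X ∧
      ∀ i j, i < e + 1 → j < e + 1 → (slt X i j ↔ slt t (a + i) (a + j))) ∧
      τ' ≤ τ + 200 * m + 100) s τ := by
  classical
  have ht' : Total (fun i j => slt t (a + i) (a + j)) (e + 1) := fun i j hi hj hij =>
    ht.total (by omega) (by omega) (by omega)
  unfold blockString
  refine wp_seq_iff.2 (wp_assign_iff.2 ⟨by simp [hm, hel]; omega, ?_⟩)
  refine wp_seq (zArray_wp (N := m + e) (by simp [hm, hel]) (by omega) (by omega) hW) ?_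
  rintro s1 τ1 ⟨hZ, hτ1⟩ hf1
  have a1 : s1.arr .U = s.arr .U := hf1.arr .U rfl
  have a2 : s1.arr .G = s.arr .G := hf1.arr .G rfl
  have a3 : s1.reg .m = m := by rw [hf1.reg .m rfl]; simpa using hm
  have a4 : s1.reg .el = e := by rw [hf1.reg .el rfl]; simpa using hel
  clear hf1
  refine wp_seq (wp_for (fun i u => ∀ j < i, u.arr .S j =
    t (a + j) + if slt t (a + e) (a + j) then 2 else 0) 16 e (by omega) (by simp) ?_ ?_) ?_
  · intro u hf
    simpa [a4] using hf.reg .el rfl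
  · intro i u τ' hf hi hI hx
    have e1 : u.arr .U = s.arr .U := by rw [hf.arr .U rfl]; simpa using a1
    have e2 : u.arr .G = s.arr .G := by rw [hf.arr .G rfl]; simpa using a2
    have e3 : u.arr .Z = s1.arr .Z := by rw [hf.arr .Z rfl]; simp
    have e4 : u.reg .m = m := by rw [hf.reg .m rfl]; simpa using a3
    have e5 : u.reg .el = e := by rw [hf.reg .el rfl]; simpa using a4
    clear hf
    have hz := hZ (m + i) (by omega)
    obtain ⟨z, hzd⟩ : ∃ z, s1.arr .Z (m + i) = z := ⟨_, rfl⟩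
    rw [hzd] at hz
    have hz1 := hz.le
    have hpre : ∀ l < z, t (a + e + l) = t (a + i + l) := fun l hl => by
      have := hz.eq l hl
      rw [St.set_arr, hU l (by omega), Nat.add_assoc, hU' (i + l) (by omega)] at this
      rw [← this, Nat.add_assoc]
    have hslt := slt_add hpre
    have hti := hU' i hi
    have hle := ht.le (a + i)
    have hstep : ∀ v, v = (t (a + i) + if slt t (a + e) (a + i) then 2 else 0) →
        ∀ j ≤ i, Function.update (u.arr .S) i v j =
          t (a + j) + if slt t (a + e) (a + j) then 2 else 0 := by
      rintro v rfl j hj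
      rcases (by omega : j = i ∨ j < i) with rfl | hj
      · simp
      · rw [Function.update_of_ne (by omega)]; exact hI j hj
    simp [hx, e1, e2, e3, e4, e5, hzd, hti, and_assoc]
    repeat refine ⟨by omega, ?_⟩
    refine ⟨fun hzk => ?_, fun hzk => ?_⟩
    · have h1 : slt t (a + e) (a + i) ↔ slt t (a + e + (e - i)) (a + e) := by
        rw [hslt, hzk, show a + i + (e - i) = a + e by omega]
      repeat refine ⟨by omega, ?_⟩
      rcases hG (e - i) (by omega) with ⟨h2, h3⟩ | ⟨h2, h3⟩
      · rw [h2]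
        repeat refine ⟨by omega, ?_⟩
        exact hstep _ (by rw [if_pos (h1.2 h3)])
      · rw [h2]
        repeat refine ⟨by omega, ?_⟩
        exact hstep _ (by rw [if_neg fun h => h3 (h1.1 h)])
    · have h2 : s.arr .U (m + i + z) = t (a + i + z) := by
        rw [Nat.add_assoc, hU' (i + z) (by omega), Nat.add_assoc]
      have h3 : s.arr .U z = t (a + e + z) := hU z (by omega)
      have hne := hz.ne (by omega)
      rw [St.set_arr, h2, h3] at hne
      rw [h2, h3]
      repeat refine ⟨by omega, ?_⟩
      refine ⟨fun hlt => ?_, fun hlt => ?_⟩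
      · repeat refine ⟨by omega, ?_⟩
        exact hstep _ (by rw [if_pos (hslt.2 (slt_of_lt hlt))])
      · have : slt t (a + i + z) (a + e + z) := slt_of_lt (by omega)
        repeat refine ⟨by omega, ?_⟩
        exact hstep _ (by rw [if_neg fun h => slt_asymm this (hslt.1 h)]; rfl)
  rintro s2 τ2 ⟨hS, -, hτ2⟩ hf2
  have b1 : s2.arr .U = s.arr .U := (hf2.arr .U rfl).trans a1
  have b4 : s2.reg .el = e := (hf2.reg .el rfl).trans a4
  clear hf2
  have h0 := hU 0 (by omega)
  have hle := ht.le (a + e)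
  rw [Nat.add_zero] at h0
  simp [b1, b4, h0, and_assoc]
  repeat refine ⟨by omega, ?_⟩
  obtain ⟨X, hX⟩ : ∃ X : ℕ → ℕ, X = fun i => if i < e then
    t (a + i) + if slt t (a + e) (a + i) then 2 else 0 else if i = e then t (a + e) + 1
      else 0 := ⟨_, rfl⟩
  have hX1 : ∀ i < e, X i = t (a + i) + if slt t (a + e) (a + i) then 2 else 0 :=
    fun i hi => by simp [hX, hi]
  have hX2 : X e = t (a + e) + 1 := by simp [hX]
  have hX3 : X (e + 1) = 0 := by simp [hX]
  have hX4 : X (e + 2) = 0 := by simp [hX]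
  obtain ⟨h1, h2⟩ := block_string (fun i hi => by rw [hX1 i hi]; split_ifs <;> rfl) hX2 ht'
  refine ⟨⟨X, h1, ⟨fun i hi => ?_, ?_, ?_, hX3, hX4, fun i hi => ?_, fun i hi => ?_⟩,
    fun i j hi hj => h2 i j (by omega) (by omega)⟩, by omega⟩
  · rw [Nat.zero_add, Function.update_of_ne (by omega), Function.update_of_ne (by omega)]
    rcases (by omega : i = e ∨ i < e) with rfl | hi
    · simp [hX2]
    · rw [Function.update_of_ne (by omega), hS i hi, hX1 i hi]
  · simp
  · simp
  · rcases (by omega : i = e ∨ i < e) with rfl | hi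
    · rw [hX2]; omega
    · rw [hX1 i hi]; have := ht.pos (a + i) (by omega); omega
  · rcases (by omega : i = e ∨ i < e) with rfl | hi
    · rw [hX2]; omega
    · rw [hX1 i hi]; have := ht.le (a + i); split_ifs <;> omega

/-- Store in `RK` the ranks of the suffixes that start in a block or just behind it. -/
def sortBlock (σ : ℕ) : Prog := blockString ;; dc3 (σ + 4)

theorem sortBlock_wp {Γ : Env} {s : St} {τ σ n m a e : ℕ} {t : ℕ → ℕ} (ht : Text σ n t)
    (hm : s.reg .m = m) (hel : s.reg .el = e) (he : 0 < e) (hem : e ≤ m) (hae : a + e ≤ n)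
    (hL : 8 * m + σ + 22 ≤ Γ.L) (hW : Γ.L < Γ.W)
    (hU : ∀ k < m, s.arr .U k = t (a + e + k)) (hU' : ∀ i < e, s.arr .U (m + i) = t (a + i))
    (hG : ∀ k ≤ m, (s.arr .G k = 1 ∧ slt t (a + e + k) (a + e)) ∨
      (s.arr .G k = 0 ∧ ¬ slt t (a + e + k) (a + e))) :
    wp Γ (sortBlock σ) (fun u τ' => u.reg .N = e + 1 ∧
      IsRank (fun i j => slt t (a + i) (a + j)) (e + 1) (u.arr .RK) ∧
      τ' ≤ τ + 5000 * (σ + 4) * m) s τ := by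
  refine wp_seq (blockString_wp ht hm hel he hem hae hL hW hU hU' hG) ?_
  rintro s1 τ1 ⟨hN, ⟨X, hX, hS, hsl⟩, hτ1⟩ -
  refine wp_mono (dc3_wp hN (by omega) (by omega) hW hX hS) ?_
  rintro s2 τ2 ⟨h1, h2, h3⟩
  refine ⟨h2, ⟨h1.lt_len, fun i j hi hj => (h1.iff i j hi hj).trans (hsl i j hi hj)⟩, ?_⟩
  have h4 : 2000 * (σ + 4) * (e + 1) ≤ 2000 * (σ + 4) * (2 * m) := by gcongr; omega
  have h5 : 310 * m ≤ 1000 * (σ + 4) * m := by nlinarith [Nat.zero_le (σ * m)]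
  have h6 : 5000 * (σ + 4) * m = 2000 * (σ + 4) * (2 * m) + 1000 * (σ + 4) * m := by ring
  omega

end ExtMem

/-! ### Counts for the backward search -/

namespace SuffixIndex

/-- The number of suffixes that start in the block of length `e` at `a`, and begin with a character
smaller than `c`, or with `c` and continue with one of the `r` smallest suffixes. -/
def occ (t : ℕ → ℕ) (a e : ℕ) (R : ℕ → ℕ) (c r : ℕ) : ℕ :=
  ((Finset.range e).filter fun i => t (a + i) < c).card +
    ((Finset.range e).filter fun i => t (a + i) = c ∧ R (i + 1) < r).card

section

variable {t R : ℕ → ℕ} {a e c r : ℕ}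

theorem occ_zero (h : ∀ i < e, 0 < t (a + i)) : occ t a e R 1 0 = 0 := by
  simp only [occ, Nat.not_lt_zero, and_false, Finset.filter_false, Finset.card_empty, add_zero,
    Finset.card_eq_zero, Finset.filter_eq_empty_iff, Finset.mem_range]
  exact fun i hi => by have := h i hi; omega

/-- The count at the end of one row is the count at the start of the next, so a single running
counter fills the whole table. -/
theorem occ_next (h : ∀ i < e, R (i + 1) < r) : occ t a e R (c + 1) 0 = occ t a e R c r := by
  simp only [occ, Nat.not_lt_zero, and_false, Finset.filter_false, Finset.card_empty, add_zero]
  rw [← Finset.card_union_of_disjoint]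
  · congr 1
    ext i
    simp only [Finset.mem_filter, Finset.mem_range, Finset.mem_union]
    constructor
    · rintro ⟨h1, h2⟩
      have := h i h1
      omega
    · omega
  · rw [Finset.disjoint_filter]
    intro i _ h1 h2
    omega

/-- Exactly one suffix has the rank `r`, and `P r` is the character before it, as in the
Burrows–Wheeler transform. The suffix at `a` is preceded by a character outside the block; it is
marked by 0, which no `c` matches. -/
theorem occ_succ {P : ℕ → ℕ} (hR : IsRank (fun i j => slt t (a + i) (a + j)) (e + 1) R)
    (ht : Total (fun i j => slt t (a + i) (a + j)) (e + 1)) (h0 : P (R 0) = 0)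
    (hP : ∀ i < e, P (R (i + 1)) = t (a + i)) (hc : 0 < c) (hr : r < e + 1) :
    occ t a e R c (r + 1) = occ t a e R c r + if P r = c then 1 else 0 := by
  have key : ((Finset.range e).filter fun i => t (a + i) = c ∧ R (i + 1) < r + 1).card =
      ((Finset.range e).filter fun i => t (a + i) = c ∧ R (i + 1) < r).card +
      ((Finset.range e).filter fun i => t (a + i) = c ∧ R (i + 1) = r).card := by
    rw [← Finset.card_union_of_disjoint]
    · congr 1
      ext i
      simp only [Finset.mem_filter, Finset.mem_range, Finset.mem_union]
      omega
    · rw [Finset.disjoint_filter]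
      intro i _ h1 h2
      omega
  have key2 : ((Finset.range e).filter fun i => t (a + i) = c ∧ R (i + 1) = r).card =
      if P r = c then 1 else 0 := by
    obtain ⟨i, hi, rfl⟩ := hR.surj ht hr
    rcases i with _ | i
    · rw [h0, if_neg (by omega), Finset.card_eq_zero, Finset.filter_eq_empty_iff]
      rintro k hk ⟨_, h2⟩
      have := hR.inj ht (by simp at hk; omega) hi h2
      omega
    · rw [hP i (by omega)]
      split_ifs with h
      · rw [Finset.card_eq_one]
        refine ⟨i, ?_⟩
        ext k
        simp only [Finset.mem_filter, Finset.mem_range, Finset.mem_singleton]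
        constructor
        · rintro ⟨h1, _, h3⟩
          have := hR.inj ht (by omega) hi h3
          omega
        · rintro rfl
          exact ⟨by omega, h, rfl⟩
      · rw [Finset.card_eq_zero, Finset.filter_eq_empty_iff]
        rintro k hk ⟨h2, h3⟩
        have := hR.inj ht (by simp at hk; omega) hi h3
        obtain rfl : k = i := by omega
        exact h h2
  rw [occ, key, key2, occ, Nat.add_assoc]

theorem occ_le : occ t a e R c r ≤ e := by
  rw [occ, ← Finset.card_union_of_disjoint]
  · refine (Finset.card_le_card (Finset.union_subset (Finset.filter_subset _ _)
      (Finset.filter_subset _ _))).trans (by simp)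
  · rw [Finset.disjoint_filter]
    intro i _ h1 h2
    omega

end

end SuffixIndex

namespace ExtMem

open SuffixIndex

/-! ## Tables for the backward search -/

/-- Prepare the tables `OCC` and `GAP`. -/
def occTable (σ : ℕ) : Prog :=
  (.r ::= 0 ;; .upTo .r (Var.N + 1) (.store .GAP Var.r 0)) ;;
  .load .x .RK 0 ;; .store .PREV Var.x 0 ;;
  (.i ::= 0 ;; .upTo .i Var.el (.load .x .RK (Var.i + 1) ;; .load .u .U (Var.m + Var.i) ;;
    .store .PREV Var.x Var.u)) ;;
  .f ::= 0 ;; .y ::= 0 ;;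
  (.c ::= 0 ;; .upTo .c (.lit σ) (
    (.r ::= 0 ;; .upTo .r Var.N (.store .OCC (Var.y + Var.r) Var.f ;; .load .u .PREV Var.r ;;
      .ite (.eq Var.u (Var.c + 1)) (.f ::= Var.f + 1) .skip)) ;;
    .store .OCC (Var.y + Var.N) Var.f ;; .y ::= Var.y + Var.N + 1))

/-- A row has `e + 2` columns, one for each possible number `0, …, e + 1` of smaller suffixes. Rows
are numbered from 0, whereas the characters of `t` start from 1. -/
theorem occTable_wp {Γ : Env} {s : St} {τ σ n m a e : ℕ} {t : ℕ → ℕ} (ht : Text σ n t)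
    (hm : s.reg .m = m) (hel : s.reg .el = e) (hN : s.reg .N = e + 1) (hem : e ≤ m)
    (hae : a + e ≤ n)
    (hL : 2 * m + (σ + 1) * (e + 2) + 2 ≤ Γ.L) (hW : Γ.L < Γ.W) (hσ : σ < Γ.W)
    (hR : IsRank (fun i j => slt t (a + i) (a + j)) (e + 1) (s.arr .RK))
    (hU : ∀ i < e, s.arr .U (m + i) = t (a + i)) :
    wp Γ (occTable σ) (fun u τ' => (∀ r ≤ e + 1, u.arr .GAP r = 0) ∧
      (∀ c < σ, ∀ r ≤ e + 1, u.arr .OCC (c * (e + 2) + r) = occ t a e (s.arr .RK) (c + 1) r) ∧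
      τ' ≤ τ + 30 * (σ + 1) * (e + 2)) s τ := by
  have ht' : Total (fun i j => slt t (a + i) (a + j)) (e + 1) := fun i j hi hj hij =>
    ht.total (by omega) (by omega) (by omega)
  obtain ⟨R, hRd⟩ : ∃ R, s.arr .RK = R := ⟨_, rfl⟩
  rw [hRd] at hR ⊢
  have hexp : (σ + 1) * (e + 2) = σ * (e + 2) + (e + 2) := by ring
  unfold occTable
  refine wp_seq (wp_for (fun i u => ∀ r < i, u.arr .GAP r = 0) 2 (e + 2) (by omega) (by simp)
    ?_ ?_) ?_
  · intro u hf
    have : u.reg .N = e + 1 := by rw [hf.reg .N rfl]; simpa using hN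
    simp [this]
    omega
  · intro i u τ' hf hi hI hx
    simp [hx, and_assoc]
    repeat refine ⟨by omega, ?_⟩
    intro v hv
    simp only [Function.update_apply]
    split_ifs with h
    · rfl
    · exact hI v (by omega)
  rintro s1 τ1 ⟨hG, -, hτ1⟩ hf1
  have a1 : s1.arr .U = s.arr .U := hf1.arr .U rfl
  have a2 : s1.arr .RK = R := (hf1.arr .RK rfl).trans hRd
  have a3 : s1.reg .m = m := (hf1.reg .m rfl).trans hm
  have a4 : s1.reg .el = e := (hf1.reg .el rfl).trans hel
  have a5 : s1.reg .N = e + 1 := (hf1.reg .N rfl).trans hN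
  clear hf1
  have hR0 := hR.lt_len 0 (by omega)
  refine wp_seq_iff.2 (wp_load_iff.2 ⟨by simp; omega, by simp; omega, ?_⟩)
  refine wp_seq_iff.2 (wp_store_iff.2 ⟨by simp, by simp; omega, by simp [a2]; omega, ?_⟩)
  refine wp_seq (wp_for (fun i u => u.arr .PREV (R 0) = 0 ∧
    ∀ k < i, u.arr .PREV (R (k + 1)) = t (a + k)) 4 e (by omega) (by simp [a2]) ?_ ?_) ?_
  · intro u hf
    simpa [a4] using hf.reg .el rfl
  · rintro i u τ' hf hi ⟨I1, I2⟩ hx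
    have e1 : u.reg .m = m := by rw [hf.reg .m rfl]; simpa using a3
    have e2 : u.arr .RK = R := by rw [hf.arr .RK rfl]; simpa using a2
    have e3 : u.arr .U = s.arr .U := by rw [hf.arr .U rfl]; simpa using a1
    have hRi := hR.lt_len (i + 1) (by omega)
    have hne : ∀ k ≤ i, R k ≠ R (i + 1) := fun k hk h => by
      have := hR.inj ht' (by omega) (by omega) h
      omega
    simp [hx, e1, e2, e3, hU i hi, and_assoc]
    repeat refine ⟨by omega, ?_⟩
    refine ⟨by rw [Function.update_of_ne (hne 0 (by omega)), I1], fun k hk => ?_⟩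
    rcases (by omega : k = i ∨ k < i) with rfl | hk
    · simp
    · rw [Function.update_of_ne (hne _ (by omega)), I2 k hk]
  rintro s2 τ2 ⟨⟨hP0, hP⟩, -, hτ2⟩ hf2
  have b1 : s2.reg .N = e + 1 := by rw [hf2.reg .N rfl]; simpa using a5
  have b2 : s2.arr .GAP = s1.arr .GAP := by rw [hf2.arr .GAP rfl]; simp
  clear hf2
  refine wp_seq_iff.2 (wp_assign_iff.2 ⟨by simp; omega, ?_⟩)
  refine wp_seq_iff.2 (wp_assign_iff.2 ⟨by simp; omega, ?_⟩)
  refine wp_mono (wp_frame (wp_for (fun c u => u.reg .f = occ t a e R (c + 1) 0 ∧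
    u.reg .y = c * (e + 2) ∧
    ∀ c' < c, ∀ r ≤ e + 1, u.arr .OCC (c' * (e + 2) + r) = occ t a e R (c' + 1) r)
    (9 * (e + 2)) σ (by omega) ?_ ?_ ?_)) ?_
  · have h0 := occ_zero (t := t) (a := a) (e := e) (R := R) fun i hi => ht.pos (a + i) (by omega)
    simp [h0]
  · intro u hf
    exact ⟨hσ, rfl⟩
  · rintro c u τ' hf hc ⟨I1, I2, I3⟩ hx
    have e1 : u.reg .N = e + 1 := by rw [hf.reg .N rfl]; simpa using b1
    have e2 : u.arr .PREV = s2.arr .PREV := by rw [hf.arr .PREV rfl]; simp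
    clear hf
    obtain ⟨y, hy⟩ : ∃ y, y = c * (e + 2) := ⟨_, rfl⟩
    rw [← hy] at I2
    have hyσ : y + (e + 2) ≤ σ * (e + 2) := by
      have : (c + 1) * (e + 2) ≤ σ * (e + 2) := Nat.mul_le_mul_right _ (by omega)
      rw [hy, ← Nat.succ_mul]; exact this
    have hlt : ∀ c' < c, ∀ r ≤ e + 1, c' * (e + 2) + r < y := fun c' hc' r hr => by
      have : (c' + 1) * (e + 2) ≤ c * (e + 2) := Nat.mul_le_mul_right _ (by omega)
      rw [Nat.succ_mul] at this
      omega
    refine wp_seq_iff.2 (wp_seq (wp_for (fun r u' => u'.reg .f = occ t a e R (c + 1) r ∧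
      (∀ r' < r, u'.arr .OCC (y + r') = occ t a e R (c + 1) r') ∧
      ∀ p < y, u'.arr .OCC p = u.arr .OCC p) 6 (e + 1) (by omega) (by simp [I1]) ?_ ?_) ?_)
    · intro u' hf
      simpa [e1] using hf.reg .N rfl
    · rintro r u' τ'' hf hr ⟨J1, J2, J3⟩ hr'
      have f1 : u'.reg .y = y := by rw [hf.reg .y rfl]; simpa using I2
      have f2 : u'.reg .c = c := by rw [hf.reg .c rfl]; simpa using hx
      have f3 : u'.arr .PREV = s2.arr .PREV := by rw [hf.arr .PREV rfl]; simpa using e2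
      have hs := occ_succ (P := s2.arr .PREV) hR ht' hP0 hP (Nat.succ_pos c) hr
      have hle := occ_le (t := t) (a := a) (e := e) (R := R) (c := c + 1) (r := r)
      have hu : ∀ r' ≤ r, Function.update (u'.arr .OCC) (y + r) (occ t a e R (c + 1) r) (y + r') =
          occ t a e R (c + 1) r' := fun r' hr' => by
        rcases (by omega : r' = r ∨ r' < r) with rfl | h
        · simp
        · rw [Function.update_of_ne (by omega), J2 r' h]
      have hu' : ∀ p < y, Function.update (u'.arr .OCC) (y + r) (occ t a e R (c + 1) r) p =
          u.arr .OCC p := fun p hp => by rw [Function.update_of_ne (by omega), J3 p hp]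
      simp [hr', f1, f2, f3, J1, and_assoc]
      repeat refine ⟨by omega, ?_⟩
      refine ⟨fun h => ?_, fun h => ?_⟩
      · rw [if_pos h] at hs
        exact ⟨by omega, by omega, by omega, by omega, hs.symm, hu, hu'⟩
      · rw [if_neg h] at hs
        exact ⟨by omega, by omega, hs.symm, hu, hu'⟩
    · rintro u' τ'' ⟨⟨J1, J2, J3⟩, -, hτ⟩ hf
      have f1 : u'.reg .y = y := (hf.reg .y rfl).trans I2
      have f2 : u'.reg .c = c := (hf.reg .c rfl).trans hx
      have f3 : u'.reg .N = e + 1 := (hf.reg .N rfl).trans e1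
      have hle := occ_le (t := t) (a := a) (e := e) (R := R) (c := c + 1) (r := e + 1)
      have hnx := occ_next (t := t) (a := a) (e := e) (R := R) (c := c + 1) (r := e + 1)
        fun i hi => hR.lt_len (i + 1) (by omega)
      simp [f1, f2, f3, J1, and_assoc]
      repeat refine ⟨by omega, ?_⟩
      refine ⟨by rw [Nat.succ_mul]; omega, fun c' hc' r hr => ?_, by omega⟩
      rcases (by omega : c' = c ∨ c' < c) with rfl | hc'
      · rw [← hy]
        rcases (by omega : r = e + 1 ∨ r < e + 1) with rfl | hr
        · simp
        · rw [Function.update_of_ne (by omega), J2 r hr]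
      · have := hlt c' hc' r hr
        rw [Function.update_of_ne (by omega), J3 _ this, I3 c' hc' r hr]
  · rintro u τ' ⟨⟨⟨-, -, h1⟩, -, h2⟩, hf⟩
    have e1 : u.arr .GAP = s1.arr .GAP := by rw [hf.arr .GAP rfl]; simpa using b2
    refine ⟨fun r hr => by rw [e1]; exact hG r (by omega), h1, ?_⟩
    have h3 : σ * (9 * (e + 2) + 1) ≤ 10 * (σ * (e + 2)) := by nlinarith [Nat.zero_le (σ * e)]
    have h4 : 30 * (σ + 1) * (e + 2) = 30 * (σ * (e + 2)) + 30 * (e + 2) := by ring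
    omega

end ExtMem

namespace ExtMem

open SuffixIndex

/-! ## Access to the disks -/

/-- Move the head of disk `k` by `e` bits to the left. -/
def movesLeft (k : Disk) (e : Ex) : Prog := .k ::= 0 ;; .upTo .k e (.move k .toLeft)

/-- Move the head of disk `k` by `e` bits to the right. -/
def movesRight (k : Disk) (e : Ex) : Prog := .k ::= 0 ;; .upTo .k e (.move k .toRight)

theorem movesLeft_wp {Γ : Env} {k : Disk} {e : Ex} {s : St} {τ H : ℕ} (hW : H < Γ.W)
    (he : ∀ u, (∀ x, x ≠ .k → u x = s.reg x) → e.ok Γ.W u ∧ e.val u = H) (hh : H ≤ s.head k) :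
    wp Γ (movesLeft k e) (fun t τ' => t.head k = s.head k - H ∧ τ' ≤ τ + 3 * H + 2) s τ := by
  refine wp_mono (wp_for (fun i t => t.head k = s.head k - i) 2 H (by omega) (by simp) ?_ ?_) ?_
  · intro t hf
    refine he _ fun x hx => ?_
    rw [hf.reg x (by simpa [Prog.modR] using hx)]
    simp [hx]
  · intro i t τ' hf hi hI hx
    simp [hx, hI, and_assoc]
    omega
  · rintro t τ' ⟨h1, -, h2⟩
    exact ⟨h1, by omega⟩

theorem movesRight_wp {Γ : Env} {k : Disk} {e : Ex} {s : St} {τ H : ℕ} (hW : H < Γ.W)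
    (he : ∀ u, (∀ x, x ≠ .k → u x = s.reg x) → e.ok Γ.W u ∧ e.val u = H)
    (hh : s.head k + H ≤ Γ.size k) :
    wp Γ (movesRight k e) (fun t τ' => t.head k = s.head k + H ∧ τ' ≤ τ + 3 * H + 2) s τ := by
  refine wp_mono (wp_for (fun i t => t.head k = s.head k + i) 2 H (by omega) (by simp) ?_ ?_) ?_
  · intro t hf
    refine he _ fun x hx => ?_
    rw [hf.reg x (by simpa [Prog.modR] using hx)]
    simp [hx]
  · intro i t τ' hf hi hI hx
    simp [hx, hI, and_assoc]
    omega
  · rintro t τ' ⟨h1, -, h2⟩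
    exact ⟨h1, by omega⟩

/-- Read the word of `cl` bits to the left of the head of the input disk into `c`. -/
def readChar (cl : ℕ) : Prog :=
  .c ::= 0 ;; .f ::= 1 ;; (.k ::= 0 ;; .upTo .k (.lit cl) (.move .input .toLeft ;;
    .read .v .input ;; .c ::= Var.c + Var.v * Var.f ;; .f ::= Var.f * 2))

/-- A leftward scan of a word stored from its most significant bit meets the lowest bit first; after
`i` bits, `c` is the value modulo `2 ^ i`. -/
theorem readChar_wp {Γ : Env} {s : St} {τ cl p v : ℕ} (hcl : 2 ^ cl < Γ.W)
    (hh : s.head .input = (p + 1) * cl) (hsize : (p + 1) * cl ≤ Γ.size .input)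
    (hT : HoldsWord cl (s.tape .input) p v) (hv : v < 2 ^ cl) :
    wp Γ (readChar cl) (fun t τ' => t.reg .c = v ∧ t.head .input = p * cl ∧
      τ' ≤ τ + 6 * cl + 4) s τ := by
  have hclW : cl < Γ.W := (Nat.lt_two_pow_self).trans hcl
  have hp : (p + 1) * cl = p * cl + cl := Nat.succ_mul _ _
  unfold readChar
  refine wp_seq_iff.2 (wp_assign_iff.2 ⟨by simp; omega, ?_⟩)
  refine wp_seq_iff.2 (wp_assign_iff.2 ⟨by simp; omega, ?_⟩)
  refine wp_mono (wp_for (fun i t => t.head .input = (p + 1) * cl - i ∧ t.reg .c = v % 2 ^ i ∧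
    t.reg .f = 2 ^ i) 5 cl (by omega) (by simp [hh, Nat.mod_one]) ?_ ?_) ?_
  · intro t hf
    exact ⟨hclW, rfl⟩
  · rintro i t τ' hf hi ⟨I1, I2, I3⟩ hx
    have e1 : t.tape .input = s.tape .input := by rw [hf.tape .input rfl]; simp
    clear hf
    have h1 := hT i hi
    have h2 : (p + 1) * cl - i - 1 = p * cl + (cl - 1 - i) := by omega
    have h3 := Nat.mod_pow_succ (b := 2) (x := v) (k := i)
    have h4 : (v.testBit i).toNat = v / 2 ^ i % 2 := Nat.toNat_testBit _ _
    have h5 : v % 2 ^ (i + 1) ≤ v := Nat.mod_le _ _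
    have h6 : 2 ^ (i + 1) ≤ 2 ^ cl := Nat.pow_le_pow_right (by omega) hi
    have h7 : v / 2 ^ i % 2 * 2 ^ i = 2 ^ i * (v / 2 ^ i % 2) := Nat.mul_comm _ _
    have h8 : (2 : ℕ) ^ (i + 1) = 2 ^ i * 2 := pow_succ _ _
    simp [hx, e1, I1, I2, I3, h2, h1, h4, and_assoc]
    rw [h7, ← h3, ← h8]
    refine ⟨by omega, by omega, ?_, by omega, by omega, by omega, by omega, by omega, by omega,
        rfl, rfl⟩
    rw [h3] at h5
    omega
  · rintro t τ' ⟨⟨h1, h2, -⟩, -, h3⟩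
    refine ⟨by rw [h2, Nat.mod_eq_of_lt hv], by omega, by omega⟩

/-- Add the value of `u` to the word of `w` bits to the left of the head of the output disk. -/
def addSlot : Prog :=
  .k ::= 0 ;; .upTo .k Var.w (.move .output .toLeft ;; .read .v .output ;;
    .u ::= Var.u + Var.v ;; .write .output Var.u ;; .u ::= Var.u / 2)

/-- Ripple-carry addition within one leftward scan: each bit is read and rewritten in place, and `u`
keeps the unused part of the summand together with the carry, `(u + x % 2 ^ i) / 2 ^ i`. -/
theorem addSlot_wp {Γ : Env} {s : St} {τ w q u x : ℕ} (hw : s.reg .w = w) (hwW : w < Γ.W)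
    (hW : 2 < Γ.W) (hu : s.reg .u = u) (hux : u + x < Γ.W)
    (hh : s.head .output = (q + 1) * w) (hsize : (q + 1) * w ≤ Γ.size .output)
    (hT : HoldsWord w (s.tape .output) q x) :
    wp Γ addSlot (fun t τ' => HoldsWord w (t.tape .output) q (u + x) ∧
      (∀ r y, r ≠ q → HoldsWord w (s.tape .output) r y → HoldsWord w (t.tape .output) r y) ∧
      t.head .output = q * w ∧ τ' ≤ τ + 7 * w + 2) s τ := by
  have hq : (q + 1) * w = q * w + w := Nat.succ_mul _ _
  refine wp_mono (wp_for (fun i t => t.head .output = (q + 1) * w - i ∧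
    t.reg .u = (u + x % 2 ^ i) / 2 ^ i ∧
    (∀ b < i, t.tape .output (q * w + (w - 1 - b)) = (u + x).testBit b) ∧
    (∀ b < w, i ≤ b → t.tape .output (q * w + (w - 1 - b)) = x.testBit b) ∧
    (∀ p, (p < q * w ∨ (q + 1) * w ≤ p) → t.tape .output p = s.tape .output p)) 6 w (by omega)
    ?_ ?_ ?_) ?_
  · simp [hh, hu, Nat.mod_one]
    exact fun b hb => hT b hb
  · intro t hf
    simpa [hw] using hf.reg .w rfl
  · rintro i t τ' hf hi ⟨I1, I2, I3, I4, I5⟩ hx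
    clear hf
    have h1 := I4 i hi le_rfl
    have h2 : (q + 1) * w - i - 1 = q * w + (w - 1 - i) := by omega
    have h3 := Nat.mod_pow_succ (b := 2) (x := x) (k := i)
    have h4 : (x.testBit i).toNat = x / 2 ^ i % 2 := Nat.toNat_testBit _ _
    have h5 : x % 2 ^ (i + 1) ≤ x := Nat.mod_le _ _
    have h6 : (u + x % 2 ^ i) / 2 ^ i + x / 2 ^ i % 2 = (u + x % 2 ^ (i + 1)) / 2 ^ i := by
      rw [h3, ← Nat.add_assoc, Nat.add_mul_div_left _ _ (by positivity)]
    have h7 : (u + x % 2 ^ (i + 1)) / 2 ^ i ≤ u + x % 2 ^ (i + 1) := Nat.div_le_self _ _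
    have h8 : (u + x % 2 ^ (i + 1)) / 2 ^ i / 2 = (u + x % 2 ^ (i + 1)) / 2 ^ (i + 1) := by
      rw [Nat.div_div_eq_div_mul, ← pow_succ]
    -- The bits of `x` above `i` have no influence on bit `i` of the sum.
    have h9 : ((u + x % 2 ^ (i + 1)) / 2 ^ i).testBit 0 = (u + x).testBit i := by
      have h10 : u + x = u + x % 2 ^ (i + 1) + 2 ^ i * (2 * (x / 2 ^ (i + 1))) := by
        have := Nat.mod_add_div x (2 ^ (i + 1))
        rw [pow_succ, Nat.mul_assoc] at this
        rw [pow_succ]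
        omega
      rw [Nat.testBit_eq_decide_div_mod_eq (x := u + x), h10, Nat.add_mul_div_left _ _
          (by positivity),
        Nat.add_mul_mod_self_left, Nat.testBit_eq_decide_div_mod_eq, pow_zero, Nat.div_one]
    simp only [wp_seq_iff, wp_moveLeft_iff, wp_read_iff, wp_assign_iff, wp_write_iff, I1, I2, hx,
      St.moveTo_head, St.moveTo_tape, St.moveTo_reg, St.set_reg, St.set_tape, St.set_head,
      Function.update_self, h2, h1, h4, Ex.ok_add, Ex.ok_var, Ex.val_add, Ex.val_var, h6,
      Ex.ok_div, Ex.ok_ofNat, Ex.val_div, Ex.val_ofNat, h8, h9, St.setBit_tape, St.setBit_head,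
      St.setBit_reg, ne_eq, reduceCtorEq, not_false_eq_true, Function.update_of_ne, true_and,
      and_assoc]
    refine ⟨by omega, by omega, by omega, by omega, by omega, by omega, by omega, by omega,
        by omega,
      fun b hb => ?_, fun b hb hib => ?_, fun p hp => ?_, by omega⟩
    · rcases (by omega : b = i ∨ b < i) with rfl | hb
      · simp
      · rw [Function.update_of_ne (by omega)]; exact I3 b hb
    · rw [Function.update_of_ne (by omega)]; exact I4 b hb (by omega)
    · rw [Function.update_of_ne (by omega)]; exact I5 p hp
  · rintro t τ' ⟨⟨h1, -, h2, -, h3⟩, -, h4⟩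
    refine ⟨h2, fun r y hr hy b hb => ?_, by omega, by omega⟩
    rw [h3, hy b hb]
    rcases Nat.lt_or_gt_of_ne hr with h | h
    · have : (r + 1) * w ≤ q * w := Nat.mul_le_mul_right _ h
      rw [Nat.succ_mul] at this
      omega
    · have : (q + 1) * w ≤ r * w := Nat.mul_le_mul_right _ h
      omega

/-- Move the heads from the block that begins at `a` and ends at `b` to the end of the text. -/
def goRight (cl : ℕ) : Prog :=
  (.j ::= Var.a ;; .upTo .j Var.n (movesRight .input (.lit cl))) ;;
  (.j ::= Var.b ;; .upTo .j Var.n (.move .work .toRight)) ;;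
  (.j ::= Var.b / Var.d ;; .upTo .j (Var.n / Var.d) (movesRight .output Var.w))

theorem goRight_wp {Γ : Env} {s : St} {τ cl n d w a b : ℕ} (hn : s.reg .n = n)
    (hd : s.reg .d = d) (hw : s.reg .w = w) (ha : s.reg .a = a) (hb : s.reg .b = b)
    (han : a ≤ n) (hbn : b ≤ n) (hnW : n < Γ.W) (hclW : cl < Γ.W) (hwW : w < Γ.W)
    (h1 : s.head .input = a * cl) (h2 : s.head .work = b) (h3 : s.head .output = b / d * w)
    (hs1 : n * cl ≤ Γ.size .input) (hs2 : n ≤ Γ.size .work) (hs3 : n / d * w ≤ Γ.size .output) :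
    wp Γ (goRight cl) (fun t τ' => t.head .input = n * cl ∧ t.head .work = n ∧
      t.head .output = n / d * w ∧
      τ' ≤ τ + (3 * cl + 8) * n + (n / d) * (3 * w + 4) + 10) s τ := by
  unfold goRight
  refine wp_seq (P := fun t τ' => t.head .input = n * cl ∧ τ' ≤ τ + n * (3 * cl + 4) + 3) ?_ ?_
  · refine wp_seq_iff.2 (wp_assign_iff.2 ⟨by simp, ?_⟩)
    refine wp_mono (wp_upTo (fun i t => t.head .input = i * cl) (fun i => i * (3 * cl + 4)) a n
      (by simp [ha]) han (by simpa using h1) ?_ ?_) ?_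
    · intro t hf
      refine ⟨trivial, ?_⟩
      simpa [hn] using hf.reg .n rfl
    · intro i t τ' hf hai hi hI hx
      have hle : (i + 1) * cl ≤ n * cl := Nat.mul_le_mul_right _ hi
      rw [Nat.succ_mul] at hle
      refine wp_seq (movesRight_wp (H := cl) hclW (fun u _ => ⟨hclW, rfl⟩) (by omega)) ?_
      rintro t' τ'' ⟨h4, h5⟩ hf'
      have := (hf'.reg .j rfl).trans hx
      simp [this, h4, hI, Nat.succ_mul]
      omega
    · rintro t τ' ⟨h4, -, h5⟩
      exact ⟨h4, by omega⟩
  rintro t1 τ1 ⟨c1, c2⟩ hf1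
  have a1 := (hf1.reg .n rfl).trans hn
  have a2 := (hf1.reg .d rfl).trans hd
  have a3 := (hf1.reg .w rfl).trans hw
  have a4 := (hf1.reg .b rfl).trans hb
  have a5 := (hf1.head .work rfl).trans h2
  have a6 := (hf1.head .output rfl).trans h3
  clear hf1
  refine wp_seq (P := fun t τ' => t.head .work = n ∧ τ' ≤ τ1 + n * 4 + 3) ?_ ?_
  · refine wp_seq_iff.2 (wp_assign_iff.2 ⟨by simp, ?_⟩)
    refine wp_mono (wp_upTo (fun i t => t.head .work = i) (fun i => i * 4) b n
      (by simp [a4]) hbn (by simpa using a5) ?_ ?_) ?_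
    · intro t hf
      refine ⟨trivial, ?_⟩
      simpa [a1] using hf.reg .n rfl
    · intro i t τ' hf hai hi hI hx
      simp [hx, hI]
      omega
    · rintro t τ' ⟨h4, -, h5⟩
      exact ⟨h4, by omega⟩
  rintro t2 τ2 ⟨c3, c4⟩ hf2
  have b1 := (hf2.reg .n rfl).trans a1
  have b2 := (hf2.reg .d rfl).trans a2
  have b3 := (hf2.reg .w rfl).trans a3
  have b4 := (hf2.reg .b rfl).trans a4
  have b5 := (hf2.head .input rfl).trans c1
  have b6 := (hf2.head .output rfl).trans a6
  clear hf2
  refine wp_seq_iff.2 (wp_assign_iff.2 ⟨by simp [b4]; omega, ?_⟩)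
  have hnd : n / d ≤ n := Nat.div_le_self _ _
  refine wp_mono (wp_frame (wp_upTo (fun i t => t.head .output = i * w)
    (fun i => i * (3 * w + 4)) (b / d) (n / d) (by simp [b4, b2]) (Nat.div_le_div_right hbn)
    (by simpa using b6) ?_ ?_)) ?_
  · intro t hf
    have e1 : t.reg .n = n := by rw [hf.reg .n rfl]; simpa using b1
    have e2 : t.reg .d = d := by rw [hf.reg .d rfl]; simpa using b2
    simp [e1, e2, hnW]
  · intro i t τ' hf hai hi hI hx
    have e1 : t.reg .w = w := by rw [hf.reg .w rfl]; simpa using b3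
    have hle : (i + 1) * w ≤ n / d * w := Nat.mul_le_mul_right _ hi
    rw [Nat.succ_mul] at hle
    refine wp_seq (movesRight_wp (H := w) hwW (fun u hu => ⟨trivial, ?_⟩) (by omega)) ?_
    · simpa [e1] using hu .w (by decide)
    rintro t' τ'' ⟨h4, h5⟩ hf'
    have := (hf'.reg .j rfl).trans hx
    simp [this, h4, hI, Nat.succ_mul]
    omega
  · rintro t τ' ⟨⟨h4, -, h5⟩, hf⟩
    refine ⟨(hf.head .input rfl).trans (by simpa using b5), (hf.head .work rfl).trans
      (by simpa using c3), h4, ?_⟩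
    have e1 : (3 * cl + 8) * n = n * (3 * cl + 4) + n * 4 := by ring
    omega

/-- The characters of `t` are stored on the tape with `cl` bits each. -/
def Encoded (cl n : ℕ) (t : ℕ → ℕ) (tape : ℕ → Bool) : Prop :=
  ∀ p < n, HoldsWord cl tape p (t p - 1) ∧ t p - 1 < 2 ^ cl

/-- Make the current block the next one in `U`, and read the new current block behind it. -/
def readBlock (cl : ℕ) : Prog :=
  (.i ::= 0 ;; .upTo .i Var.m (.load .u .U (Var.m + Var.i) ;; .store .U Var.i Var.u)) ;;
  (.i ::= 0 ;; .upTo .i Var.el (readChar cl ;;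
    .store .U (Var.m + Var.el - 1 - Var.i) (Var.c + 1)))

/-- After the shift, `U` holds the next block followed by the current one, which is the string whose
Z-function is needed. -/
theorem readBlock_wp {Γ : Env} {s : St} {τ σ n cl m a e : ℕ} {t : ℕ → ℕ} (ht : Text σ n t)
    (hT : Encoded cl n t (s.tape .input)) (hcl : 2 ^ cl < Γ.W)
    (hm : s.reg .m = m) (hel : s.reg .el = e) (hem : e ≤ m) (hae : a + e ≤ n)
    (hL : 2 * m < Γ.L) (hW : Γ.L < Γ.W)
    (hU : ∀ k < m, s.arr .U (m + k) = t (a + e + k)) (hh : s.head .input = (a + e) * cl)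
    (hs : n * cl ≤ Γ.size .input) :
    wp Γ (readBlock cl) (fun u τ' => (∀ k < m, u.arr .U k = t (a + e + k)) ∧
      (∀ i < e, u.arr .U (m + i) = t (a + i)) ∧ u.head .input = a * cl ∧
      τ' ≤ τ + (6 * cl + 14) * m + 10) s τ := by
  unfold readBlock
  refine wp_seq (wp_for (fun i u => (∀ k < i, u.arr .U k = t (a + e + k)) ∧
    ∀ k < m, i ≤ m + k → u.arr .U (m + k) = t (a + e + k)) 3 m (by omega) ?_ ?_ ?_) ?_
  · simpa using fun k hk => hU k hk
  · intro u hf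
    refine ⟨trivial, ?_⟩
    simpa [hm] using hf.reg .m rfl
  · rintro i u τ' hf hi ⟨I1, I2⟩ hx
    have e1 : u.reg .m = m := by rw [hf.reg .m rfl]; simpa using hm
    simp [hx, e1, I2 i hi, and_assoc]
    repeat refine ⟨by omega, ?_⟩
    refine ⟨fun k hk => ?_, fun k hk hk' => ?_⟩
    · rcases (by omega : k = i ∨ k < i) with rfl | hk
      · simp
      · rw [Function.update_of_ne (by omega), I1 k hk]
    · rw [Function.update_of_ne (by omega), I2 k hk (by omega)]
  rintro s1 τ1 ⟨⟨h1, -⟩, -, hτ1⟩ hf1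
  have a1 : s1.reg .m = m := (hf1.reg .m rfl).trans hm
  have a2 : s1.reg .el = e := (hf1.reg .el rfl).trans hel
  have a3 : s1.head .input = (a + e) * cl := (hf1.head .input rfl).trans hh
  have a4 : s1.tape .input = s.tape .input := hf1.tape .input rfl
  clear hf1
  refine wp_mono (wp_for (fun i u => (∀ k < m, u.arr .U k = t (a + e + k)) ∧
    (∀ k < e, e ≤ k + i → u.arr .U (m + k) = t (a + k)) ∧ u.head .input = (a + e - i) * cl)
    (6 * cl + 8) e (by omega) ?_ ?_ ?_) ?_
  · simp [a3]
    exact ⟨h1, fun k hk hk' => absurd hk' (by omega)⟩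
  · intro u hf
    refine ⟨trivial, ?_⟩
    simpa [a2] using hf.reg .el rfl
  · rintro i u τ' hf hi ⟨I1, I2, I3⟩ hx
    have e1 : u.reg .m = m := by rw [hf.reg .m rfl]; simpa using a1
    have e2 : u.reg .el = e := by rw [hf.reg .el rfl]; simpa using a2
    have e3 : u.tape .input = s.tape .input := by rw [hf.tape .input rfl]; simpa using a4
    clear hf
    have hp : a + e - i = (a + (e - 1 - i)) + 1 := by omega
    rw [hp] at I3
    obtain ⟨hT1, hT2⟩ := hT (a + (e - 1 - i)) (by omega)
    have hle : (a + (e - 1 - i) + 1) * cl ≤ n * cl := Nat.mul_le_mul_right _ (by omega)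
    refine wp_seq_iff.2 (wp_seq (readChar_wp hcl I3 (by omega) (by rw [e3]; exact hT1) hT2) ?_)
    rintro u' τ'' ⟨h2, h3, h4⟩ hf
    have f1 : u'.reg .m = m := (hf.reg .m rfl).trans e1
    have f2 : u'.reg .el = e := (hf.reg .el rfl).trans e2
    have f3 : u'.arr .U = u.arr .U := hf.arr .U rfl
    have f4 : u'.reg .i = i := (hf.reg .i rfl).trans hx
    have h5 := ht.pos (a + (e - 1 - i)) (by omega)
    have h6 : t (a + (e - 1 - i)) - 1 + 1 = t (a + (e - 1 - i)) := by omega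
    simp [f1, f2, f3, f4, h2, h3, h6, and_assoc]
    repeat refine ⟨by omega, ?_⟩
    refine ⟨fun k hk => ?_, fun k hk hk' => ?_, ?_, by omega⟩
    · rw [Function.update_of_ne (by omega), I1 k hk]
    · rcases (by omega : k = e - 1 - i ∨ e ≤ k + i) with rfl | hk'
      · rw [show m + e - 1 - i = m + (e - 1 - i) by omega]
        simp
      · rw [Function.update_of_ne (by omega), I2 k hk hk']
    · rw [show a + e - (i + 1) = a + (e - 1 - i) by omega]
      simp
  · rintro u τ' ⟨⟨h2, h3, h4⟩, -, h5⟩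
    refine ⟨h2, fun i hi => h3 i hi (by omega), by rw [h4, Nat.add_sub_cancel], ?_⟩
    have h6 : e * (6 * cl + 8 + 1) ≤ m * (6 * cl + 8 + 1) := Nat.mul_le_mul_right _ hem
    have h7 : (6 * cl + 14) * m = m * (6 * cl + 8 + 1) + 5 * m := by ring
    omega

end ExtMem

/-! ### Gap counts and the values of partially processed slots -/

namespace SuffixIndex

/-- The number of positions from `lo` to `n - 1` where `F` has the value `r`. -/
def gap (F : ℕ → ℕ) (lo n r : ℕ) : ℕ := ((Finset.Ico lo n).filter fun p => F p = r).card

/-- The number of positions from `lo` to `n - 1` where `F` has a value smaller than `r`. -/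
def cumGap (F : ℕ → ℕ) (lo n r : ℕ) : ℕ := ((Finset.Ico lo n).filter fun p => F p < r).card

theorem gap_self (F : ℕ → ℕ) (n r : ℕ) : gap F n n r = 0 := by simp [gap]

theorem gap_le (F : ℕ → ℕ) (lo n r : ℕ) : gap F lo n r ≤ n - lo :=
  (Finset.card_filter_le _ _).trans (by simp)

theorem gap_step (F : ℕ → ℕ) {lo n : ℕ} (h : lo < n) (r : ℕ) :
    gap F lo n r = gap F (lo + 1) n r + if F lo = r then 1 else 0 := by
  rw [gap, gap, ← Finset.insert_Ico_add_one_left_eq_Ico h, Finset.filter_insert]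
  split_ifs
  · rw [Finset.card_insert_of_notMem (by simp)]
  · rfl

theorem cumGap_zero (F : ℕ → ℕ) (lo n : ℕ) : cumGap F lo n 0 = 0 := by simp [cumGap]

theorem cumGap_le (F : ℕ → ℕ) (lo n r : ℕ) : cumGap F lo n r ≤ n - lo :=
  (Finset.card_filter_le _ _).trans (by simp)

theorem cumGap_succ (F : ℕ → ℕ) (lo n r : ℕ) :
    cumGap F lo n (r + 1) = cumGap F lo n r + gap F lo n r := by
  rw [cumGap, cumGap, gap, ← Finset.card_union_of_disjoint]
  · congr 1
    ext i
    simp only [Finset.mem_filter, Finset.mem_union]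
    constructor
    · rintro ⟨h1, h2⟩
      rcases (Nat.lt_succ_iff_lt_or_eq.1 h2) with h | h
      · exact .inl ⟨h1, h⟩
      · exact .inr ⟨h1, h⟩
    · rintro (⟨h1, h2⟩ | ⟨h1, h2⟩) <;> exact ⟨h1, by omega⟩
  · rw [Finset.disjoint_filter]
    intro i _ h1 h2
    omega

theorem cnt_eq_card_Ico (t : ℕ → ℕ) (b n j : ℕ) [DecidablePred fun p => slt t p j] :
    cnt t b (n - b) j = ((Finset.Ico b n).filter fun p => slt t p j).card := by
  classical
  rw [cnt]
  refine Finset.card_bij (fun i _ => b + i) (fun i hi => ?_) (fun i _ j _ h => by omega)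
    fun p hp => ?_
  · simp only [Finset.mem_filter, Finset.mem_range, Finset.mem_Ico] at hi ⊢
    exact ⟨by omega, hi.2⟩
  · simp only [Finset.mem_filter, Finset.mem_Ico] at hp
    refine ⟨p - b, ?_, by omega⟩
    simp only [Finset.mem_filter, Finset.mem_range]
    refine ⟨by omega, ?_⟩
    rw [Nat.add_sub_cancel' hp.1.1]
    exact hp.2

theorem cnt_lt {t : ℕ → ℕ} {a N i : ℕ} (hi : i < N) : cnt t a N (a + i) < N := by
  classical
  have := Finset.card_lt_card (s := (Finset.range N).filter fun k => slt t (a + k) (a + i))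
    (t := Finset.range N) ⟨Finset.filter_subset _ _, fun h => by
      have := h (Finset.mem_range.2 hi)
      simp [slt_irrefl] at this⟩
  rw [Finset.card_range] at this
  rw [cnt]
  convert this

/-- The value in the slot `q` when the text from `b` on has been processed. -/
noncomputable def slotVal (t : ℕ → ℕ) (n d b q : ℕ) : ℕ :=
  if (q + 1) * d ≤ b then 0 else 1 + cnt t b (n - b) ((q + 1) * d - 1)

/-- A rank among at most `n` suffixes. As `n` fits into a word, no addition to a slot overflows. -/
theorem slotVal_le {t : ℕ → ℕ} {n d b q : ℕ} (hq : (q + 1) * d ≤ n) : slotVal t n d b q ≤ n := by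
  unfold slotVal
  split_ifs with h
  · omega
  · have := cnt_lt (t := t) (a := b) (i := (q + 1) * d - 1 - b) (N := n - b) (by omega)
    rw [Nat.add_sub_cancel' (by omega)] at this
    omega

theorem slotVal_of_dvd {t : ℕ → ℕ} {n d b j : ℕ} (hd : d ∣ j + 1) :
    slotVal t n d b (j / d) = if j < b then 0 else 1 + cnt t b (n - b) j := by
  have h := Nat.succ_div (a := j) (b := d)
  rw [if_pos hd] at h
  rw [slotVal, ← h, Nat.div_mul_cancel hd, Nat.add_sub_cancel]
  rfl

/-- The suffixes from `a` on are those of the block and those from `a + e` on, so a later rank grows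
by the number of block suffixes below it. -/
theorem slotVal_add {t : ℕ → ℕ} {n d a e j : ℕ} (haj : a + e ≤ j) (hjn : j < n) (hd : d ∣ j + 1) :
    cnt t a e j + slotVal t n d (a + e) (j / d) = slotVal t n d a (j / d) := by
  rw [slotVal_of_dvd hd, slotVal_of_dvd hd, if_neg (by omega), if_neg (by omega),
    show n - a = e + (n - (a + e)) by omega, cnt_add]
  omega

/-- The slots while the block from `a` to `b` is processed, and the scan is at `j`. -/
def Slots (t : ℕ → ℕ) (n d w a b j : ℕ) (tape : ℕ → Bool) : Prop :=
  ∀ q, (q + 1) * d ≤ n →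
    HoldsWord w tape q (if j < (q + 1) * d then slotVal t n d a q else slotVal t n d b q)

theorem Slots.skip {t : ℕ → ℕ} {n d w a b j : ℕ} {tape : ℕ → Bool} (hd : ¬ d ∣ j + 1)
    (h : Slots t n d w a b (j + 1) tape) : Slots t n d w a b j tape := by
  intro q hq
  have h1 := h q hq
  have h2 : (q + 1) * d ≠ j + 1 := fun h => hd ⟨q + 1, by rw [← h, Nat.mul_comm]⟩
  rw [if_congr (show j < (q + 1) * d ↔ j + 1 < (q + 1) * d by omega) rfl rfl]
  exact h1

end SuffixIndex

namespace ExtMem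

open SuffixIndex

/-! ## The scans of the disks -/

/-- If the position `j` is sampled, add the value of `u` to its slot. -/
def putSlot : Prog := .ite (.eq ((Var.j + 1) % Var.d) 0) addSlot .skip

/-- The time is amortized over the scan: the quotient by `d` drops by one exactly at the sampled
positions, and only these pay for the `w` bits of a slot. -/
theorem putSlot_wp {Γ : Env} {s : St} {τ n d w a b j u : ℕ} {t : ℕ → ℕ} (hj : s.reg .j = j)
    (hd : s.reg .d = d) (hw : s.reg .w = w) (hu : s.reg .u = u) (hjn : j < n) (hnW : n < Γ.W)
    (hwW : w < Γ.W) (hW : 2 < Γ.W) (hd0 : 0 < d) (hh : s.head .output = (j + 1) / d * w)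
    (hsize : n / d * w ≤ Γ.size .output) (hS : Slots t n d w a b (j + 1) (s.tape .output))
    (hval : d ∣ j + 1 → u + slotVal t n d b (j / d) = slotVal t n d a (j / d)) :
    wp Γ putSlot (fun s' τ' => s'.head .output = j / d * w ∧
      Slots t n d w a b j (s'.tape .output) ∧
      τ' + (7 * w + 4) * (j / d) ≤ τ + (7 * w + 4) * ((j + 1) / d) + 2) s τ := by
  have hdiv := Nat.succ_div (a := j) (b := d)
  refine wp_ite_iff.2 ⟨by simp [hj]; omega, fun hc => ?_, fun hc => ?_⟩
  · have hdvd : d ∣ j + 1 := Nat.dvd_of_mod_eq_zero (by simpa [hj, hd] using hc)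
    rw [if_pos hdvd] at hdiv
    have hq : (j / d + 1) * d = j + 1 := by rw [← hdiv, Nat.div_mul_cancel hdvd]
    have hle := slotVal_le (t := t) (n := n) (d := d) (b := a) (q := j / d) (by omega)
    have hv := hval hdvd
    have hsz : (j / d + 1) * w ≤ n / d * w := by
      rw [← hdiv]
      exact Nat.mul_le_mul_right _ (Nat.div_le_div_right hjn)
    have hx := hS (j / d) (by omega)
    rw [hq, if_neg (lt_irrefl _)] at hx
    refine wp_mono (addSlot_wp hw hwW hW hu (by omega) (by rw [hh, hdiv]) (by omega) hx) ?_
    rintro s' τ' ⟨h1, h2, h3, h4⟩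
    refine ⟨h3, fun q hqn => ?_, ?_⟩
    · rcases eq_or_ne q (j / d) with rfl | hne
      · rw [hq, if_pos (Nat.lt_succ_self _), ← hv]; exact h1
      · have h5 := h2 q _ hne (hS q hqn)
        have h6 : (q + 1) * d ≠ j + 1 := fun h => hne (by
          have := Nat.eq_of_mul_eq_mul_right hd0 (h.trans hq.symm); omega)
        rw [if_congr (show j < (q + 1) * d ↔ j + 1 < (q + 1) * d by omega) rfl rfl]
        exact h5
    · rw [hdiv, Nat.mul_succ]
      omega
  · have hdvd : ¬ d ∣ j + 1 := fun h => hc (by simpa [hj, hd] using Nat.mod_eq_zero_of_dvd h)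
    replace hdiv : (j + 1) / d = j / d := by rw [hdiv, if_neg hdvd]; rfl
    rw [wp_skip_iff, hdiv]
    refine ⟨by rw [hh, hdiv], hS.skip hdvd, by omega⟩

/-- Scan the disks from the end of the text to the end of the block: find the rank of every suffix
among those of the block. -/
def scan (cl : ℕ) : Prog :=
  .rk ::= 0 ;; .i ::= 0 ;; .upTo .i (Var.n - Var.b) (.j ::= Var.n - 1 - Var.i ;; readChar cl ;;
    (.move .work .toLeft ;; .read .h .work ;;
    .load .rk .OCC (Var.c * (Var.N + 1) + Var.rk) ;; .u ::= Var.rk ;; .rk ::= Var.rk + Var.h ;;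
    .load .y .GAP Var.rk ;; .store .GAP Var.rk (Var.y + 1) ;;
    .ite (.lt Var.g Var.rk) (.write .work 1) (.write .work 0)) ;; putSlot)

/-- The budget of one round: `Z` is what the scan may spend on slots, and `X` and `Y` are the
unspent parts before and after the round. -/
theorem time_step {τ τ₁ τ₂ τ₃ c A X Y Z : ℕ} (h₁ : τ₁ ≤ τ + 1 + 6 * c + 4) (h₂ : τ₂ ≤ τ₁ + 12)
    (h₃ : τ₃ + Y ≤ τ₂ + X + 2) (hXZ : X ≤ Z) (hYX : Y ≤ X) :
    τ₃ + 1 + 1 + (A + (Z - X)) ≤ τ + (A + (6 * c + 40) + (Z - Y)) := by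
  omega

set_option maxHeartbeats 400000 in
-- Backward search: `F j`, the number of sorted suffixes below suffix `j`, follows from `F (j + 1)`,
-- the character at `j` and the bit under the head of the work disk. After its use the bit is
-- replaced by the one that the next block needs, so the bits of two blocks never have to coexist.
theorem scan_wp {Γ : Env} {s : St} {τ σ n d w cl a e : ℕ} {t R : ℕ → ℕ} (ht : Text σ n t)
    (hn : s.reg .n = n) (hd : s.reg .d = d) (hw : s.reg .w = w) (hb : s.reg .b = a + e)
    (hN : s.reg .N = e + 1) (hg : s.reg .g = R 0) (hae : a + e ≤ n) (hnW : n < Γ.W)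
    (hwW : w < Γ.W) (hW : 2 < Γ.W) (hd0 : 0 < d) (hcl : 2 ^ cl < Γ.W) (hLW : Γ.L < Γ.W)
    (hL : σ * (e + 2) ≤ Γ.L) (hL' : e + 2 ≤ Γ.L)
    (hR : IsRank (fun i j => slt t (a + i) (a + j)) (e + 1) R)
    (hT : Encoded cl n t (s.tape .input)) (hs1 : n * cl ≤ Γ.size .input) (hs2 : n ≤ Γ.size .work)
    (hs3 : n / d * w ≤ Γ.size .output) (h1 : s.head .input = n * cl) (h2 : s.head .work = n)
    (h3 : s.head .output = n / d * w)
    (hocc : ∀ c < σ, ∀ r ≤ e + 1, s.arr .OCC (c * (e + 2) + r) = occ t a e R (c + 1) r)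
    (hgap : ∀ r ≤ e + 1, s.arr .GAP r = 0)
    (hwork : ∀ p, a + e ≤ p → p < n → (s.tape .work p = true ↔ slt t (a + e) p))
    (hslots : Slots t n d w a (a + e) n (s.tape .output)) :
    wp Γ (scan cl) (fun s' τ' =>
      (∀ r ≤ e + 1, s'.arr .GAP r = gap (cnt t a (e + 1)) (a + e) n r) ∧
      (∀ p, a + e ≤ p → p < n → (s'.tape .work p = true ↔ slt t a p)) ∧
      Slots t n d w a (a + e) (a + e) (s'.tape .output) ∧ s'.head .input = (a + e) * cl ∧
      s'.head .work = a + e ∧ s'.head .output = (a + e) / d * w ∧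
      τ' ≤ τ + (6 * cl + 40) * n + (7 * w + 4) * (n / d) + 10) s τ := by
  classical
  have ht' : Total (fun i j => slt t (a + i) (a + j)) (e + 1) := fun i j hi hj hij =>
    ht.total (by omega) (by omega) (by omega)
  obtain ⟨F, hF⟩ : ∃ F, cnt t a (e + 1) = F := ⟨_, rfl⟩
  -- From `n` on there are only zeros, and no suffix is smaller; the search starts from 0.
  have hFn : F n = 0 := by
    rw [← hF, cnt, Finset.card_eq_zero, Finset.filter_eq_empty_iff]
    rintro i - ⟨k, _, hk⟩
    rw [ht.zero (n + k) (by omega)] at hk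
    omega
  have hFle : ∀ j, F j ≤ e + 1 := fun j => by rw [← hF]; exact cnt_le _ _ _ _
  rw [hF]
  unfold scan
  refine wp_seq_iff.2 (wp_assign_iff.2 ⟨by simp; omega, ?_⟩)
  refine wp_seq_iff.2 (wp_assign_iff.2 ⟨by simp; omega, ?_⟩)
  refine wp_mono (wp_upTo (fun i u => u.head .input = (n - i) * cl ∧ u.head .work = n - i ∧
    u.head .output = (n - i) / d * w ∧ u.reg .rk = F (n - i) ∧
    (∀ r ≤ e + 1, u.arr .GAP r = gap F (n - i) n r) ∧
    (∀ p, n - i ≤ p → p < n → (u.tape .work p = true ↔ slt t a p)) ∧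
    (∀ p, a + e ≤ p → p < n - i → (u.tape .work p = true ↔ slt t (a + e) p)) ∧
    Slots t n d w a (a + e) (n - i) (u.tape .output))
    (fun i => (6 * cl + 40) * i + ((7 * w + 4) * (n / d) - (7 * w + 4) * ((n - i) / d)))
    0 (n - (a + e)) (by simp) (by omega) ?_ ?_ ?_) ?_
  · simp only [St.set_head, St.set_reg, St.set_arr, St.set_tape, Nat.sub_zero, hFn, gap_self]
    exact ⟨h1, h2, h3, by simp, hgap, fun p h h' => absurd h' (by omega), hwork, hslots⟩
  · intro u hf
    have e1 : u.reg .n = n := by rw [hf.reg .n rfl]; simpa using hn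
    have e2 : u.reg .b = a + e := by rw [hf.reg .b rfl]; simpa using hb
    simp [e1, e2]
    omega
  · rintro i u τ' hf - hi ⟨I1, I2, I3, I4, I5, I6, I7, I8⟩ hx
    have e1 : u.reg .n = n := by rw [hf.reg .n rfl]; simpa using hn
    have e2 : u.reg .N = e + 1 := by rw [hf.reg .N rfl]; simpa using hN
    have e3 : u.reg .d = d := by rw [hf.reg .d rfl]; simpa using hd
    have e4 : u.reg .w = w := by rw [hf.reg .w rfl]; simpa using hw
    have e5 : u.reg .g = R 0 := by rw [hf.reg .g rfl]; simpa using hg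
    have e6 : u.arr .OCC = s.arr .OCC := by rw [hf.arr .OCC rfl]; simp
    have e7 : u.tape .input = s.tape .input := by rw [hf.tape .input rfl]; simp
    clear hf
    obtain ⟨j, hj⟩ : ∃ j, n - i = j + 1 := ⟨n - i - 1, by omega⟩
    have hjn : j < n := by omega
    have hjb : a + e ≤ j := by omega
    have hj' : n - (i + 1) = j := by omega
    have hj'' : n - 1 - i = j := by omega
    rw [hj] at I1 I2 I3 I4 I5 I6 I7 I8
    rw [hj, hj']
    obtain ⟨hT1, hT2⟩ := hT j hjn
    have hle : (j + 1) * cl ≤ n * cl := Nat.mul_le_mul_right _ hjn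
    have htj := ht.pos j hjn
    have htj' := ht.le j
    have hFj := hFle (j + 1)
    have hstep : F j = occ t a e R (t j) (F (j + 1)) + if slt t (a + e) j then 1 else 0 := by
      rw [← hF]; exact cnt_step hR ht' j
    have hocc' : s.arr .OCC ((t j - 1) * (e + 1 + 1) + F (j + 1)) =
        occ t a e R (t j) (F (j + 1)) := by
      rw [show e + 1 + 1 = e + 2 by omega, hocc (t j - 1) (by omega) _ hFj,
        Nat.sub_add_cancel htj]
    obtain ⟨o, ho⟩ : ∃ o, occ t a e R (t j) (F (j + 1)) = o := ⟨_, rfl⟩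
    rw [ho] at hstep hocc'
    have hidx : (t j - 1) * (e + 1 + 1) + F (j + 1) < σ * (e + 2) := by
      have : (t j - 1 + 1) * (e + 2) ≤ σ * (e + 2) := Nat.mul_le_mul_right _ (by omega)
      rw [Nat.succ_mul] at this
      rw [show e + 1 + 1 = e + 2 by omega]
      omega
    have hFj' := hFle j
    -- Before the bit is added, the value counts the suffixes of the block proper. This is the
    -- increment of the slot, since the suffix at `a + e` has been counted there already.
    have hcnt : cnt t a e j = o := by
      have := cnt_succ t a e j
      rw [hF, hstep] at this
      omega
    -- The new bit: suffix `a` is below suffix `j` exactly if its rank `R 0` is among the first `F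
    -- j` ranks.
    have hgt : slt t a j ↔ R 0 < F j := by
      rw [← hF]; exact slt_iff_lt_cnt hR ht' (Nat.succ_pos e) j
    have hgap' := gap_step F hjn
    have hgle := gap_le F (j + 1) n (F j)
    refine wp_seq_iff.2 (wp_seq_iff.2 (wp_assign_iff.2 ⟨by simp [e1, hx]; omega, ?_⟩))
    refine wp_seq (readChar_wp (p := j) hcl (by simpa using I1) (by omega)
      (by simpa [e7] using hT1) hT2) ?_
    rintro u1 τ1 ⟨g1, g2, g3⟩ hf
    have a1 : u1.reg .i = i := (hf.reg .i rfl).trans (by simpa using hx)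
    have a2 : u1.reg .N = e + 1 := (hf.reg .N rfl).trans (by simpa using e2)
    have a3 : u1.reg .d = d := (hf.reg .d rfl).trans (by simpa using e3)
    have a4 : u1.reg .w = w := (hf.reg .w rfl).trans (by simpa using e4)
    have a5 : u1.reg .g = R 0 := (hf.reg .g rfl).trans (by simpa using e5)
    have a6 : u1.arr .OCC = s.arr .OCC := (hf.arr .OCC rfl).trans (by simpa using e6)
    have a7 : u1.reg .j = j := (hf.reg .j rfl).trans (by simp [e1, hx, hj''])
    have a8 : u1.head .work = j + 1 := (hf.head .work rfl).trans (by simpa using I2)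
    have a9 : u1.head .output = (j + 1) / d * w := (hf.head .output rfl).trans (by simpa using I3)
    have a10 : u1.reg .rk = F (j + 1) := (hf.reg .rk rfl).trans (by simpa using I4)
    have a11 : u1.arr .GAP = u.arr .GAP := (hf.arr .GAP rfl).trans (by simp)
    have a12 : u1.tape = u.tape := by
      funext k
      exact (hf.tape k (by cases k <;> rfl)).trans (by simp)
    clear hf
    obtain ⟨bit, hbit⟩ : ∃ bit, (u.tape .work j).toNat = bit := ⟨_, rfl⟩
    have hbit' : bit = if slt t (a + e) j then 1 else 0 := by
      rw [← hbit]
      by_cases h : slt t (a + e) j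
      · rw [if_pos h, (I7 j hjb (by omega)).2 h]; rfl
      · rw [if_neg h]
        have := (I7 j hjb (by omega)).not.2 h
        simp at this
        rw [this]; rfl
    rw [← hbit'] at hstep
    refine wp_seq (P := fun u2 τ2 => u2.reg .u = o ∧ u2.reg .rk = F j ∧ u2.head .work = j ∧
      (∀ r ≤ e + 1, u2.arr .GAP r = gap F j n r) ∧
      (∀ p, j ≤ p → p < n → (u2.tape .work p = true ↔ slt t a p)) ∧
      (∀ p, a + e ≤ p → p < j → (u2.tape .work p = true ↔ slt t (a + e) p)) ∧
      u2.head .output = (j + 1) / d * w ∧ u2.head .input = j * cl ∧ τ2 ≤ τ1 + 12) ?_ ?_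
    · have hupd : ∀ r ≤ e + 1, Function.update (u.arr .GAP) (F j) (gap F (j + 1) n (F j) + 1) r =
          gap F j n r := fun r hr => by
        rw [hgap' r, Function.update_apply]
        split_ifs with h1 h2 h2
        · rw [h1]
        · exact absurd h1.symm h2
        · exact absurd h2.symm h1
        · exact I5 r hr
      have htape : ∀ v : Bool, (v = true ↔ slt t a j) →
          (∀ p, j ≤ p → p < n → (Function.update (u.tape .work) j v p = true ↔ slt t a p)) ∧
          (∀ p, a + e ≤ p → p < j →
            (Function.update (u.tape .work) j v p = true ↔ slt t (a + e) p)) := by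
        intro v hv
        refine ⟨fun p hp hpn => ?_, fun p hp hpj => ?_⟩
        · rcases (by omega : p = j ∨ j + 1 ≤ p) with rfl | h
          · simpa using hv
          · rw [Function.update_of_ne (by omega)]; exact I6 p h hpn
        · rw [Function.update_of_ne (by omega)]; exact I7 p hp (by omega)
      have hG := I5 (F j) hFj'
      simp only [wp_seq_iff, wp_moveLeft_iff, wp_read_iff, wp_load_iff, wp_assign_iff, wp_ite_iff,
        wp_store_iff, wp_write_iff, St.moveTo_head, St.moveTo_tape, St.moveTo_reg, St.moveTo_arr,
        St.set_reg, St.set_tape, St.set_head, St.set_arr, St.setArr_reg, St.setArr_arr,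
        St.setArr_tape, St.setArr_head, St.setBit_reg, St.setBit_arr, St.setBit_tape,
        St.setBit_head, Function.update_self, a2, a5, a6, a8, a9, a10, a11, a12, g1, g2,
        Nat.add_sub_cancel, hbit, hocc', hG, Ex.ok_add, Ex.ok_mul, Ex.ok_var, Ex.ok_ofNat,
        Ex.val_add, Ex.val_mul, Ex.val_var, Ex.val_ofNat, Cn.ok_lt, Cn.holds_lt, ne_eq,
        reduceCtorEq, not_false_eq_true, Function.update_of_ne, true_and, and_assoc, ← hstep]
      refine ⟨by omega, by omega, by omega, by omega, by omega, by omega, by omega, by omega,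
        by omega, by omega, by omega, by omega, fun h => ?_, fun h => ?_⟩
      · obtain ⟨b1, b2⟩ := htape true (by simpa using hgt.2 h)
        exact ⟨by omega, by omega, hupd, b1, b2, by omega⟩
      · obtain ⟨b1, b2⟩ := htape false (by simpa using fun h' => h (hgt.1 h'))
        exact ⟨by omega, by omega, hupd, b1, b2, by omega⟩
    rintro u2 τ2 ⟨k1, k2, k3, k4, k5, k6, k7, k8, k9⟩ hf
    have c1 : u2.reg .i = i := (hf.reg .i rfl).trans a1
    have c2 : u2.reg .d = d := (hf.reg .d rfl).trans a3
    have c3 : u2.reg .w = w := (hf.reg .w rfl).trans a4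
    have c4 : u2.reg .j = j := (hf.reg .j rfl).trans a7
    have c5 : u2.tape .output = u.tape .output := by rw [hf.tape .output rfl, a12]
    clear hf
    refine wp_mono (wp_frame (putSlot_wp (a := a) (b := a + e) (t := t) c4 c2 c3 k1 hjn hnW hwW
      hW hd0 k7 hs3
      (by rw [c5]; exact I8) fun hdvd => ?_)) ?_
    · rw [← hcnt]; exact slotVal_add hjb hjn hdvd
    · rintro u3 τ3 ⟨⟨m1, m2, m3⟩, hf⟩
      have d1 : u3.reg .i = i := (hf.reg .i rfl).trans c1
      have d2 : u3.reg .rk = F j := (hf.reg .rk rfl).trans k2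
      have d3 : u3.arr .GAP = u2.arr .GAP := hf.arr .GAP rfl
      have d4 : u3.tape .work = u2.tape .work := hf.tape .work rfl
      have d5 : u3.head .work = j := (hf.head .work rfl).trans k3
      have d6 : u3.head .input = j * cl := (hf.head .input rfl).trans k8
      clear hf
      have hiW : i + 1 < Γ.W := by clear * - hi hae hnW; omega
      have hm1 : (7 * w + 4) * ((j + 1) / d) ≤ (7 * w + 4) * (n / d) :=
        Nat.mul_le_mul_left _ (Nat.div_le_div_right hjn)
      have hm2 : (7 * w + 4) * (j / d) ≤ (7 * w + 4) * ((j + 1) / d) :=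
        Nat.mul_le_mul_left _ (Nat.div_le_div_right (by omega))
      simp only [wp_assign_iff, Ex.ok_add, Ex.ok_var, Ex.ok_ofNat, Ex.val_add, Ex.val_var,
        Ex.val_ofNat, d1, St.set_reg, St.set_arr, St.set_tape, St.set_head, Function.update_self,
        ne_eq, reduceCtorEq, not_false_eq_true, Function.update_of_ne, d2, d3, d4, d5, d6, m1,
        true_and, and_assoc]
      refine ⟨by clear * - hW; omega, hiW, k4, k5, k6, m2, ?_⟩
      rw [Nat.mul_succ]
      exact time_step g3 k9 m3 hm1 hm2
  · rintro u τ' ⟨⟨h1, h2, h3, -, h4, h5, -, h6⟩, -, h7⟩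
    rw [show n - (n - (a + e)) = a + e by omega] at *
    refine ⟨h4, h5, h6, h1, h2, h3, ?_⟩
    have h8 : (6 * cl + 40) * (n - (a + e)) ≤ (6 * cl + 40) * n :=
      Nat.mul_le_mul_left _ (by omega)
    simp only [Nat.mul_zero, Nat.sub_zero, Nat.sub_self] at h7
    omega

end ExtMem

/-! ### Completing a block: ranks of its own suffixes and comparisons for the next one -/

namespace ExtMem

open SuffixIndex

/-- Replace the counts in `GAP` by their prefix sums. -/
def sumGaps : Prog :=
  .f ::= 0 ;; .r ::= 0 ;; .upTo .r Var.N (.load .y .GAP Var.r ;; .f ::= Var.f + Var.y ;;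
    .store .GAP Var.r Var.f)

theorem sumGaps_wp {Γ : Env} {s : St} {τ e b n : ℕ} {F : ℕ → ℕ} (hN : s.reg .N = e + 1)
    (hL : e + 1 ≤ Γ.L) (hLW : Γ.L < Γ.W) (hnW : n < Γ.W)
    (hG : ∀ r ≤ e + 1, s.arr .GAP r = gap F b n r) :
    wp Γ sumGaps (fun t τ' => (∀ r ≤ e, t.arr .GAP r = cumGap F b n (r + 1)) ∧
      τ' ≤ τ + 5 * (e + 1) + 10) s τ := by
  unfold sumGaps
  refine wp_seq_iff.2 (wp_assign_iff.2 ⟨by simp; omega, ?_⟩)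
  refine wp_mono (wp_for (fun i t => t.reg .f = cumGap F b n i ∧
    (∀ r < i, t.arr .GAP r = cumGap F b n (r + 1)) ∧
    ∀ r ≤ e + 1, i ≤ r → t.arr .GAP r = gap F b n r) 4 (e + 1) (by omega) ?_ ?_ ?_) ?_
  · simp [cumGap_zero]
    exact hG
  · intro t hf
    refine ⟨trivial, ?_⟩
    simpa [hN] using hf.reg .N rfl
  · rintro i t τ' hf hi ⟨I1, I2, I3⟩ hx
    have h1 := I3 i (by omega) le_rfl
    have h2 := cumGap_succ F b n i
    have h3 := cumGap_le F b n (i + 1)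
    simp [hx, h1, I1, and_assoc, ← h2]
    repeat refine ⟨by omega, ?_⟩
    refine ⟨fun r hr => ?_, fun r hr hir => ?_⟩
    · rcases (by omega : r = i ∨ r < i) with rfl | hr
      · simp
      · rw [Function.update_of_ne (by omega), I2 r hr]
    · rw [Function.update_of_ne (by omega), I3 r hr (by omega)]
  · rintro t τ' ⟨⟨-, h1, -⟩, -, h2⟩
    exact ⟨fun r hr => h1 r (by omega), by omega⟩

/-- Store in `G` which suffixes are smaller than the one at the start of the block. -/
def compareFirst : Prog :=
  .k ::= 0 ;; .upTo .k Var.N (.load .y .RK Var.k ;;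
    .ite (.lt Var.y Var.g) (.store .G Var.k 1) (.store .G Var.k 0))

/-- For the next block, `a` is the position just behind it, so `G` has to hold comparisons with
suffix `a`; the ranks of the current block contain them. -/
theorem compareFirst_wp {Γ : Env} {s : St} {τ e : ℕ} {R : ℕ → ℕ} (hN : s.reg .N = e + 1)
    (hg : s.reg .g = R 0) (hL : e + 1 ≤ Γ.L) (hLW : Γ.L < Γ.W) (hR : s.arr .RK = R) :
    wp Γ compareFirst (fun t τ' => (∀ k ≤ e, (t.arr .G k = 1 ∧ R k < R 0) ∨
      (t.arr .G k = 0 ∧ ¬ R k < R 0)) ∧ τ' ≤ τ + 5 * (e + 1) + 10) s τ := by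
  refine wp_mono (wp_for (fun i t => ∀ k < i, (t.arr .G k = 1 ∧ R k < R 0) ∨
      (t.arr .G k = 0 ∧ ¬ R k < R 0)) 4 (e + 1) (by omega) (by simp) ?_ ?_) ?_
  · intro t hf
    refine ⟨trivial, ?_⟩
    simpa [hN] using hf.reg .N rfl
  · intro i t τ' hf hi hI hx
    have e1 : t.reg .g = R 0 := by rw [hf.reg .g rfl]; simpa using hg
    have e2 : t.arr .RK = R := by rw [hf.arr .RK rfl]; simpa using hR
    have hu : ∀ v, ((v = 1 ∧ R i < R 0) ∨ (v = 0 ∧ ¬ R i < R 0)) → ∀ k < i + 1,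
        (Function.update (t.arr .G) i v k = 1 ∧ R k < R 0) ∨
        (Function.update (t.arr .G) i v k = 0 ∧ ¬ R k < R 0) := by
      intro v hv k hk
      rcases (by omega : k = i ∨ k < i) with rfl | hk
      · simpa using hv
      · rw [Function.update_of_ne (by omega)]; exact hI k hk
    simp only [wp_seq_iff, wp_load_iff, wp_assign_iff, wp_ite_iff, wp_store_iff, St.set_reg,
      St.set_arr, St.setArr_reg, St.setArr_arr, Function.update_self, e1, e2, hx, Ex.ok_var,
      Ex.val_var, Ex.ok_ofNat, Ex.val_ofNat, Ex.ok_add, Ex.val_add, Cn.ok_lt, Cn.holds_lt, ne_eq,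
      reduceCtorEq, not_false_eq_true, Function.update_of_ne, true_and, and_assoc]
    refine ⟨by omega, fun h => ?_, fun h => ?_⟩
    · exact ⟨by omega, by omega, by omega, by omega, hu 1 (.inl ⟨rfl, h⟩), by omega⟩
    · exact ⟨by omega, by omega, by omega, by omega, hu 0 (.inr ⟨rfl, h⟩), by omega⟩
  · rintro t τ' ⟨h1, -, h2⟩
    exact ⟨fun k hk => h1 k (by omega), by omega⟩

/-- A later suffix `p` is below suffix `a + i` exactly if suffix `a + i` is not among those below
`p`, that is, if at most `R i` sorted suffixes are below `p`. Summing the gap counts up to and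
including `R i` counts these `p`. -/
theorem cumGap_eq_cnt {σ n a e i : ℕ} {t R : ℕ → ℕ} (ht : Text σ n t) (hae : a + e ≤ n)
    (hR : IsRank (fun i j => slt t (a + i) (a + j)) (e + 1) R) (hi : i < e) :
    cumGap (cnt t a (e + 1)) (a + e) n (R i + 1) = cnt t (a + e) (n - (a + e)) (a + i) := by
  classical
  have ht' : Total (fun i j => slt t (a + i) (a + j)) (e + 1) := fun i j hi hj hij =>
    ht.total (by omega) (by omega) (by omega)
  rw [cnt_eq_card_Ico, cumGap]
  congr 1
  ext p
  simp only [Finset.mem_filter, Finset.mem_Ico]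
  refine and_congr_right fun hp => ?_
  have h1 := slt_iff_lt_cnt hR ht' (show i < e + 1 by omega) p
  have h2 := ht.total (show a + i ≤ n by omega) (show p ≤ n by omega) (by omega)
  constructor
  · intro h
    exact h2.resolve_left fun h3 => by have := h1.1 h3; omega
  · intro h
    by_contra h3
    exact slt_asymm h (h1.2 (by omega))

/-- `R` also counts the suffix at `a + e`, which is no block suffix: it is counted with the rest of
the text, or is empty. Removing it when it is smaller, and adding the 1 from which positions are
counted, amounts to adding 1 only when it is not smaller. -/
theorem slotVal_block {σ n d a e i u : ℕ} {t R : ℕ → ℕ} (ht : Text σ n t) (hae : a + e ≤ n)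
    (hR : IsRank (fun i j => slt t (a + i) (a + j)) (e + 1) R) (hi : i < e)
    (hd : d ∣ a + i + 1)
    (hu : u = R i + cnt t (a + e) (n - (a + e)) (a + i) + if R e < R i then 0 else 1) :
    u + slotVal t n d (a + e) ((a + i) / d) = slotVal t n d a ((a + i) / d) := by
  classical
  have ht' : Total (fun i j => slt t (a + i) (a + j)) (e + 1) := fun i j hi hj hij =>
    ht.total (by omega) (by omega) (by omega)
  rw [slotVal_of_dvd hd, slotVal_of_dvd hd, if_pos (by omega), if_neg (by omega), hu,
    show n - a = e + (n - (a + e)) by omega, cnt_add]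
  have h1 := rank_eq_cnt hR ht' (show i < e + 1 by omega)
  have h2 := hR.iff e i (by omega) (by omega)
  rw [cnt_succ] at h1
  split_ifs at h1 ⊢ with h3 h4 h4
  · omega
  · exact absurd (h2.1 h3) h4
  · exact absurd (h2.2 h4) h3
  · omega

/-- Scan the block: store the positions of its suffixes. -/
def finish (cl : ℕ) : Prog :=
  .i ::= 0 ;; .upTo .i Var.el (.j ::= Var.b - 1 - Var.i ;; movesLeft .input (.lit cl) ;;
    (.move .work .toLeft ;; .load .rk .RK (Var.el - 1 - Var.i) ;;
      .ite (.lt Var.g Var.rk) (.write .work 1) (.write .work 0) ;; .load .y .GAP Var.rk ;;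
      .load .v .RK Var.el ;; .u ::= Var.rk + Var.y ;;
      .ite (.lt Var.v Var.rk) .skip (.u ::= Var.u + 1)) ;; putSlot)

theorem finish_time {τ τ₁ τ₂ τ₃ c A X Y Z : ℕ} (h₁ : τ₁ ≤ τ + 1 + 3 * c + 2) (h₂ : τ₂ ≤ τ₁ + 12)
    (h₃ : τ₃ + Y ≤ τ₂ + X + 2) (hXZ : X ≤ Z) (hYX : Y ≤ X) :
    τ₃ + 1 + 1 + (A + (Z - X)) ≤ τ + (A + (3 * c + 40) + (Z - Y)) := by
  omega

set_option maxHeartbeats 400000 in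
-- Inside the block no search is needed: the ranks `R` give the new bits, and together with the
-- summed gap counts they give the values of the slots, which are still zero.
theorem finish_wp {Γ : Env} {s : St} {τ σ n d w cl a e : ℕ} {t R : ℕ → ℕ} (ht : Text σ n t)
    (hd : s.reg .d = d) (hw : s.reg .w = w) (hb : s.reg .b = a + e) (hel : s.reg .el = e)
    (hg : s.reg .g = R 0) (hRK : s.arr .RK = R) (hae : a + e ≤ n) (hnW : n < Γ.W)
    (hwW : w < Γ.W) (hW : 2 < Γ.W) (hd0 : 0 < d) (hclW : cl < Γ.W)
    (hLW : Γ.L < Γ.W) (hL : e + 2 ≤ Γ.L)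
    (hR : IsRank (fun i j => slt t (a + i) (a + j)) (e + 1) R) (hs2 : n ≤ Γ.size .work)
    (hs3 : n / d * w ≤ Γ.size .output) (h1 : s.head .input = (a + e) * cl)
    (h2 : s.head .work = a + e) (h3 : s.head .output = (a + e) / d * w)
    (hgap : ∀ r ≤ e, s.arr .GAP r = cumGap (cnt t a (e + 1)) (a + e) n (r + 1))
    (hwork : ∀ p, a + e ≤ p → p < n → (s.tape .work p = true ↔ slt t a p))
    (hslots : Slots t n d w a (a + e) (a + e) (s.tape .output)) :
    wp Γ (finish cl) (fun s' τ' =>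
      (∀ p, a ≤ p → p < n → (s'.tape .work p = true ↔ slt t a p)) ∧
      Slots t n d w a (a + e) a (s'.tape .output) ∧ s'.head .input = a * cl ∧
      s'.head .work = a ∧ s'.head .output = a / d * w ∧
      τ' ≤ τ + (3 * cl + 40) * n + (7 * w + 4) * (n / d) + 10) s τ := by
  classical
  have ht' : Total (fun i j => slt t (a + i) (a + j)) (e + 1) := fun i j hi hj hij =>
    ht.total (by omega) (by omega) (by omega)
  unfold finish
  refine wp_seq_iff.2 (wp_assign_iff.2 ⟨by simp; omega, ?_⟩)
  refine wp_mono (wp_upTo (fun i u => u.head .input = (a + e - i) * cl ∧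
    u.head .work = a + e - i ∧ u.head .output = (a + e - i) / d * w ∧
    (∀ p, a + e - i ≤ p → p < n → (u.tape .work p = true ↔ slt t a p)) ∧
    Slots t n d w a (a + e) (a + e - i) (u.tape .output))
    (fun i => (3 * cl + 40) * i + ((7 * w + 4) * (n / d) - (7 * w + 4) * ((a + e - i) / d)))
    0 e (by simp) (by omega) ?_ ?_ ?_) ?_
  · simpa using ⟨h1, h2, h3, hwork, hslots⟩
  · intro u hf
    refine ⟨trivial, ?_⟩
    simpa [hel] using hf.reg .el rfl
  · rintro i u τ' hf - hi ⟨I1, I2, I3, I6, I8⟩ hx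
    have e1 : u.reg .b = a + e := by rw [hf.reg .b rfl]; simpa using hb
    have e2 : u.reg .el = e := by rw [hf.reg .el rfl]; simpa using hel
    have e3 : u.reg .d = d := by rw [hf.reg .d rfl]; simpa using hd
    have e4 : u.reg .w = w := by rw [hf.reg .w rfl]; simpa using hw
    have e5 : u.reg .g = R 0 := by rw [hf.reg .g rfl]; simpa using hg
    have e6 : u.arr .GAP = s.arr .GAP := by rw [hf.arr .GAP rfl]; simp
    have e7 : u.arr .RK = R := by rw [hf.arr .RK rfl]; simpa using hRK
    clear hf
    obtain ⟨k, hk⟩ : ∃ k, e - 1 - i = k := ⟨_, rfl⟩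
    have hke : k < e := by omega
    have hj : a + e - i = a + k + 1 := by omega
    have hj' : a + e - (i + 1) = a + k := by omega
    have hjn : a + k < n := by omega
    rw [hj] at I1 I2 I3 I6 I8
    rw [hj, hj']
    have hle : (a + k + 1) * cl = (a + k) * cl + cl := Nat.succ_mul _ _
    have hRk := hR.lt_len k (by omega)
    have hRe := hR.lt_len e (by omega)
    have hG : s.arr .GAP (R k) = cnt t (a + e) (n - (a + e)) (a + k) := by
      rw [hgap _ (by omega), cumGap_eq_cnt ht hae hR hke]
    have hcl' := cnt_le t (a + e) (n - (a + e)) (a + k)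
    have hgt : slt t a (a + k) ↔ R 0 < R k := (hR.iff 0 k (by omega) (by omega)).symm
    have hval := fun hdvd u hu => slotVal_block (u := u) (d := d) ht hae hR hke hdvd hu
    obtain ⟨v, hv⟩ : ∃ v, cnt t (a + e) (n - (a + e)) (a + k) = v := ⟨_, rfl⟩
    rw [hv] at hG hcl' hval
    refine wp_seq_iff.2 (wp_seq_iff.2 (wp_assign_iff.2 ⟨by simp [e1, hx]; omega, ?_⟩))
    refine wp_seq (movesLeft_wp (H := cl) hclW (fun u _ => ⟨hclW, rfl⟩)
      (by rw [St.set_head, I1]; omega)) ?_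
    rintro u1 τ1 ⟨g1, g2⟩ hf
    have a1 : u1.reg .i = i := (hf.reg .i rfl).trans (by simpa using hx)
    have a2 : u1.reg .el = e := (hf.reg .el rfl).trans (by simpa using e2)
    have a3 : u1.reg .d = d := (hf.reg .d rfl).trans (by simpa using e3)
    have a4 : u1.reg .w = w := (hf.reg .w rfl).trans (by simpa using e4)
    have a5 : u1.reg .g = R 0 := (hf.reg .g rfl).trans (by simpa using e5)
    have a6 : u1.arr .GAP = s.arr .GAP := (hf.arr .GAP rfl).trans (by simpa using e6)
    have a7 : u1.reg .j = a + k := (hf.reg .j rfl).trans (by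
      simp [e1, hx]; clear * - hj; omega)
    have a8 : u1.head .work = a + k + 1 := (hf.head .work rfl).trans (by simpa using I2)
    have a9 : u1.head .output = (a + k + 1) / d * w :=
      (hf.head .output rfl).trans (by simpa using I3)
    have a11 : u1.arr .RK = R := (hf.arr .RK rfl).trans (by simpa using e7)
    have a12 : u1.tape = u.tape := by
      funext k
      exact (hf.tape k (by cases k <;> rfl)).trans (by simp)
    rw [St.set_head, I1, hle, Nat.add_sub_cancel] at g1
    clear hf
    refine wp_seq (P := fun u2 τ2 =>
      (d ∣ a + k + 1 → u2.reg .u + slotVal t n d (a + e) ((a + k) / d) =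
        slotVal t n d a ((a + k) / d)) ∧ u2.head .work = a + k ∧
      (∀ p, a + k ≤ p → p < n → (u2.tape .work p = true ↔ slt t a p)) ∧
      u2.head .output = (a + k + 1) / d * w ∧ u2.head .input = (a + k) * cl ∧ τ2 ≤ τ1 + 12) ?_ ?_
    · have htape : ∀ v : Bool, (v = true ↔ slt t a (a + k)) →
          ∀ p, a + k ≤ p → p < n →
            (Function.update (u.tape .work) (a + k) v p = true ↔ slt t a p) := by
        intro v hv p hp hpn
        rcases (by omega : p = a + k ∨ a + k + 1 ≤ p) with rfl | h
        · simpa using hv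
        · rw [Function.update_of_ne (by omega)]; exact I6 p h hpn
      simp only [wp_seq_iff, wp_moveLeft_iff, wp_load_iff, wp_assign_iff, wp_ite_iff,
        wp_write_iff, wp_skip_iff, St.moveTo_head, St.moveTo_tape, St.moveTo_reg, St.moveTo_arr,
        St.set_reg, St.set_tape, St.set_head, St.set_arr, St.setBit_reg, St.setBit_arr,
        St.setBit_tape, St.setBit_head, Function.update_self, a1, a2, a5, a6, a8, a9, a11, a12, g1,
        Nat.add_sub_cancel, hG, Ex.ok_add, Ex.ok_sub, Ex.ok_var, Ex.ok_ofNat, hk,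
        Ex.val_add, Ex.val_sub, Ex.val_var, Ex.val_ofNat, Cn.ok_lt, Cn.holds_lt, ne_eq,
        reduceCtorEq, not_false_eq_true, Function.update_of_ne, true_and, and_assoc]
      have fin : ∀ b : Bool, (b = true ↔ slt t a (a + k)) → ∀ τ2, τ2 ≤ τ1 + 6 →
          R k < Γ.L ∧ e < Γ.L ∧ R k + v < Γ.W ∧
          (R e < R k → (d ∣ a + k + 1 → R k + v + slotVal t n d (a + e) ((a + k) / d) =
            slotVal t n d a ((a + k) / d)) ∧
            (∀ p, a + k ≤ p → p < n →
              (Function.update (u.tape .work) (a + k) b p = true ↔ slt t a p)) ∧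
            τ2 + 1 + 1 + 1 + 1 + 1 ≤ τ1 + 12) ∧
          (¬ R e < R k → 1 < Γ.W ∧ R k + v + 1 < Γ.W ∧
            (d ∣ a + k + 1 → R k + v + 1 + slotVal t n d (a + e) ((a + k) / d) =
            slotVal t n d a ((a + k) / d)) ∧
            (∀ p, a + k ≤ p → p < n →
              (Function.update (u.tape .work) (a + k) b p = true ↔ slt t a p)) ∧
            τ2 + 1 + 1 + 1 + 1 + 1 ≤ τ1 + 12) := by
        intro b hb τ2 hτ2
        have hke' : R k ≠ R e := fun h => by
          have := hR.inj ht' (show k < e + 1 by omega) (show e < e + 1 by omega) h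
          omega
        refine ⟨by omega, by omega, by omega, fun h => ⟨fun hdvd => ?_, htape b hb, by omega⟩,
          fun h => ⟨by omega, by omega, fun hdvd => ?_, htape b hb, by omega⟩⟩
        · exact hval hdvd _ (by rw [if_pos h]; rfl)
        · exact hval hdvd _ (by rw [if_neg h])
      refine ⟨by omega, by omega, by omega, by omega, by omega, by omega, by omega, fun h => ?_,
          fun h => ?_⟩
      · refine ⟨by omega, by omega, fin true (by simpa using hgt.2 h) _ (by omega)⟩
      · refine ⟨by omega, by omega, fin false (by simpa using fun h' => h (hgt.1 h')) _ (by omega)⟩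
    rintro u2 τ2 ⟨k1, k3, k5, k7, k8, k9⟩ hf
    have c1 : u2.reg .i = i := (hf.reg .i rfl).trans a1
    have c2 : u2.reg .d = d := (hf.reg .d rfl).trans a3
    have c3 : u2.reg .w = w := (hf.reg .w rfl).trans a4
    have c4 : u2.reg .j = a + k := (hf.reg .j rfl).trans a7
    have c5 : u2.tape .output = u.tape .output := by rw [hf.tape .output rfl, a12]
    clear hf
    refine wp_mono (wp_frame (putSlot_wp (a := a) (b := a + e) (t := t) c4 c2 c3 rfl hjn hnW hwW
      hW hd0 k7 hs3 (by rw [c5]; exact I8) k1)) ?_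
    rintro u3 τ3 ⟨⟨m1, m2, m3⟩, hf⟩
    have d1 : u3.reg .i = i := (hf.reg .i rfl).trans c1
    have d4 : u3.tape .work = u2.tape .work := hf.tape .work rfl
    have d5 : u3.head .work = a + k := (hf.head .work rfl).trans k3
    have d6 : u3.head .input = (a + k) * cl := (hf.head .input rfl).trans k8
    clear hf
    have hiW : i + 1 < Γ.W := by clear * - hi hae hnW; omega
    have hm1 : (7 * w + 4) * ((a + k + 1) / d) ≤ (7 * w + 4) * (n / d) :=
      Nat.mul_le_mul_left _ (Nat.div_le_div_right hjn)
    have hm2 : (7 * w + 4) * ((a + k) / d) ≤ (7 * w + 4) * ((a + k + 1) / d) :=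
      Nat.mul_le_mul_left _ (Nat.div_le_div_right (Nat.le_succ _))
    simp only [wp_assign_iff, Ex.ok_add, Ex.ok_var, Ex.ok_ofNat, Ex.val_add, Ex.val_var,
      Ex.val_ofNat, d1, St.set_reg, St.set_tape, St.set_head, Function.update_self,
      d4, d5, d6, m1,
      true_and, and_assoc]
    refine ⟨by clear * - hW; omega, hiW, k5, m2, ?_⟩
    rw [Nat.mul_succ]
    exact finish_time g2 k9 m3 hm1 hm2
  · rintro u τ' ⟨⟨h1, h2, h3, h5, h6⟩, -, h7⟩
    rw [Nat.add_sub_cancel] at *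
    refine ⟨h5, h6, h1, h2, h3, ?_⟩
    have h8 : (3 * cl + 40) * e ≤ (3 * cl + 40) * n := Nat.mul_le_mul_left _ (by omega)
    have h9 : (7 * w + 4) * ((a + e) / d) ≤ (7 * w + 4) * (n / d) :=
      Nat.mul_le_mul_left _ (Nat.div_le_div_right hae)
    simp only [Nat.mul_zero, Nat.sub_zero] at h7
    clear * - h7 h8 h9
    omega

end ExtMem

namespace ExtMem

open SuffixIndex

/-! ## The main loop -/

/-- What has to fit into words, memory and disks to process blocks of `m` characters. -/
structure Fits (Γ : Env) (σ cl n d w m : ℕ) : Prop where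
  m_pos : 0 < m
  m_le : m ≤ n
  d_pos : 0 < d
  n_lt : n < Γ.W
  w_lt : w < Γ.W
  two_lt : 2 < Γ.W
  cl_lt : 2 ^ cl < Γ.W
  L_lt : Γ.L < Γ.W
  L_ge : (3 * σ + 50) * m ≤ Γ.L
  input : n * cl ≤ Γ.size .input
  output : n / d * w ≤ Γ.size .output
  work : n ≤ Γ.size .work

/-- The registers that hold the parameters. -/
structure Params (s : St) (n d w m : ℕ) : Prop where
  n : s.reg .n = n
  d : s.reg .d = d
  w : s.reg .w = w
  m : s.reg .m = m

/-- The text from the position `b` on has been processed. -/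
structure Done (cl n d w m : ℕ) (t : ℕ → ℕ) (b : ℕ) (s : St) : Prop where
  input : s.head .input = b * cl
  work : s.head .work = b
  output : s.head .output = b / d * w
  bits : ∀ p, b ≤ p → p < n → (s.tape .work p = true ↔ slt t b p)
  slots : ∀ q, (q + 1) * d ≤ n → HoldsWord w (s.tape .output) q (slotVal t n d b q)
  next : 0 < b → ∀ k < m, s.arr .U (m + k) = t (b + k)
  less : 0 < b → ∀ k ≤ m, (s.arr .G k = 1 ∧ slt t (b + k) b) ∨
    (s.arr .G k = 0 ∧ ¬ slt t (b + k) b)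

/-- Process the block of `el` characters at the position `a`. -/
def blockPass (σ cl : ℕ) : Prog :=
  readBlock cl ;; goRight cl ;; sortBlock σ ;; occTable σ ;; .load .g .RK 0 ;; scan cl ;;
    sumGaps ;; finish cl ;; compareFirst

/-- The bound for one block: `cl` accounts for moving over characters, `σ` for sorting and the
tables, and the last term for the slots. The length of the block has been replaced by the bound `n`.
-/
def passTime (σ cl n d w : ℕ) : ℕ := (18 * cl + 5200 * (σ + 4) + 1000) * n + 20 * (w + 1) * (n / d)

theorem passTime_eq (σ cl n d w : ℕ) : passTime σ cl n d w = 18 * (cl * n) + 5200 * (σ * n) +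
    21800 * n + 20 * (w * (n / d)) + 20 * (n / d) := by
  unfold passTime
  ring

theorem passTime_bound {σ cl n d w m e τ₁ τ₂ τ₃ τ₄ τ₅ τ₆ τ₇ τ₈ τ : ℕ} (hm : 0 < m) (hmn : m ≤ n)
    (hem : e ≤ m) (h₁ : τ₁ ≤ τ + (6 * cl + 14) * m + 10)
    (h₂ : τ₂ ≤ τ₁ + (3 * cl + 8) * n + (n / d) * (3 * w + 4) + 10)
    (h₃ : τ₃ ≤ τ₂ + 5000 * (σ + 4) * m) (h₄ : τ₄ ≤ τ₃ + 30 * (σ + 1) * (e + 2))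
    (h₅ : τ₅ ≤ τ₄ + 1 + (6 * cl + 40) * n + (7 * w + 4) * (n / d) + 10)
    (h₆ : τ₆ ≤ τ₅ + 5 * (e + 1) + 10)
    (h₇ : τ₇ ≤ τ₆ + (3 * cl + 40) * n + (7 * w + 4) * (n / d) + 10)
    (h₈ : τ₈ ≤ τ₇ + 5 * (e + 1) + 10) : τ₈ + 20 ≤ τ + passTime σ cl n d w := by
  have g₁ : (6 * cl + 14) * m ≤ 6 * (cl * n) + 14 * n := by
    rw [← Nat.mul_assoc, ← Nat.add_mul]; exact Nat.mul_le_mul_left _ hmn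
  have g₂ : (3 * cl + 8) * n = 3 * (cl * n) + 8 * n := by ring
  have g₃ : 5000 * (σ + 4) * m ≤ 5000 * (σ * n) + 20000 * n := by
    rw [show 5000 * (σ * n) + 20000 * n = 5000 * (σ + 4) * n by ring]
    exact Nat.mul_le_mul_left _ hmn
  have g₄ : 30 * (σ + 1) * (e + 2) ≤ 90 * (σ * n) + 90 * n := by
    rw [show 90 * (σ * n) + 90 * n = 30 * (σ + 1) * (3 * n) by ring]
    exact Nat.mul_le_mul_left _ (by omega)
  have g₅ : (6 * cl + 40) * n = 6 * (cl * n) + 40 * n := by ring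
  have g₆ : (3 * cl + 40) * n = 3 * (cl * n) + 40 * n := by ring
  have g₇ : (7 * w + 4) * (n / d) = 7 * (w * (n / d)) + 4 * (n / d) := by ring
  have g₈ : (n / d) * (3 * w + 4) = 3 * (w * (n / d)) + 4 * (n / d) := by ring
  rw [passTime_eq]
  generalize cl * n = A at *
  generalize σ * n = B at *
  generalize w * (n / d) = D at *
  generalize n / d = E at *
  omega

/-- The block is read leftwards, the heads return to the end of the text, and the scans go leftwards
again. Each of the two reversals costs at most three passes; the next block continues in the same
direction. The 20 spare time units pay for the control of the outer loop. -/
theorem blockPass_wp {Γ : Env} {s : St} {τ σ n d w m cl a e : ℕ} {t : ℕ → ℕ} (ht : Text σ n t)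
    (hσ : σ < Γ.W) (hF : Fits Γ σ cl n d w m) (hp : Params s n d w m) (ha : s.reg .a = a)
    (hb : s.reg .b = a + e) (hel : s.reg .el = e) (he : 0 < e) (hem : e ≤ m) (hae : a + e ≤ n)
    (hem' : 0 < a → e = m) (hT : Encoded cl n t (s.tape .input))
    (hs : Done cl n d w m t (a + e) s) :
    wp Γ (blockPass σ cl) (fun s' τ' => Done cl n d w m t a s' ∧
      s'.phi .toLeft ≤ s.phi .toLeft + 6 ∧
      τ' + 20 ≤ τ + passTime σ cl n d w) s τ := by
  have hLm := hF.L_ge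
  have hm0 := hF.m_pos
  have hmn := hF.m_le
  have hL₁ : 8 * m + σ + 22 ≤ Γ.L := by nlinarith
  have hL₂ : 2 * m + (σ + 1) * (e + 2) + 2 ≤ Γ.L := by
    have : (σ + 1) * (e + 2) ≤ (σ + 1) * (3 * m) := Nat.mul_le_mul_left _ (by omega)
    nlinarith
  have hL₃ : σ * (e + 2) ≤ Γ.L := by rw [Nat.succ_mul σ] at hL₂; omega
  have hL₄ : e + 2 ≤ Γ.L := by omega
  have hclW : cl < Γ.W := lt_trans Nat.lt_two_pow_self hF.cl_lt
  unfold blockPass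
  refine wp_seq (readBlock_wp ht hT hF.cl_lt hp.m hel hem hae (by omega) hF.L_lt
    (hs.next (by omega)) hs.input hF.input) ?_
  rintro s₁ τ₁ ⟨b1, b2, b3, b4⟩ f₁
  refine wp_seq (goRight_wp ((f₁.reg .n rfl).trans hp.n) ((f₁.reg .d rfl).trans hp.d)
    ((f₁.reg .w rfl).trans hp.w) ((f₁.reg .a rfl).trans ha) ((f₁.reg .b rfl).trans hb) (by omega)
    hae hF.n_lt hclW hF.w_lt b3 ((f₁.head .work rfl).trans hs.work)
    ((f₁.head .output rfl).trans hs.output) hF.input hF.work hF.output) ?_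
  rintro s₂ τ₂ ⟨c1, c2, c3, c4⟩ f₂
  have hU₂ : s₂.arr .U = s₁.arr .U := f₂.arr .U rfl
  have hG₂ : s₂.arr .G = s.arr .G := (f₂.arr .G rfl).trans (f₁.arr .G rfl)
  refine wp_seq (sortBlock_wp ht ((f₂.reg .m rfl).trans ((f₁.reg .m rfl).trans hp.m))
    ((f₂.reg .el rfl).trans ((f₁.reg .el rfl).trans hel)) he hem hae hL₁ hF.L_lt
    (by rw [hU₂]; exact b1) (by rw [hU₂]; exact b2) (by rw [hG₂]; exact hs.less (by omega))) ?_
  rintro s₃ τ₃ ⟨d1, d2, d3⟩ f₃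
  have hU₃ : s₃.arr .U = s₁.arr .U := (f₃.arr .U rfl).trans hU₂
  have f₃' := (f₁.seq f₂).seq f₃
  refine wp_seq (occTable_wp ht ((f₃'.reg .m rfl).trans hp.m) ((f₃'.reg .el rfl).trans hel)
    d1 hem hae
    hL₂ hF.L_lt hσ d2 (by rw [hU₃]; exact b2)) ?_
  rintro s₄ τ₄ ⟨e1, e2, e3⟩ f₄
  have hR₄ : s₄.arr .RK = s₃.arr .RK := f₄.arr .RK rfl
  have f₄' := f₃'.seq f₄
  refine wp_seq_iff.2 (wp_load_iff.2 ⟨by simp; omega, by simp; omega, ?_⟩)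
  simp only [Ex.val_ofNat, hR₄]
  obtain ⟨R, hR⟩ : ∃ R, s₃.arr .RK = R := ⟨_, rfl⟩
  rw [hR] at d2 e2 hR₄ ⊢
  have h4i : s₄.tape .input = s.tape .input := f₄'.tape .input rfl
  have h4w : s₄.tape .work = s.tape .work := f₄'.tape .work rfl
  have h4o : s₄.tape .output = s.tape .output := f₄'.tape .output rfl
  have hN₄ : s₄.reg .N = e + 1 := (f₄.reg .N rfl).trans d1
  have hb₄ : s₄.reg .b = a + e := (f₄'.reg .b rfl).trans hb
  have hel₄ : s₄.reg .el = e := (f₄'.reg .el rfl).trans hel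
  have hd₄ : s₄.reg .d = d := (f₄'.reg .d rfl).trans hp.d
  have hw₄ : s₄.reg .w = w := (f₄'.reg .w rfl).trans hp.w
  have f₃₄ := f₃.seq f₄
  refine wp_seq (scan_wp (d := d) (w := w) (a := a) (e := e) (R := R) ht
    (by simpa using (f₄'.reg .n rfl).trans hp.n) (by simpa using hd₄) (by simpa using hw₄)
    (by simpa using hb₄) (by simpa using hN₄) (by simp) hae hF.n_lt
    hF.w_lt hF.two_lt hF.d_pos hF.cl_lt hF.L_lt hL₃ hL₄ d2 (by simpa [h4i] using hT) hF.input
    hF.work hF.output (by simpa using (f₃₄.head .input rfl).trans c1)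
    (by simpa using (f₃₄.head .work rfl).trans c2)
    (by simpa using (f₃₄.head .output rfl).trans c3) (by simpa using e2) (by simpa using e1)
    (by simpa [h4w] using hs.bits) (fun q hq => by
      rw [if_neg (by omega), St.set_tape, h4o]; exact hs.slots q hq)) ?_
  rintro s₅ τ₅ ⟨g1, g2, g3, g4, g5, g6, g7⟩ f₅
  refine wp_seq (sumGaps_wp ((f₅.reg .N rfl).trans (by simpa using hN₄))
      (by omega) hF.L_lt hF.n_lt g1) ?_
  rintro s₆ τ₆ ⟨k1, k2⟩ f₆
  have f₆' := f₅.seq f₆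
  refine wp_seq (finish_wp ht ((f₆'.reg .d rfl).trans (by simpa using hd₄))
    ((f₆'.reg .w rfl).trans (by simpa using hw₄)) ((f₆'.reg .b rfl).trans (by simpa using hb₄))
    ((f₆'.reg .el rfl).trans (by simpa using hel₄)) ((f₆'.reg .g rfl).trans (by simp))
    ((f₆'.arr .RK rfl).trans
        (by simpa using hR₄)) hae hF.n_lt hF.w_lt hF.two_lt hF.d_pos hclW hF.L_lt hL₄
    d2 hF.work hF.output ((f₆.head .input rfl).trans g4) ((f₆.head .work rfl).trans g5)
    ((f₆.head .output rfl).trans g6) k1 (by rw [f₆.tape .work rfl]; exact g2)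
    (by rw [f₆.tape .output rfl]; exact g3)) ?_
  rintro s₇ τ₇ ⟨l1, l2, l3, l4, l5, l6⟩ f₇
  have f₇' := f₆'.seq f₇
  refine wp_mono (wp_frame (compareFirst_wp (R := R) ((f₇'.reg .N rfl).trans (by simpa using hN₄))
    ((f₇'.reg .g rfl).trans (by simp)) (by omega) hF.L_lt
    ((f₇'.arr .RK rfl).trans (by simpa using hR₄)))) ?_
  rintro s₈ τ₈ ⟨⟨m1, m2⟩, f₈⟩
  have f₈' := f₇'.seq f₈
  refine ⟨⟨(f₈.head .input rfl).trans l3, (f₈.head .work rfl).trans l4,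
    (f₈.head .output rfl).trans l5, by rw [f₈.tape .work rfl]; exact l1, fun q hq => ?_,
        fun h0 => ?_,
    fun h0 k hk => ?_⟩, ?_, passTime_bound hm0 hmn hem b4 c4 d3 e3 g7 k2 l6 m2⟩
  -- For a slot that ends at or before `a`, the scan invariant still mentions the old value; it is
  -- 0, like the new one.
  · have h := l2 q hq
    rw [f₈.tape .output rfl]
    split_ifs at h with h1
    · exact h
    · rw [slotVal, if_pos (by omega)] at h ⊢
      exact h
  -- Only the leftmost block can be shorter than `m`, and no block comes after it; so the data for a
  -- next block are complete whenever they are wanted.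
  · obtain rfl := hem' h0
    have : s₈.arr .U = s₁.arr .U := (f₈'.arr .U rfl).trans ((f₄.arr .U rfl).trans hU₃)
    rw [this]
    exact b2
  · obtain rfl := hem' h0
    have h := d2.iff k 0 (by omega) (by omega)
    rcases m1 k hk with ⟨h1, h2⟩ | ⟨h1, h2⟩
    · exact .inl ⟨h1, h.1 h2⟩
    · exact .inr ⟨h1, fun h' => h2 (h.2 h')⟩
  · have p1 := f₁.phi .toLeft rfl
    have p2 := (f₂.seq f₃₄).phi .toRight rfl
    have p3 := f₈'.phi .toLeft rfl
    have p4 := s₁.phi_le .toRight .toLeft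
    have p5 := s₄.phi_le .toLeft .toRight
    have p6 : (s₄.set .g (R 0)).phi .toLeft = s₄.phi .toLeft := rfl
    omega

/-- The sampled inverse suffix array, block by block from the right. -/
def posD (σ cl : ℕ) : Prog :=
  .a ::= 0 ;; .b ::= 0 ;; goRight cl ;; .b ::= Var.n ;;
    .loop (.lt 0 Var.b) (.ite (.lt Var.m Var.b) (.a ::= Var.b - Var.m) (.a ::= 0) ;;
      .el ::= Var.b - Var.a ;; blockPass σ cl ;; .b ::= Var.a)

theorem not_slt_of_zero {t : ℕ → ℕ} {i j : ℕ} (h : ∀ k, t (j + k) = 0) : ¬ slt t i j := by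
  rintro ⟨k, -, hk⟩
  rw [h k] at hk
  exact Nat.not_lt_zero _ hk

/-- The number of remaining blocks is the quotient by `m` rounded up; it drops by one even if the
last block is short. -/
theorem blocks_step {m b a e : ℕ} (hm : 0 < m) (hb : b = a + e) (he : 0 < e) (hem : e ≤ m)
    (h : 0 < a → e = m) : (b + m - 1) / m = (a + m - 1) / m + 1 := by
  rcases Nat.eq_zero_or_pos a with rfl | ha
  · rw [show b + m - 1 = (e - 1) + m by omega, Nat.add_div_right _ hm, Nat.div_eq_of_lt (by omega),
      Nat.div_eq_of_lt (by omega)]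
  · rw [h ha] at hb
    rw [show b + m - 1 = (a + m - 1) + m by omega, Nat.add_div_right _ hm]

theorem posD_wp {Γ : Env} {s : St} {τ σ n d w m cl : ℕ} {t : ℕ → ℕ} (ht : Text σ n t)
    (hσ : σ < Γ.W) (hF : Fits Γ σ cl n d w m) (hp : Params s n d w m)
    (hT : Encoded cl n t (s.tape .input)) (harr : ∀ x k, s.arr x k = 0)
    (hout : ∀ p, s.tape .output p = false)
    (hhead : ∀ k, s.head k = 0) :
    wp Γ (posD σ cl) (fun s' τ' =>
      (∀ q, (q + 1) * d ≤ n → HoldsWord w (s'.tape .output) q (slotVal t n d 0 q)) ∧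
      s'.passes ≤ s.phi .toLeft + 6 + 6 * ((n + m - 1) / m) ∧
      τ' ≤ τ + passTime σ cl n d w + passTime σ cl n d w * ((n + m - 1) / m)) s τ := by
  have hm0 := hF.m_pos
  have hmn := hF.m_le
  have hW := hF.two_lt
  have hnW := hF.n_lt
  have hclW : cl < Γ.W := lt_trans Nat.lt_two_pow_self hF.cl_lt
  unfold posD
  refine wp_seq_iff.2 (wp_assign_iff.2 ⟨by simp; omega, ?_⟩)
  refine wp_seq_iff.2 (wp_assign_iff.2 ⟨by simp; omega, ?_⟩)
  refine wp_seq (goRight_wp (cl := cl) (d := d) (n := n) (w := w) (a := 0) (b := 0)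
    (by simpa using hp.n) (by simpa using hp.d) (by simpa using hp.w) (by simp) (by simp) (by omega)
    (by omega) hnW hclW hF.w_lt (by simp [hhead]) (by simp [hhead]) (by simp [hhead])
    hF.input hF.work hF.output) ?_
  rintro s₁ τ₁ ⟨b1, b2, b3, b4⟩ f₁
  have hn₁ : s₁.reg .n = n := (f₁.reg .n rfl).trans (by simpa using hp.n)
  refine wp_seq_iff.2 (wp_assign_iff.2 ⟨trivial, ?_⟩)
  obtain ⟨s₂, hs₂⟩ : ∃ s₂, s₁.set .b ((Ex.var .n).val s₁.reg) = s₂ := ⟨_, rfl⟩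
  have hphi : s₂.phi .toLeft ≤ s.phi .toLeft + 6 := by
    have p1 := f₁.phi .toRight rfl
    have p2 := s₁.phi_le .toLeft .toRight
    have p3 := s.phi_le .toRight .toLeft
    have p4 : s₂.phi .toLeft = s₁.phi .toLeft := by rw [← hs₂]; rfl
    have p5 : ((s.set .a (Ex.val s.reg 0)).set .b (Ex.val (s.set .a (Ex.val s.reg 0)).reg 0)).phi
      .toRight = s.phi .toRight := rfl
    omega
  have hp₂ : Params s₂ n d w m := by
    subst hs₂
    refine ⟨?_, ?_, ?_, ?_⟩
    · simpa using hn₁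
    · simpa using (f₁.reg .d rfl).trans (by simpa using hp.d)
    · simpa using (f₁.reg .w rfl).trans (by simpa using hp.w)
    · simpa using (f₁.reg .m rfl).trans (by simpa using hp.m)
  have hT₂ : Encoded cl n t (s₂.tape .input) := by
    subst hs₂
    rw [St.set_tape, f₁.tape .input rfl]
    exact hT
  have hz : ∀ k, t (n + k) = 0 := fun k => ht.zero _ (Nat.le_add_right _ _)
  -- At `b = n` the invariant holds for the initial contents: everything from `n` on is zero, no
  -- suffix is below the zero string, and the slots are still zero.
  have hD : Done cl n d w m t n s₂ := by
    subst hs₂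
    refine ⟨by simpa using b1, by simpa using b2, by simpa using b3, fun p h1 h2 => by omega,
      fun q hq => ?_, fun _ k _ => ?_, fun _ k _ => .inr ⟨?_, not_slt_of_zero hz⟩⟩
    · rw [slotVal, if_pos hq, St.set_tape, f₁.tape .output rfl]
      intro b _
      simp [hout]
    · rw [hz, St.set_arr, f₁.arr .U rfl]
      simp [harr]
    · rw [St.set_arr, f₁.arr .G rfl]
      simp [harr]
  have hb₂ : s₂.reg .b = n := by subst hs₂; simpa using hn₁
  rw [hs₂]
  clear hs₂
  refine wp_mono (wp_while (fun u τ' => ∃ b ≤ n, u.reg .b = b ∧ Done cl n d w m t b u ∧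
    Params u n d w m ∧ Encoded cl n t (u.tape .input) ∧
    u.phi .toLeft + 6 * ((b + m - 1) / m) ≤ s₂.phi .toLeft + 6 * ((n + m - 1) / m) ∧
    τ' + passTime σ cl n d w * ((b + m - 1) / m) ≤
      τ₁ + 1 + passTime σ cl n d w * ((n + m - 1) / m)) (fun u => u.reg .b)
    ⟨n, le_rfl, hb₂, hD, hp₂, hT₂, le_rfl, le_rfl⟩ ?_ ?_) ?_
  · intro u τ' _ _
    simp
    omega
  · rintro u τ' - ⟨b, hbn, hb, hDu, hpu, hTu, hphi, htime⟩ hc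
    replace hc : 0 < b := by simpa [hb] using hc
    have hm := hpu.m
    refine wp_seq (P := fun v τ'' => v.reg .a = b - m ∧ v.arr = u.arr ∧ v.tape = u.tape ∧
      v.head = u.head ∧ τ'' ≤ τ' + 3) ?_ ?_
    · simp [hb, hm]
      refine ⟨fun h => ⟨by omega, by omega⟩, fun h => ⟨by omega, by omega⟩⟩
    rintro v τ'' ⟨h1, h2, h3, h4, h5⟩ hf
    obtain ⟨a, ha⟩ : ∃ a, b - m = a := ⟨_, rfl⟩
    obtain ⟨e, he⟩ : ∃ e, b = a + e := ⟨b - a, by omega⟩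
    have hbv : v.reg .b = b := (hf.reg .b rfl).trans hb
    rw [ha] at h1
    refine wp_seq_iff.2 (wp_assign_iff.2 ⟨by simp [hbv, h1]; omega, ?_⟩)
    obtain ⟨y, hy⟩ : ∃ y, v.set .el ((Var.b - Var.a : Ex).val v.reg) = y := ⟨_, rfl⟩
    have hpy : Params y n d w m := by
      subst hy
      exact ⟨by simpa using (hf.reg .n rfl).trans hpu.n, by simpa using (hf.reg .d rfl).trans hpu.d,
        by simpa using (hf.reg .w rfl).trans hpu.w, by simpa using (hf.reg .m rfl).trans hpu.m⟩
    have hely : y.reg .el = e := by subst hy; simp [hbv, h1]; omega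
    have hay : y.reg .a = a := by subst hy; simpa using h1
    have hby : y.reg .b = a + e := by subst hy; simp [hbv]; omega
    have hTy : Encoded cl n t (y.tape .input) := by subst hy; rw [St.set_tape, h3]; exact hTu
    have hDy : Done cl n d w m t (a + e) y := by
      subst hy he
      exact ⟨by simpa [h4] using hDu.input, by simpa [h4] using hDu.work,
        by simpa [h4] using hDu.output, by simpa [h3] using hDu.bits,
        by simpa [h3] using hDu.slots, by simpa [h2] using hDu.next, by simpa [h2] using hDu.less⟩
    have hphiy : y.phi .toLeft ≤ u.phi .toLeft := by
      subst hy
      exact hf.phi .toLeft rfl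
    rw [hy]
    clear hy
    have hstep := blocks_step hm0 he (by omega) (by omega) (fun h => by omega)
    refine wp_seq (blockPass_wp ht hσ hF hpy hay hby hely (by omega) (by omega) (by omega)
      (by omega) hTy hDy) ?_
    rintro z τz ⟨hDz, hphiz, htz⟩ hfz
    have haz : z.reg .a = a := (hfz.reg .a rfl).trans hay
    refine wp_assign_iff.2 ⟨trivial, ⟨a, by omega, by simp [haz], ?_, ?_, ?_, ?_, ?_⟩, ?_⟩
    · exact ⟨hDz.input, hDz.work, hDz.output, hDz.bits, hDz.slots, hDz.next, hDz.less⟩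
    · exact ⟨by simpa using (hfz.reg .n rfl).trans hpy.n,
          by simpa using (hfz.reg .d rfl).trans hpy.d,
        by simpa using (hfz.reg .w rfl).trans hpy.w, by simpa using (hfz.reg .m rfl).trans hpy.m⟩
    · rw [St.set_tape, hfz.tape .input rfl]
      exact hTy
    · have : (z.set .b ((Ex.var .a).val z.reg)).phi .toLeft = z.phi .toLeft := rfl
      omega
    · rw [hstep, Nat.mul_succ] at htime
      omega
    · simp [haz, hb]
      omega
  · rintro u τ' ⟨τ'', rfl, ⟨b, hbn, hb, hDu, -, -, hphi', htime⟩, hc⟩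
    obtain rfl : b = 0 := by
      have : ¬ 0 < b := by simpa [hb] using hc
      omega
    refine ⟨hDu.slots, ?_, ?_⟩
    · have : u.passes ≤ u.phi .toLeft := by unfold St.phi; omega
      omega
    -- The first move to the end of the text is charged to the additional summand `passTime`.
    · have : 20 + (3 * cl + 8) * n + (n / d) * (3 * w + 4) ≤ passTime σ cl n d w := by
        rw [passTime_eq, show (n / d) * (3 * w + 4) = 3 * (w * (n / d)) + 4 * (n / d) by ring,
          show (3 * cl + 8) * n = 3 * (cl * n) + 8 * n by ring]
        omega
      omega

end ExtMem

namespace ExtMem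

open SuffixIndex

/-! ## Texts of bounded length -/

/-- Read the bits from `h` to `h + k - 1` of the input disk, and continue with `f` applied to the
string of these bits. -/
def readBits (f : (ℕ → Bool) → Prog) (h : ℕ) : ℕ → Prog
  | 0 => f fun _ => false
  | k + 1 => .read .c .input ;; .move .input .toRight ;;
      .ite (.lt 0 Var.c) (readBits (fun g => f (Function.update g h true)) (h + 1) k)
        (readBits (fun g => f (Function.update g h false)) (h + 1) k)

/-- The program is a decision tree with a leaf for every string of `k` bits. Its size is exponential
in `k`, but a run follows a single branch. -/
theorem readBits_wp {Γ : Env} {f : (ℕ → Bool) → Prog} {Q : St → ℕ → Prop} {k h : ℕ} {s : St}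
    {τ : ℕ} (hW : 0 < Γ.W) (hh : s.head .input = h) (hs : h + k ≤ Γ.size .input)
    (hf : ∀ u τ', (∀ x, x ≠ .c → u.reg x = s.reg x) → u.tape = s.tape →
      u.head .output = s.head .output → τ' ≤ τ + 4 * k →
      wp Γ (f fun p => if h ≤ p ∧ p < h + k then s.tape .input p else false) Q u τ') :
    wp Γ (readBits f h k) Q s τ := by
  induction k generalizing f h s τ with
  | zero =>
    have h1 := hf s τ (fun _ _ => rfl) rfl rfl le_rfl
    rwa [show (fun p => if h ≤ p ∧ p < h + 0 then s.tape .input p else false) = fun _ => false by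
      funext p; exact if_neg (by omega)] at h1
  | succ k ih =>
    have key : ∀ b, s.tape .input h = b →
        wp Γ (readBits (fun g => f (Function.update g h b)) (h + 1) k) Q
          ((s.set .c b.toNat).moveTo .input .toRight (h + 1)) (τ + 1 + 1 + 1) := by
      intro b hb
      refine ih (by simp) (by omega) fun u τ' h1 h2 h3 h4 => ?_
      have h5 := hf u τ' (fun x hx => (h1 x hx).trans (by simp [hx])) h2 (h3.trans (by simp))
        (by omega)
      convert h5 using 2
      funext p
      rcases eq_or_ne p h with rfl | hp
      · simp [hb]
      · rw [Function.update_of_ne hp]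
        exact if_congr (by omega) rfl rfl
    simp only [readBits, wp_seq_iff, wp_read_iff, wp_moveRight_iff, wp_ite_iff, St.set_head, hh]
    refine ⟨by omega, by omega, by simp [hW], fun hc => ?_, fun hc => ?_⟩
    · cases hb : s.tape .input h
      · simp [hb] at hc
      · exact key _ hb
    · cases hb : s.tape .input h
      · exact key _ hb
      · simp [hb] at hc

/-- Store `v (d - 1), v (2 * d - 1), …` for the positions below `j`. -/
def putConstants (v : ℕ → ℕ) : ℕ → Prog
  | 0 => .skip
  | j + 1 => putConstants v j ;; .ite (.eq (.lit (j + 1) % Var.d) 0)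
      (movesRight .output Var.w ;; .u ::= .lit (v j) ;; addSlot ;; movesRight .output Var.w) .skip

/-- `addSlot` works leftwards from the end of a slot, so every slot is crossed, filled on the way
back, and crossed again. The slots are zero at first, so adding a value stores it. -/
theorem putConstants_wp {Γ : Env} {s : St} {τ n d w j : ℕ} {v : ℕ → ℕ} (hd : s.reg .d = d)
    (hw : s.reg .w = w) (hjn : j ≤ n) (hnW : n < Γ.W) (hwW : w < Γ.W) (hW : 2 < Γ.W)
    (hd0 : 0 < d) (hv : ∀ i < n, v i ≤ n) (hh : s.head .output = 0)
    (hs : n / d * w ≤ Γ.size .output) (ht : ∀ p, s.tape .output p = false) :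
    wp Γ (putConstants v j) (fun u τ' => u.head .output = j / d * w ∧
      (∀ q, j < (q + 1) * d → HoldsWord w (u.tape .output) q 0) ∧
      (∀ q, (q + 1) * d ≤ j → HoldsWord w (u.tape .output) q (v ((q + 1) * d - 1))) ∧
      τ' ≤ τ + j * (13 * w + 20) + 1) s τ := by
  induction j with
  | zero =>
    refine wp_skip_iff.2 ⟨by simp [hh], fun q _ b _ => by simp [ht], fun q hq => ?_, by omega⟩
    have : 0 < (q + 1) * d := Nat.mul_pos (Nat.succ_pos q) hd0
    omega
  | succ j ih =>
    refine wp_seq (ih (by omega)) ?_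
    rintro u τ' ⟨h1, h2, h3, h4⟩ hf
    have hmod : ∀ (x : Var) v j, x = .d ∨ x = .w → (putConstants v j).modR x = false := by
      rintro x v j (rfl | rfl) <;> induction j with
      | zero => rfl
      | succ j ih => simp [putConstants, Prog.modR, ih, movesRight, addSlot, Prog.upTo]
    have e1 : u.reg .d = d := (hf.reg .d (hmod _ _ _ (.inl rfl))).trans hd
    have e2 : u.reg .w = w := (hf.reg .w (hmod _ _ _ (.inr rfl))).trans hw
    have hdiv := Nat.succ_div (a := j) (b := d)
    refine wp_ite_iff.2 ⟨by simp; omega, fun hc => ?_, fun hc => ?_⟩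
    · have hdvd : d ∣ j + 1 := Nat.dvd_of_mod_eq_zero (by simpa [e1] using hc)
      rw [if_pos hdvd] at hdiv
      have hq : (j / d + 1) * d = j + 1 := by rw [← hdiv, Nat.div_mul_cancel hdvd]
      have hsz : (j / d + 1) * w ≤ n / d * w := by
        rw [← hdiv]
        exact Nat.mul_le_mul_right _ (Nat.div_le_div_right hjn)
      have hvn := hv j (by omega)
      have hsucc : (j / d + 1) * w = j / d * w + w := Nat.succ_mul _ _
      refine wp_seq (movesRight_wp (H := w) hwW (fun r hr => by simp [hr, e2]) (by omega)) ?_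
      rintro u₁ τ₁ ⟨a1, a2⟩ f₁
      refine wp_seq_iff.2 (wp_assign_iff.2 ⟨by simp; omega, ?_⟩)
      refine wp_seq (addSlot_wp (w := w) (q := j / d) (u := v j) (x := 0)
        (by simpa using (f₁.reg .w rfl).trans e2) hwW hW (by simp) (by omega)
        (by rw [St.set_head, a1]; omega) (by omega)
        (by rw [St.set_tape, f₁.tape .output rfl]; exact h2 _ (by omega))) ?_
      rintro u₂ τ₂ ⟨b1, b2, b3, b4⟩ f₂
      have e3 : u₂.reg .w = w := (f₂.reg .w rfl).trans (by simpa using (f₁.reg .w rfl).trans e2)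
      refine wp_mono (wp_frame (movesRight_wp (H := w) hwW (fun r hr => by simp [hr, e3])
        (by omega))) ?_
      rintro u₃ τ₃ ⟨⟨c1, c2⟩, f₃⟩
      rw [f₃.tape .output rfl]
      rw [St.set_tape, f₁.tape .output rfl] at b2
      refine ⟨by rw [c1, b3, hdiv, hsucc], fun q hq' => ?_, fun q hq' => ?_, ?_⟩
      · exact b2 q 0 (fun h => by subst h; omega) (h2 q (by omega))
      · rcases eq_or_ne q (j / d) with rfl | hne
        · rw [hq]; exact b1
        · have h6 : (q + 1) * d ≠ j + 1 := fun h => hne (by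
            have := Nat.eq_of_mul_eq_mul_right hd0 (h.trans hq.symm); omega)
          exact b2 q _ hne (h3 q (by omega))
      · rw [Nat.succ_mul]
        omega
    · have hdvd : ¬ d ∣ j + 1 := fun h => hc (by simpa [e1] using Nat.mod_eq_zero_of_dvd h)
      replace hdiv : (j + 1) / d = j / d := by rw [hdiv, if_neg hdvd]; rfl
      refine wp_skip_iff.2 ⟨by rw [h1, hdiv], fun q hq => h2 q (by omega), fun q hq => h3 q ?_, ?_⟩
      · have h6 : (q + 1) * d ≠ j + 1 := fun h => hdvd ⟨q + 1, by rw [← h, Nat.mul_comm]⟩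
        omega
      · rw [Nat.succ_mul]
        omega

theorem holdsWord_encodeText {σ n : ℕ} (T : Fin n → Fin σ) (i : Fin n) :
    HoldsWord (Nat.clog 2 σ) (encodeText T) i (T i) := by
  intro b hb
  have hcl : 0 < Nat.clog 2 σ := by omega
  have h2 : (i * Nat.clog 2 σ + (Nat.clog 2 σ - 1 - b)) / Nat.clog 2 σ = i := by
    rw [Nat.mul_comm, Nat.mul_add_div hcl, Nat.div_eq_of_lt (by omega), Nat.add_zero]
  have h3 : (i * Nat.clog 2 σ + (Nat.clog 2 σ - 1 - b)) % Nat.clog 2 σ =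
      Nat.clog 2 σ - 1 - b := by
    rw [Nat.mul_comm, Nat.mul_add_mod, Nat.mod_eq_of_lt (by omega)]
  have h4 : Nat.clog 2 σ - 1 - (Nat.clog 2 σ - 1 - b) = b := by omega
  simp only [encodeText, h2, h3, h4, i.isLt, dite_true]

theorem lt_two_pow_clog {σ : ℕ} (a : Fin σ) : (a : ℕ) < 2 ^ Nat.clog 2 σ :=
  a.isLt.trans_le (Nat.le_pow_clog (by norm_num) σ)

/-- A leaf of the decision tree knows only the bits; injectivity makes the text, and hence its
ranks, a function of them. -/
theorem encodeText_injective {σ n : ℕ} :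
    Function.Injective (encodeText : (Fin n → Fin σ) → ℕ → Bool) := by
  intro T T' h
  funext i
  refine Fin.ext (Nat.eq_of_testBit_eq fun b => ?_)
  rcases lt_or_ge b (Nat.clog 2 σ) with hb | hb
  · rw [← holdsWord_encodeText T i b hb, ← holdsWord_encodeText T' i b hb, h]
  · rw [Nat.testBit_lt_two_pow ((lt_two_pow_clog _).trans_le (Nat.pow_le_pow_right
        (by norm_num) hb)),
      Nat.testBit_lt_two_pow ((lt_two_pow_clog _).trans_le (Nat.pow_le_pow_right (by norm_num) hb))]

theorem encodeText_eq_false {σ n : ℕ} (hσ : 2 ≤ σ) (T : Fin n → Fin σ) {p : ℕ}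
    (hp : n * Nat.clog 2 σ ≤ p) : encodeText T p = false := by
  have hcl : 0 < Nat.clog 2 σ := Nat.clog_pos (by norm_num) hσ
  exact dif_neg (not_lt.2 ((Nat.le_div_iff_mul_le hcl).2 hp))

open Classical in
/-- The ranks of the suffixes of the text encoded by `g`. -/
noncomputable def posOf (σ n : ℕ) (g : ℕ → Bool) (i : ℕ) : ℕ :=
  if h : (∃ T : Fin n → Fin σ, encodeText T = g) ∧ i < n then pos h.1.choose ⟨i, h.2⟩ else 0

theorem posOf_encodeText {σ n : ℕ} (T : Fin n → Fin σ) (i : Fin n) :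
    posOf σ n (encodeText T) i = pos T i := by
  have h : (∃ T' : Fin n → Fin σ, encodeText T' = encodeText T) ∧ (i : ℕ) < n := ⟨⟨T, rfl⟩, i.isLt⟩
  rw [posOf, dif_pos h, encodeText_injective h.1.choose_spec]

theorem posOf_le {σ n : ℕ} (g : ℕ → Bool) (i : ℕ) : posOf σ n g i ≤ n := by
  unfold posOf
  split_ifs with h
  · exact ((sa h.1.choose).symm ⟨i, h.2⟩).isLt
  · exact Nat.zero_le _

/-- Look up the sampled inverse suffix array of the text on the input disk. -/
noncomputable def lookup (σ n : ℕ) : Prog :=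
  readBits (fun g => putConstants (posOf σ n g) n) 0 (n * Nat.clog 2 σ)

theorem lookup_wp {Γ : Env} {s : St} {τ σ n d w : ℕ} {T : Fin n → Fin σ} (hσ : 2 ≤ σ)
    (hd : s.reg .d = d) (hw : s.reg .w = w) (hnW : n < Γ.W) (hwW : w < Γ.W) (hW : 2 < Γ.W)
    (hd0 : 0 < d) (hh : ∀ k, s.head k = 0) (hs : n * Nat.clog 2 σ ≤ Γ.size .input)
    (hs' : n / d * w ≤ Γ.size .output) (ht : s.tape .input = encodeText T)
    (ht' : ∀ p, s.tape .output p = false) :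
    wp Γ (lookup σ n) (fun u τ' => HoldsPosD T d w (u.tape .output) ∧
      τ' ≤ τ + 4 * (n * Nat.clog 2 σ) + n * (13 * w + 20) + 1) s τ := by
  refine readBits_wp (by omega) (hh _) (by omega) fun u τ' h1 h2 h3 h4 => ?_
  have hg : (fun p => if 0 ≤ p ∧ p < 0 + n * Nat.clog 2 σ then s.tape .input p else false) =
      encodeText T := by
    funext p
    rw [ht]
    split_ifs with h
    · rfl
    · exact (encodeText_eq_false hσ T (by omega)).symm
  rw [hg]
  refine wp_mono (putConstants_wp (n := n) (d := d) (w := w) ((h1 .d (by decide)).trans hd)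
    ((h1 .w (by decide)).trans hw) le_rfl hnW hwW hW hd0 (fun i _ => posOf_le _ i)
    (h3.trans (hh _)) hs' (by rw [h2]; exact ht')) ?_
  rintro v τ'' ⟨-, -, g1, g2⟩
  refine ⟨fun k i hi => ?_, by omega⟩
  have := g1 k (by omega)
  rwa [← hi, Nat.add_sub_cancel, posOf_encodeText] at this

end ExtMem

namespace ExtMem

open SuffixIndex

/-! ## The program on the machine -/

/-- The program state that a machine state with empty memory represents. -/
def State.toSt (σ : State) : St :=
  ⟨fun x => σ.reg x.ctorIdx, fun _ _ => 0, σ.tape, σ.head, σ.dir, σ.passes⟩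

theorem State.rel_toSt {H L κ τ : ℕ} {σ : State} (hL : σ.reg lenReg = L) (hmem : ∀ v, σ.mem v = 0)
    (hslot : ∀ v, σ.reg (slotReg v) = 0) (hτ : σ.time ≤ κ * τ) : Rel H L κ σ σ.toSt τ :=
  ⟨fun _ => rfl, hL, fun _ _ _ => by simp [State.cell, State.toSt, hmem, hslot], rfl, rfl, rfl, rfl,
    hτ⟩

/-- Branch on the value of the register `0`, which is at least `k`. -/
def dispatch (f : ℕ → Cmd) (g : Cmd) (k : ℕ) : ℕ → Cmd
  | 0 => g
  | j + 1 => .cond (.bin .eq (.reg 0) (.lit k)) (f k) (dispatch f g (k + 1) j)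

theorem dispatch_exec {m : Machine} {f : ℕ → Cmd} {g : Cmd} {k j n : ℕ} {s : State}
    (hs : s.reg 0 = n) (hn : n < 2 ^ m.w) (hk : k ≤ n) :
    ∃ i ≤ 4 * j, ∀ t, Exec m (if n < k + j then f n else g) (s.tick i) t →
      Exec m (dispatch f g k j) s t := by
  induction j generalizing k s with
  | zero =>
    refine ⟨0, le_rfl, fun t ht => ?_⟩
    rwa [if_neg (by omega)] at ht
  | succ j ih =>
    have hk' : k % 2 ^ m.w = k := Nat.mod_eq_of_lt (by omega)
    rcases eq_or_ne n k with rfl | hne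
    · refine ⟨4, by omega, fun t ht => .condTrue (by simp [Expr.eval, BinOp.eval, hs, hk']) ?_⟩
      rwa [if_pos (by omega)] at ht
    · obtain ⟨i, hi, h⟩ := ih (k := k + 1) (s := s.tick 4) hs (by omega)
      refine ⟨4 + i, by omega, fun t ht =>
        .condFalse (by simp [Expr.eval, BinOp.eval, hs, hk', hne]) (h t ?_)⟩
      rw [if_congr (show n < k + (j + 1) ↔ n < k + 1 + j by omega) rfl rfl] at ht
      rwa [show (s.tick 4).tick i = s.tick (4 + i) by simp [State.tick, Nat.add_assoc]]

theorem posInit_slotReg {σ n : ℕ} (T : Fin n → Fin σ) (d w M v : ℕ) :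
    (posInit T d w M).reg (slotReg v) = 0 := by
  rw [slotReg, Nat.add_comm]
  rfl

/-- The program contains no arrays, so it can be compiled with array length 0 and no extra
registers, and nothing is required of `M`. -/
theorem lookup_exec {σ n d w M B k : ℕ} (hσ : 2 ≤ σ) (hn : 2 ≤ n) (hd : 0 < d) (hnw : n < 2 ^ w)
    (T : Fin n → Fin σ) :
    ∃ t, Exec (posMachine σ n d w M B) ((lookup σ n).compile 0) ((posInit T d w M).tick k) t ∧
      HoldsPosD T d w (t.tape .output) ∧ t.time ≤ ((lookup σ n).cost 0 + 1) *
        (k + 4 * (n * Nat.clog 2 σ) + n * (13 * w + 20) + 1) := by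
  have hR : Rel 0 0 ((lookup σ n).cost 0 + 1) ((posInit T d w M).tick k)
      ((posInit T d w M).tick k).toSt k := by
    refine State.rel_toSt rfl (fun _ => rfl) (posInit_slotReg T d w M) ?_
    simp only [State.tick, posInit]
    nlinarith
  obtain ⟨t, u, τ', h1, h2, h3, h4⟩ := compile_sound (m := posMachine σ n d w M B) (by simp)
      (by simp)
    (by simp) (show 1 < 2 ^ w by omega)
    (lookup_wp (Γ := ⟨2 ^ w, 0, (posMachine σ n d w M B).size⟩) (n := n) (d := d) (w := w) (T := T)
      hσ rfl rfl hnw Nat.lt_two_pow_self (by simp; omega) hd (fun _ => rfl) le_rfl le_rfl rfl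
      (fun _ => rfl)) (Nat.le_succ _) hR
  exact ⟨t, h1, by rw [h2.tape]; exact h3, h2.time.trans (Nat.mul_le_mul_left _ h4)⟩

/-- The number of registers that extend the internal memory. -/
def spare (σ : ℕ) : ℕ := numArr * (3 * σ + 50)

/-- The length of a block, for an internal memory of `M` words. -/
def blockLen (σ M : ℕ) : ℕ := M / (2 * spare σ) + 1

def posDWithLen (σ : ℕ) : Prog :=
  .m ::= Var.M / .lit (2 * spare σ) + 1 ;; posD σ (Nat.clog 2 σ)

/-- The array length is not a variable of the structured language; its register is set by a machine
command before the compiled program starts. -/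
def posDCmd (σ : ℕ) : Cmd :=
  .seq (.assign lenReg (.bin .mul (.lit (3 * σ + 50))
    (.bin .add (.bin .div (.reg 1) (.lit (2 * spare σ))) (.lit 1))))
    ((posDWithLen σ).compile (spare σ))

/-- With blocks of `M / (2 * spare σ) + 1` characters, the arrays need `spare σ` times as many
cells. The summand 1 is covered by the `spare σ` extra registers, and the rest takes at most half of
the internal memory. Since `4 * spare σ ≤ n` and `M ≤ n`, all addresses and constants are below `2 ^
w`. -/
theorem posD_exec {σ n d w M B k : ℕ} (hσ : 2 ≤ σ) (hn : 4 * spare σ ≤ n) (hd : 0 < d)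
    (hnw : n < 2 ^ w) (hM : M ≤ n) (T : Fin n → Fin σ) :
    ∃ t, Exec (posMachine σ n d w M B) (posDCmd σ) ((posInit T d w M).tick k) t ∧
      HoldsPosD T d w (t.tape .output) ∧
      t.passes ≤ 9 + 6 * ((n + blockLen σ M - 1) / blockLen σ M) ∧
      t.time ≤ ((posDWithLen σ).cost (spare σ) + 8) * (k + 2 + passTime σ (Nat.clog 2 σ) n d w +
        passTime σ (Nat.clog 2 σ) n d w * ((n + blockLen σ M - 1) / blockLen σ M)) := by
  have hsp : spare σ = 14 * (3 * σ + 50) := rfl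
  obtain ⟨K, hK⟩ : ∃ K, 2 * spare σ = K := ⟨_, rfl⟩
  have hMK : M / K * K ≤ M := Nat.div_mul_le_self _ _
  have hMK' : M / K ≤ M := Nat.div_le_self _ _
  obtain ⟨m, hm⟩ : ∃ m, M / K + 1 = m := ⟨_, rfl⟩
  have hbl : blockLen σ M = m := by rw [blockLen, hK, hm]
  have hL : numArr * ((3 * σ + 50) * m) ≤ spare σ + M / K * spare σ := by
    rw [← Nat.mul_assoc, ← hm]
    change spare σ * _ ≤ _
    exact le_of_eq (by ring)
  have hMK2 : 2 * (M / K * spare σ) ≤ M := by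
    calc _ = M / K * K := by rw [← hK]; ring
      _ ≤ M := hMK
  have hL' : (3 * σ + 50) * m ≤ numArr * ((3 * σ + 50) * m) := Nat.le_mul_of_pos_left _ (by decide)
  have hmle : m ≤ (3 * σ + 50) * m := Nat.le_mul_of_pos_left _ (by omega)
  rw [hbl]
  set s₀ := (posInit T d w M).tick k with hs₀
  obtain ⟨s₁, hs₁⟩ : ∃ s₁, (s₀.setReg lenReg ((3 * σ + 50) * m)).tick 8 = s₁ := ⟨_, rfl⟩
  have hexec : Exec (posMachine σ n d w M B) (.assign lenReg (.bin .mul (.lit (3 * σ + 50))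
      (.bin .add (.bin .div (.reg 1) (.lit (2 * spare σ))) (.lit 1)))) s₀ s₁ := by
    have h := Exec.assign (m := posMachine σ n d w M B) s₀ lenReg (.bin .mul (.lit (3 * σ + 50))
      (.bin .add (.bin .div (.reg 1) (.lit (2 * spare σ))) (.lit 1)))
    have e : Expr.eval (posMachine σ n d w M B).w s₀.reg (.bin .mul (.lit (3 * σ + 50))
      (.bin .add (.bin .div (.reg 1) (.lit (2 * spare σ))) (.lit 1))) = (3 * σ + 50) * m := by
      change (3 * σ + 50) % 2 ^ w * ((M / (2 * spare σ % 2 ^ w) % 2 ^ w + 1 % 2 ^ w) % 2 ^ w) %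
        2 ^ w = _
      rw [hK, Nat.mod_eq_of_lt (show 3 * σ + 50 < 2 ^ w by omega),
        Nat.mod_eq_of_lt (show K < 2 ^ w by omega), Nat.mod_eq_of_lt (show 1 < 2 ^ w by omega),
        Nat.mod_eq_of_lt (show M / K < 2 ^ w by omega), hm,
        Nat.mod_eq_of_lt (show m < 2 ^ w by omega), Nat.mod_eq_of_lt (by omega)]
    rw [e] at h
    rw [← hs₁]
    exact h
  have hR : Rel (spare σ) ((3 * σ + 50) * m) ((posDWithLen σ).cost (spare σ) + 8) s₁ s₁.toSt
      (k + 1) := by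
    subst hs₁
    refine State.rel_toSt (by simp [State.tick, State.setReg]) (fun _ => rfl) (fun v => ?_) ?_
    · rw [hs₀]
      simp only [State.tick, State.setReg, slotReg, lenReg]
      rw [Function.update_of_ne (by omega)]
      exact posInit_slotReg T d w M v
    · simp only [hs₀, State.tick, State.setReg, posInit]
      nlinarith
  have hreg : ∀ x : Var, s₁.toSt.reg x = (posInit T d w M).reg x.ctorIdx := fun x => by
    have := x.ctorIdx_lt
    rw [← hs₁, hs₀]
    simp only [State.toSt, State.tick, State.setReg, lenReg]
    rw [Function.update_of_ne (by omega)]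
  have htape : s₁.toSt.tape = (posInit T d w M).tape := by rw [← hs₁]; rfl
  have hhead : s₁.toSt.head = fun _ => 0 := by rw [← hs₁]; rfl
  have hphi : s₁.toSt.phi .toLeft = 3 := by rw [← hs₁]; rfl
  -- The constructors `n`, `M`, `d`, `w` come first in `Var`, so these variables live in the
  -- registers 0 to 3, where the parameters are given.
  have hrM : s₁.toSt.reg .M = M := hreg .M
  have hrn : s₁.toSt.reg .n = n := hreg .n
  have hrd : s₁.toSt.reg .d = d := hreg .d
  have hrw : s₁.toSt.reg .w = w := hreg .w
  have hdiv : (Var.M / .lit (2 * spare σ) + 1 : Ex).val s₁.toSt.reg = m := by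
    simp [hrM, hK, hm]
  have hclog : 2 ^ Nat.clog 2 σ < 2 * σ := by
    have h1 := Nat.pow_pred_clog_lt_self (b := 2) (by norm_num) (show 1 < σ by omega)
    have h2 : 0 < Nat.clog 2 σ := Nat.clog_pos (by norm_num) hσ
    obtain ⟨y, hy⟩ : ∃ y, Nat.clog 2 σ = y + 1 := ⟨_, (Nat.succ_pred_eq_of_pos h2).symm⟩
    rw [hy] at h1 ⊢
    rw [Nat.pow_succ]
    simp only [Nat.pred_eq_sub_one, Nat.add_sub_cancel] at h1
    omega
  have hF : Fits ⟨2 ^ w, (3 * σ + 50) * m,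
      (posMachine σ n d w M B).size⟩ σ (Nat.clog 2 σ) n d w m :=
    ⟨hm ▸ Nat.succ_pos _, hmle.trans (hL'.trans (hL.trans (by omega))), hd, hnw,
        Nat.lt_two_pow_self,
      show 2 < 2 ^ w by omega,
      hclog.trans (show 2 * σ < 2 ^ w by omega), show (3 * σ + 50) * m < 2 ^ w by omega, le_rfl,
      le_rfl, le_rfl, le_rfl⟩
  have ht : Text σ n (padded T) := ⟨fun p => padded_pos T, fun p => padded_le T p,
    fun p => padded_eq_zero T⟩
  have hEnc : Encoded (Nat.clog 2 σ) n (padded T) (encodeText T) := by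
    intro p hp
    have : padded T p - 1 = T ⟨p, hp⟩ := by simp [padded, hp]
    rw [this]
    exact ⟨holdsWord_encodeText T ⟨p, hp⟩, lt_two_pow_clog _⟩
  obtain ⟨t, u, τ', h1, h2, h3, h4, h5⟩ := compile_sound (m := posMachine σ n d w M B)
    (H := spare σ) (L := (3 * σ + 50) * m) (p := posDWithLen σ)
    (show spare σ < 2 ^ w by omega) (show _ < 2 ^ w by omega) (show _ ≤ spare σ + M by omega)
    (show 1 < 2 ^ w by omega) (wp_seq_iff.2 (wp_assign_iff.2 ⟨by
        rw [hK]
        simp only [Ex.ok_add, Ex.ok_div, Ex.ok_var, Ex.ok_lit, Ex.ok_ofNat, Ex.val_div, Ex.val_var,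
          Ex.val_lit, Ex.val_ofNat, hrM, true_and]
        change (K < 2 ^ w ∧ M < 2 ^ w) ∧ 1 < 2 ^ w ∧ M / K + 1 < 2 ^ w
        omega,
      posD_wp (τ := k + 1 + 1) ht (show σ < 2 ^ w by omega) hF
        ⟨by simpa using hrn, by simpa using hrd, by simpa using hrw,
          by simpa using hdiv⟩
        (by rw [St.set_tape, htape]; exact hEnc) (fun _ _ => rfl)
        (by rw [St.set_tape, htape]; exact fun _ => rfl)
        (by rw [St.set_head, hhead]; exact fun _ => rfl)⟩)) (Nat.le_add_right _ 8) hR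
  refine ⟨t, .seq hexec h1, fun q i hi => ?_, ?_, ?_⟩
  · have hin := i.isLt
    have h6 := h3 q (by omega)
    rw [h2.tape, pos_eq_cnt]
    rw [slotVal, if_neg (by omega), ← hi, Nat.add_sub_cancel] at h6
    exact h6
  · rw [h2.passes]
    have h7 : (s₁.toSt.set .m ((Var.M / .lit (2 * spare σ) + 1 : Ex).val s₁.toSt.reg)).phi .toLeft =
      s₁.toSt.phi .toLeft := rfl
    rw [h7, hphi] at h4
    omega
  · exact h2.time.trans (Nat.mul_le_mul_left _ (by omega))

end ExtMem

/-! ### Asymptotic bounds and the choice of constants -/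

namespace ExtMem

open SuffixIndex

theorem two_le_of_isText {σ n : ℕ} {T : Fin n → Fin σ} (hT : IsText T) (hn : 2 ≤ n) : 2 ≤ σ := by
  have h := hT ⟨0, by omega⟩ ⟨n - 1, by omega⟩ (by simp; omega) (by simp [Fin.ext_iff]; omega)
  have h1 := (T ⟨0, by omega⟩).isLt
  have h2 : (T ⟨n - 1, by omega⟩ : ℕ) < T ⟨0, by omega⟩ := h
  omega

/-- A bound for the time on texts of length below `N`. -/
noncomputable def lookupCost (σ N : ℕ) : ℕ := ∑ n ∈ Finset.range N, ((lookup σ n).cost 0 + 1)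

/-- A pass meets at most `V / (B * w)` page boundaries, where `V` is the total disk space, and `log₂
n ≤ w`. The six accesses charged in advance are absorbed because both `K * n / (B * log₂ n)` and `n
/ M` are at least 1. -/
theorem pageAccesses_le {σ n d w M B : ℕ} {T : Fin n → Fin σ} {P : Cmd} {t : State}
    (h : Exec (posMachine σ n d w M B) P (posInit T d w M) t) {S X K : ℝ} (hn : 2 ≤ n)
    (hw : n < 2 ^ w) (hM : 1 ≤ M) (hMn : M ≤ n) (hB : 1 ≤ B) (hK : (B : ℝ) * Real.logb 2 n ≤ K * n)
    (hS : ((posMachine σ n d w M B).size .input : ℝ) + (posMachine σ n d w M B).size .output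
      + (posMachine σ n d w M B).size .work ≤ S * n) (hX : (t.passes : ℝ) ≤ X * (n / M))
    (hS0 : 0 ≤ S) :
    (t.pageAccesses : ℝ) ≤ (6 * K + 2 * S * X) * (n ^ 2 / (M * B * Real.logb 2 n)) := by
  obtain ⟨V, hV⟩ : ∃ V : ℕ, (posMachine σ n d w M B).size .input +
    (posMachine σ n d w M B).size .output + (posMachine σ n d w M B).size .work = V := ⟨_, rfl⟩
  have hp := (Exec.pageAccesses_le (R := V / (B * w)) (fun k =>
    Nat.div_le_div_right (by rw [← hV]; cases k <;> omega)) h (fun k => Nat.zero_le _)).2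
  have hp' : t.pageAccesses ≤ 6 + 2 * (V / (B * w)) * t.passes := by
    have e1 : (posInit T d w M).pageAccesses = 6 := rfl
    have e2 : (posInit T d w M).passes = 0 := rfl
    have e3 : ∀ R k, (posInit T d w M).rest (posMachine σ n d w M B) R k = 0 := fun _ _ => rfl
    rw [e1, e2, e3, e3, e3] at hp
    omega
  obtain ⟨l, hl⟩ : ∃ l, Real.logb 2 n = l := ⟨_, rfl⟩
  have hn' : (2 : ℝ) ≤ n := by exact_mod_cast hn
  have hl1 : 1 ≤ l := by
    rw [← hl, Real.le_logb_iff_rpow_le (by norm_num) (by linarith)]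
    simpa using hn'
  have hlw : l ≤ w := by
    rw [← hl, Real.logb_le_iff_le_rpow (by norm_num) (by linarith), Real.rpow_natCast]
    exact_mod_cast hw.le
  rw [hl] at hK ⊢
  have hM' : (1 : ℝ) ≤ M := by exact_mod_cast hM
  have hMn' : (M : ℝ) ≤ n := by exact_mod_cast hMn
  have hB' : (1 : ℝ) ≤ B := by exact_mod_cast hB
  have hV' : (V : ℝ) ≤ S * n := by rw [← hV]; push_cast; exact hS
  have hR : ((V / (B * w) : ℕ) : ℝ) ≤ S * n / (B * l) := by
    refine Nat.cast_div_le.trans ?_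
    push_cast
    gcongr
  have h1 : (1 : ℝ) ≤ n / M := by rwa [one_le_div (by linarith)]
  have h2 : 1 ≤ K * n / (B * l) := by rwa [one_le_div (by positivity)]
  have h3 : (t.pageAccesses : ℝ) ≤ 6 + 2 * ((V / (B * w) : ℕ) : ℝ) * t.passes := by
    exact_mod_cast hp'
  calc (t.pageAccesses : ℝ) ≤ 6 + 2 * ((V / (B * w) : ℕ) : ℝ) * t.passes := h3
    _ ≤ 6 * ((K * n / (B * l)) * (n / M)) + 2 * (S * n / (B * l)) * (X * (n / M)) := by
        gcongr
        nlinarith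
    _ = _ := by field_simp

/-- A block has at least `M / (2 * spare σ)` characters, and rounding up costs one more block,
absorbed by `n / M ≥ 1`. -/
theorem blocks_le {σ n M : ℕ} (hM : 1 ≤ M) (hMn : M ≤ n) :
    (((n + blockLen σ M - 1) / blockLen σ M : ℕ) : ℝ) ≤ (1 + 2 * spare σ) * (n / M) := by
  have hsp : 0 < 2 * spare σ := by unfold spare numArr; omega
  have hb : 0 < blockLen σ M := Nat.succ_pos _
  have hM' : (0 : ℝ) < M := by exact_mod_cast hM
  have h1 : (n + blockLen σ M - 1) / blockLen σ M ≤ n / blockLen σ M + 1 := by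
    rw [← Nat.add_div_right _ hb]
    exact Nat.div_le_div_right (by omega)
  have h2 : M ≤ 2 * spare σ * blockLen σ M := (Nat.lt_mul_div_succ M hsp).le
  have h3 : (n : ℝ) / blockLen σ M ≤ 2 * spare σ * (n / M) := by
    rw [div_le_iff₀ (by exact_mod_cast hb)]
    have h4 : (M : ℝ) ≤ 2 * spare σ * blockLen σ M := by exact_mod_cast h2
    calc (n : ℝ) = n / M * M := by field_simp
      _ ≤ n / M * (2 * spare σ * blockLen σ M) := by gcongr
      _ = _ := by ring
  have h4 : (1 : ℝ) ≤ n / M := by rw [one_le_div hM']; exact_mod_cast hMn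
  calc (((n + blockLen σ M - 1) / blockLen σ M : ℕ) : ℝ)
      ≤ ((n / blockLen σ M + 1 : ℕ) : ℝ) := by exact_mod_cast h1
    _ ≤ n / blockLen σ M + 1 := by push_cast; gcongr; exact Nat.cast_div_le
    _ ≤ _ := by linarith

theorem passTime_le {σ n d w cl : ℕ} {D : ℝ} (hD : (n / d : ℕ) * (w : ℝ) ≤ D * n) :
    (passTime σ cl n d w : ℝ) ≤ (18 * cl + 5200 * σ + 21820 + 20 * D) * n := by
  have h : ((n / d : ℕ) : ℝ) ≤ n := by exact_mod_cast Nat.div_le_self _ _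
  rw [passTime_eq]
  push_cast at h hD ⊢
  nlinarith

theorem lookup_time_le {a A cl i n N w K : ℝ} (ha : a ≤ A) (hA : 0 ≤ A) (hi : i ≤ 4 * N)
    (hi0 : 0 ≤ i) (hn : n ≤ N) (hn0 : 0 ≤ n) (hw : w ≤ K * N) (hw0 : 0 ≤ w) (hcl : 0 ≤ cl) :
    a * (i + 4 * (n * cl) + n * (13 * w + 20) + 1) ≤
      A * (4 * N + 4 * (N * cl) + N * (13 * (K * N) + 20) + 1) := by
  have hN : 0 ≤ N := hn0.trans hn
  gcongr

theorem posD_time_le {a i n N p E b m q : ℝ} (ha : 0 ≤ a) (hi : i ≤ 4 * N) (hn : 2 ≤ n)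
    (hN : N ≤ n) (hq : 1 ≤ q) (hp : p ≤ E * n) (hE : 0 ≤ E) (hb0 : 0 ≤ b) (hb : b ≤ m * q) :
    a * (i + 2 + p + p * b) ≤ a * (6 + E + E * m) * (n * q) := by
  have h1 : i + 2 ≤ 6 * n * q := by nlinarith
  have h2 : p ≤ E * n * q := hp.trans (le_mul_of_one_le_right (by positivity) hq)
  calc a * (i + 2 + p + p * b) ≤ a * (6 * n * q + E * n * q + E * n * (m * q)) := by gcongr
    _ = _ := by ring

end ExtMem

theorem mainTheorem5 (σ : ℕ) :
    ∃ P : ExtMem.Cmd, ∀ c K : ℝ, 0 < c → ∃ C : ℝ,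
      ∀ (n d w M B : ℕ) (T : Fin n → Fin σ),
        SuffixIndex.IsText T →
        2 ≤ n → d ≤ n → c * Real.logb 2 n ≤ d →
        n < 2 ^ w → (w : ℝ) ≤ K * Real.logb 2 n →
        M ≤ n → 1 ≤ B → B ≤ M → (B : ℝ) * Real.logb 2 n ≤ K * n →
        ∃ s : ExtMem.State,
          ExtMem.Exec (ExtMem.posMachine σ n d w M B) P (ExtMem.posInit T d w M) s ∧
          SuffixIndex.HoldsPosD T d w (s.tape .output) ∧
          (n : ℝ) ≤ ((ExtMem.posMachine σ n d w M B).size .input : ℝ)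
            + (ExtMem.posMachine σ n d w M B).size .output
            + (ExtMem.posMachine σ n d w M B).size .work ∧
          ((ExtMem.posMachine σ n d w M B).size .input : ℝ)
            + (ExtMem.posMachine σ n d w M B).size .output
            + (ExtMem.posMachine σ n d w M B).size .work ≤ C * n ∧
          (s.passes : ℝ) ≤ C * (n / M) ∧
          (s.pageAccesses : ℝ) ≤ C * (n ^ 2 / (M * B * Real.logb 2 n)) ∧
          (s.time : ℝ) ≤ C * (n ^ 2 / M) := by
  open ExtMem in
  obtain ⟨N, hN⟩ : ∃ N, 4 * spare σ = N := ⟨_, rfl⟩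
  obtain ⟨cl, hcl⟩ : ∃ cl, Nat.clog 2 σ = cl := ⟨_, rfl⟩
  -- From `N = 4 * spare σ` on, the constants of the block algorithm fit into words. Shorter texts
  -- are finitely many for fixed `σ` and are looked up.
  refine ⟨dispatch (fun n => (lookup σ n).compile 0) (posDCmd σ) 0 N, fun c K hc => ?_⟩
  obtain ⟨S, hS0, hS⟩ : ∃ S : ℝ, 0 ≤ S ∧ cl + |K| / c + 1 = S :=
    ⟨_, by clear * - hc; positivity, rfl⟩
  obtain ⟨D, hD0, hD⟩ : ∃ D : ℝ, 0 ≤ D ∧ (lookupCost σ N : ℝ) *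
    (4 * N + 4 * (N * cl) + N * (13 * (|K| * N) + 20) + 1) = D :=
    ⟨_, by clear * - hc; positivity, rfl⟩
  obtain ⟨E, hE0, hE⟩ : ∃ E : ℝ, 0 ≤ E ∧ 18 * cl + 5200 * σ + 21820 + 20 * (|K| / c) = E :=
    ⟨_, by clear * - hc; positivity, rfl⟩
  obtain ⟨Y, hY0, hY⟩ : ∃ Y : ℝ, 0 ≤ Y ∧ (((posDWithLen σ).cost (spare σ) + 8 : ℕ) : ℝ) *
    (6 + E + E * (1 + 2 * spare σ)) = Y :=
    ⟨_, by clear * - hE0; positivity, rfl⟩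
  obtain ⟨X, hX0, hX⟩ : ∃ X : ℝ, 0 ≤ X ∧ 9 + 6 * (1 + 2 * (spare σ : ℝ)) = X :=
    ⟨_, by clear * - hc; positivity, rfl⟩
  -- The summands bound, in this order, the disk space, the passes, the time and the page accesses.
  -- `D` takes care of the texts shorter than `N`, for which it bounds time and passes alike.
  refine ⟨S + (D + X) + (D + Y) + (6 * |K| + 2 * S * (D + X)),
    fun n d w M B T hT hn hdn hcd hnw hwK hMn hB hBM hBK => ?_⟩
  have hσ := two_le_of_isText hT hn
  have hM : 1 ≤ M := hB.trans hBM
  obtain ⟨l, hl⟩ : ∃ l, Real.logb 2 n = l := ⟨_, rfl⟩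
  have hn' : (2 : ℝ) ≤ n := by exact_mod_cast hn
  have hM' : (1 : ℝ) ≤ M := by exact_mod_cast hM
  have hMn' : (M : ℝ) ≤ n := by exact_mod_cast hMn
  have hB' : (1 : ℝ) ≤ B := by exact_mod_cast hB
  have hl1 : 1 ≤ l := by
    rw [← hl, Real.le_logb_iff_rpow_le (by norm_num) (by linarith)]
    simpa using hn'
  have hln : l ≤ n := by
    rw [← hl, Real.logb_le_iff_le_rpow (by norm_num) (by linarith), Real.rpow_natCast]
    exact_mod_cast Nat.lt_two_pow_self.le
  have hd : 0 < d := by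
    have : (0 : ℝ) < d := lt_of_lt_of_le (by rw [hl]; positivity) hcd
    exact_mod_cast this
  have hwK' : (w : ℝ) ≤ |K| * l := by
    rw [← hl]
    exact hwK.trans (mul_le_mul_of_nonneg_right (le_abs_self K) (by rw [hl]; linarith))
  have hBK' : (B : ℝ) * Real.logb 2 n ≤ |K| * n :=
    hBK.trans (mul_le_mul_of_nonneg_right (le_abs_self K) (by linarith))
  -- Here the sampling step enters: as `w` is at most `|K| / c` times `d`, the `n / d` words of the
  -- output take O(n) bits.
  have hout : (n / d : ℕ) * (w : ℝ) ≤ |K| / c * n := by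
    have hd' : (0 : ℝ) < d := by exact_mod_cast hd
    have hw : (w : ℝ) ≤ |K| / c * d := by
      rw [hl] at hcd
      calc (w : ℝ) ≤ |K| / c * (c * l) := by field_simp; exact hwK'
        _ ≤ _ := by gcongr
    calc (n / d : ℕ) * (w : ℝ) ≤ n / d * (|K| / c * d) :=
          mul_le_mul Nat.cast_div_le hw (by positivity) (by positivity)
      _ = _ := by field_simp
  have hsize : ((posMachine σ n d w M B).size .input : ℝ) + (posMachine σ n d w M B).size .output
      + (posMachine σ n d w M B).size .work ≤ S * n := by
    change ((n * Nat.clog 2 σ : ℕ) : ℝ) + (n / d * w : ℕ) + n ≤ S * n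
    rw [hcl, ← hS]
    push_cast
    linarith
  have h1 : (1 : ℝ) ≤ n / M := by rwa [one_le_div (by linarith)]
  have h2 : (n : ℝ) ^ 2 / M = n * (n / M) := by ring
  have h3 : (1 : ℝ) ≤ n ^ 2 / M := by rw [h2]; nlinarith
  have key : ∃ s : State, Exec (posMachine σ n d w M B)
      (dispatch (fun n => (lookup σ n).compile 0) (posDCmd σ) 0 N) (posInit T d w M) s ∧
      SuffixIndex.HoldsPosD T d w (s.tape .output) ∧ (s.passes : ℝ) ≤ (D + X) * (n / M) ∧
      (s.time : ℝ) ≤ (D + Y) * (n ^ 2 / M) := by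
    obtain ⟨i, hi, hex⟩ := dispatch_exec (m := posMachine σ n d w M B)
      (f := fun n => (lookup σ n).compile 0) (g := posDCmd σ) (k := 0) (j := N)
      (n := n) (s := posInit T d w M) rfl hnw (Nat.zero_le n)
    have hi' : (i : ℝ) ≤ 4 * N := by exact_mod_cast hi
    rw [Nat.zero_add] at hex
    by_cases hnN : n < N
    · rw [if_pos hnN] at hex
      obtain ⟨t, ht, hpos, htime⟩ := lookup_exec (M := M) (B := B) (k := i) hσ hn hd hnw T
      have ht' := hex t ht
      have hpass := ht'.passes_le_time
      have hnN' : (n : ℝ) ≤ N := by exact_mod_cast hnN.le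
      have hcost : (lookup σ n).cost 0 + 1 ≤ lookupCost σ N :=
        Finset.single_le_sum (f := fun n => (lookup σ n).cost 0 + 1) (fun _ _ => Nat.zero_le _)
          (Finset.mem_range.2 hnN)
      have hcost' : (((lookup σ n).cost 0 + 1 : ℕ) : ℝ) ≤ lookupCost σ N := by exact_mod_cast hcost
      have hwN : (w : ℝ) ≤ |K| * N := hwK'.trans (by gcongr; linarith)
      have htD : (t.time : ℝ) ≤ D := by
        calc (t.time : ℝ) ≤ (((lookup σ n).cost 0 + 1 : ℕ) : ℝ) *
              (i + 4 * (n * cl) + n * (13 * w + 20) + 1) := by rw [← hcl]; exact_mod_cast htime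
          _ ≤ D := hD ▸ lookup_time_le hcost' (Nat.cast_nonneg _) hi' (Nat.cast_nonneg _) hnN'
              (Nat.cast_nonneg _) hwN (Nat.cast_nonneg _) (Nat.cast_nonneg _)
      have hpD : (t.passes : ℝ) ≤ D := by
        refine le_trans ?_ htD
        have e1 : (posInit T d w M).passes = 0 := rfl
        have e2 : (posInit T d w M).time = 0 := rfl
        rw [e1, e2] at hpass
        exact_mod_cast (by omega : t.passes ≤ t.time)
      refine ⟨t, ht', hpos, ?_, ?_⟩
      · calc (t.passes : ℝ) ≤ D + X := by linarith
          _ ≤ _ := le_mul_of_one_le_right (by linarith) h1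
      · calc (t.time : ℝ) ≤ D + Y := by linarith
          _ ≤ _ := le_mul_of_one_le_right (by linarith) h3
    · rw [if_neg hnN] at hex
      obtain ⟨t, ht, hpos, hpass, htime⟩ := posD_exec (M := M) (B := B) (k := i) hσ
        (by omega) hd hnw
        hMn T
      obtain ⟨b, hb⟩ : ∃ b, (n + blockLen σ M - 1) / blockLen σ M = b := ⟨_, rfl⟩
      have hbl := blocks_le (σ := σ) hM hMn
      rw [hb] at hpass htime hbl
      have hnN' : (N : ℝ) ≤ n := by exact_mod_cast not_lt.1 hnN
      have hpt := passTime_le (σ := σ) (cl := cl) hout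
      rw [hE] at hpt
      refine ⟨t, hex t ht, hpos, ?_, ?_⟩
      · have hpass' : (t.passes : ℝ) ≤ 9 + 6 * b := by exact_mod_cast hpass
        have h4 : (D + X) * (n / M) = D * (n / M) + 9 * (n / M) +
            6 * ((1 + 2 * (spare σ : ℝ)) * (n / M)) := by rw [← hX]; ring
        have h5 : 0 ≤ D * (n / M) := mul_nonneg hD0 (by linarith)
        linarith
      · have htime' : (t.time : ℝ) ≤ (((posDWithLen σ).cost (spare σ) + 8 : ℕ) : ℝ) *
            (i + 2 + passTime σ cl n d w + passTime σ cl n d w * b) := by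
          rw [← hcl]
          exact_mod_cast htime
        calc (t.time : ℝ) ≤ _ := htime'
          _ ≤ Y * (n * (n / M)) := hY ▸ posD_time_le (Nat.cast_nonneg _) hi' hn' hnN' h1 hpt hE0
              (Nat.cast_nonneg _) hbl
          _ ≤ _ := by rw [h2]; exact mul_le_mul_of_nonneg_right (by linarith) (by linarith)
  obtain ⟨s, hs, hpos, hpass, htime⟩ := key
  have hpage := pageAccesses_le hs hn hnw hM hMn hB hBK' hsize hpass hS0
  have hpg0 : 0 ≤ 6 * |K| + 2 * S * (D + X) := by positivity
  have hlog : 0 ≤ Real.logb 2 n := by rw [hl]; linarith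
  refine ⟨s, hs, hpos, ?_, ?_, ?_, ?_, ?_⟩
  · have hwork : ((posMachine σ n d w M B).size .work : ℝ) = n := rfl
    rw [hwork]
    have : (0 : ℝ) ≤ ((posMachine σ n d w M B).size .input : ℝ) +
      (posMachine σ n d w M B).size .output := by positivity
    linarith
  · exact hsize.trans (mul_le_mul_of_nonneg_right (by linarith) (by linarith))
  · exact hpass.trans (mul_le_mul_of_nonneg_right (by linarith) (by linarith))
  · exact hpage.trans (mul_le_mul_of_nonneg_right (by linarith) (by positivity))
  · exact htime.trans (mul_le_mul_of_nonneg_right (by linarith) (by positivity))
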